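/- Let $\Lambda_c=\mathbb C\langle X,Y,Z\rangle/(Z^2-1,\,XZ+ZX,\,YZ+ZY,\,[X^2,Y],\,[Y^2,X])$ be the conifold algebra, with orthogonal idempotents $e_1=\frac12(1+Z)$, $e_2=\frac12(1-Z)$, and let $\alpha=(1,1)$, $\mathrm{GL}(\alpha)=\mathbb C^*\times\mathbb C^*$. Let $\mathrm{rep}_\alpha\Lambda_c$ be the affine scheme which represents the algebra homomorphisms $\Lambda_c\to M_2$ with $e_i\mapsto E_{ii}$. Let $Q$ be the quiver with two vertices $1,2$, two arrows $x_3,y_3:1\to2$ and two arrows $x_2,y_2:2\to1$; so $\mathbb C[\mathrm{rep}_\alpha Q]=\mathbb C[x_2,x_3,y_2,y_3]$. In both cases $\mathrm{GL}(\alpha)$ acts by base change. For $\theta=(t_1,t_2)\in\{(-1,1),(1,-1)\}$ and $\chi_\theta(g_1,g_2)=g_1^{t_1}g_2^{t_2}$, a function $f$ is a $\theta$-semi-invariant of weight $l\ge0$ if $f(g\cdot V)=\chi_\theta(g)^l f(V)$ for all $g\in\mathrm{GL}(\alpha)$; the ring of $\theta$-semi-invariants is graded by the weight. A representation $V$ is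 $\theta$-semistable (resp. $\theta$-stable) if $\theta\cdot\dim W\ge0$ (resp. $>0$) for all proper (resp. proper nonzero) subrepresentations $W$. Let $X_c=\operatorname{Spec}\mathbb C[a,b,c,d]/(ad-bc)$ be the conifold. Then: 1. $\mathrm{rep}_\alpha\Lambda_c\cong\mathrm{rep}_\alpha Q=\mathbb A^4$, $\mathrm{GL}(\alpha)$-equivariantly, by $X\mapsto\begin{pmatrix}0&x_2\\x_3&0\end{pmatrix}$, $Y\mapsto\begin{pmatrix}0&y_2\\y_3&0\end{pmatrix}$, $Z\mapsto\begin{pmatrix}1&0\\0&-1\end{pmatrix}$, and this induces isomorphisms between the $\operatorname{Proj}$'s of the two rings of $\theta$-semi-invariants, for $\theta=(-1,1)$ and for $\theta=(1,-1)$. 2. Let $\theta=(-1,1)$, and let $M_\theta$ be $\operatorname{Proj}$ of the ring of $\theta$-semi-invariants. - An $\alpha$-dimensional representation of $\Lambda_c$ is $\theta$-stable if and only if it is $\theta$-semistable, and the closed points of the $\operatorname{Proj}$ of the ring of $\theta$-semi-invariants on $\mathrm{rep}_\alpha\Lambda_c$ are in bijection with the isomorphism classes of $\theta$-stable $\alpha$-dimensional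 representations $V$: a semi-invariant $f$ vanishes at the point of $V$ if and only if $f(V)=0$. - The ring of $\theta$-semi-invariants of $\mathrm{rep}_\alpha Q$ is $\mathbb C[x_2x_3,x_2y_3,x_3y_2,y_2y_3][x_3,y_3]\subset\mathbb C[x_2,x_3,y_2,y_3]$, its part of weight $l$ is the module over the ring of invariants generated by the monomials of degree $l$ in $x_3,y_3$, and its part of weight $0$, the ring of invariants, is isomorphic to $\mathbb C[a,b,c,d]/(ad-bc)$ by $(a,b,c,d)\mapsto(x_2x_3,x_2y_3,x_3y_2,y_2y_3)$. This gives a morphism $\pi:M_\theta\to X_c$. - With $[e:f]=[x_3:y_3]$, the ring of $\theta$-semi-invariants is $\mathbb C[a,b,c,d][e,f]/(ad-bc,af-be,cf-de)$, and $M_\theta$ is isomorphic to the closed subscheme $\mathbb V(ad-bc,af-be,cf-de)\subset\mathbb A^4\times\mathbb P^1$, where $\pi$ becomes the projection to $\mathbb A^4$. - $\pi$ is a small resolution of the conifold: $M_\theta$ is integral and smooth of dimension $3$ over $\mathbb C$, $\pi$ is projective, surjective and birational, and an isomorphism over the complement of the origin, the fiber of $\pi$ over the origin is isomorphic to $\mathbb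 P^1$, and all points of $M_\theta$ over the origin have codimension at least $2$. 3. For $\theta'=(1,-1)$ the same holds, with $x_2,y_2$ in place of $x_3,y_3$ as the generators of weight one, $[e:f]=[x_2:y_2]$, and the equations $ad-bc,\ af-ce,\ bf-de$. This gives a small resolution $\pi':M_{\theta'}\to X_c$. 4. $\pi$ and $\pi'$ are related by the Atiyah flop: there are morphisms $\phi,\phi'$ over $X_c$ from the blow-up of $X_c$ in the origin to $M_\theta$ and to $M_{\theta'}$, and isomorphisms of the fibers over the origin of the blow-up, $M_\theta$, $M_{\theta'}$ with $\mathbb P^1\times\mathbb P^1$, $\mathbb P^1$, $\mathbb P^1$ over $\mathbb C$, under which $\phi$ and $\phi'$ become the first and the second projection; and there is no morphism over $X_c$ from $M_\theta$ to $M_{\theta'}$ or from $M_{\theta'}$ to $M_\theta$. -/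

import Mathlib

open CategoryTheory CategoryTheory.Limits AlgebraicGeometry

noncomputable section

namespace ConifoldModuli

/-! ### The graded ring `⨁ F l` of a multiplicative family of submodules -/

section GradedRingOfFamily

variable {k A : Type} [CommRing k] [CommRing A] [Algebra k A]

/-- For submodules `F l ⊆ A` with `1 ∈ F 0` and `F i * F j ⊆ F (i + j)`, the graded ring
`⨁ l, F l`, realised as the ring of polynomials `∑ f_l t ^ l` in `A[t]` with `f_l ∈ F l`. -/
def gradedRing (F : ℕ → Submodule k A) [SetLike.GradedMonoid F] :
    Subalgebra k (Polynomial A) where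
  carrier := {p | ∀ l, p.coeff l ∈ F l}
  mul_mem' := by
    intro p q hp hq l
    rw [Polynomial.coeff_mul]
    refine Submodule.sum_mem _ fun ij hij => ?_
    rw [← Finset.HasAntidiagonal.mem_antidiagonal.mp hij]
    exact SetLike.mul_mem_graded (hp _) (hq _)
  add_mem' := by
    intro p q hp hq l
    rw [Polynomial.coeff_add]
    exact add_mem (hp l) (hq l)
  algebraMap_mem' := by
    intro r l
    rw [Polynomial.algebraMap_apply, Polynomial.coeff_C]
    split_ifs with h
    · subst h
      exact SetLike.algebraMap_mem_graded F r
    · exact zero_mem _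

/-- The homogeneous elements `f t ^ l`, `f ∈ F l`, of degree `l` of `gradedRing F`. -/
def grading (F : ℕ → Submodule k A) [SetLike.GradedMonoid F] (l : ℕ) :
    Submodule k (gradedRing F) where
  carrier := {p | ∀ m, m ≠ l → (p : Polynomial A).coeff m = 0}
  zero_mem' := by intro m _; simp
  add_mem' := by
    intro p q hp hq m hm
    simp [hp m hm, hq m hm]
  smul_mem' := by
    intro c p hp m hm
    simp [hp m hm]

/-- The element `f t ^ l` of `gradedRing F`, for `f ∈ F l`. -/
def homog (F : ℕ → Submodule k A) [SetLike.GradedMonoid F] (l : ℕ) (f : F l) :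
    gradedRing F :=
  ⟨Polynomial.monomial l (f : A), by
    intro m
    rw [Polynomial.coeff_monomial]
    split_ifs with h
    · subst h; exact f.2
    · exact zero_mem _⟩

theorem homog_mem (F : ℕ → Submodule k A) [SetLike.GradedMonoid F] (l : ℕ) (f : F l) :
    homog F l f ∈ grading F l := by
  intro m hm
  exact Polynomial.coeff_monomial_of_ne _ hm

instance (F : ℕ → Submodule k A) [SetLike.GradedMonoid F] :
    SetLike.GradedMonoid (grading F) where
  one_mem := by
    intro m hm
    simp [Polynomial.coeff_one, hm]
  mul_mem := by
    intro i j p q hp hq m hm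
    change ((p : Polynomial A) * (q : Polynomial A)).coeff m = 0
    rw [Polynomial.coeff_mul]
    refine Finset.sum_eq_zero fun ab hab => ?_
    by_cases ha : ab.1 = i
    · have hb : ab.2 ≠ j := by
        intro hb
        exact hm (by rw [← Finset.HasAntidiagonal.mem_antidiagonal.mp hab, ha, hb])
      rw [hq _ hb, mul_zero]
    · rw [hp _ ha, zero_mul]

theorem grading_isInternal (F : ℕ → Submodule k A) [SetLike.GradedMonoid F] :
    DirectSum.IsInternal (grading F) := by
  classical
  have key : ∀ (v : DirectSum ℕ fun l => grading F l) (n : ℕ),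
      ((DirectSum.coeAddMonoidHom (grading F) v : gradedRing F) : Polynomial A).coeff n
        = ((v n : gradedRing F) : Polynomial A).coeff n := by
    intro v n
    induction v using DirectSum.induction_on with
    | zero => simp
    | of i x =>
      rw [DirectSum.coeAddMonoidHom_of]
      by_cases h : n = i
      · subst h; rw [DirectSum.of_eq_same]
      · rw [DirectSum.of_eq_of_ne _ _ _ h, x.2 n h]; simp
    | add x y hx hy => simp [hx, hy]
  constructor
  · intro v w hvw
    refine DFinsupp.ext fun n => Subtype.ext (Subtype.ext (Polynomial.ext fun m => ?_))
    by_cases hm : m = n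
    · subst hm
      rw [← key v, ← key w, hvw]
    · rw [(v n).2 m hm, (w n).2 m hm]
  · intro p
    refine ⟨∑ l ∈ (p : Polynomial A).support,
      DirectSum.of (fun l => grading F l) l
        ⟨homog F l ⟨(p : Polynomial A).coeff l, p.2 l⟩, homog_mem F l _⟩, ?_⟩
    rw [map_sum]
    simp only [DirectSum.coeAddMonoidHom_of]
    apply Subtype.ext
    rw [AddSubmonoidClass.coe_finsetSum]
    exact ((p : Polynomial A).as_sum_support).symm

instance (F : ℕ → Submodule k A) [SetLike.GradedMonoid F] : GradedAlgebra (grading F) :=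
  { DirectSum.IsInternal.chooseDecomposition _ (grading_isInternal F) with }

end GradedRingOfFamily

/-- The structure morphism `Proj 𝒜 ⟶ Spec k` for a graded `k`-algebra. -/
def projStr (k : Type) [CommRing k] {B : Type} [CommRing B] [Algebra k B]
    (𝒜 : ℕ → Submodule k B) [GradedAlgebra 𝒜] : Proj 𝒜 ⟶ Spec (.of k) :=
  Proj.toSpecZero 𝒜 ≫ Spec.map (CommRingCat.ofHom (algebraMap k (𝒜 0)))

/-! ### Projective spaces over affine schemes, and closed subschemes of them -/

/-- The grading of `R[X₀, …, Xₙ]` by the total degree in `X₀, …, Xₙ`. -/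
abbrev projGrading (n : ℕ) (R : Type) [CommRing R] :
    ℕ → Submodule R (MvPolynomial (Fin (n + 1)) R) :=
  MvPolynomial.homogeneousSubmodule (Fin (n + 1)) R

instance (n : ℕ) (R : Type) [CommRing R] : GradedAlgebra (projGrading n R) :=
  MvPolynomial.gradedAlgebra

/-- `ℙⁿ_R = Spec R × ℙⁿ`, as `Proj R[X₀, …, Xₙ]`. -/
abbrev ProjSpace (n : ℕ) (R : Type) [CommRing R] : Scheme := Proj (projGrading n R)

/-- The projection `ℙⁿ_R ⟶ Spec R`. -/
def ProjSpace.str (n : ℕ) (R : Type) [CommRing R] : ProjSpace n R ⟶ Spec (.of R) :=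
  projStr R (projGrading n R)

theorem X_mem (n : ℕ) (R : Type) [CommRing R] (i : Fin (n + 1)) :
    (MvPolynomial.X i : MvPolynomial (Fin (n + 1)) R) ∈ projGrading n R 1 :=
  (MvPolynomial.mem_homogeneousSubmodule _ _).mpr (MvPolynomial.isHomogeneous_X R i)

/-- The affine chart `X i ≠ 0` of `ℙⁿ_R`. -/
def ProjSpace.chart (n : ℕ) (R : Type) [CommRing R] (i : Fin (n + 1)) :
    (ProjSpace n R).affineOpens :=
  ⟨Proj.basicOpen (projGrading n R) (MvPolynomial.X i),
    Proj.isAffineOpen_basicOpen (projGrading n R) _ (X_mem n R i) one_pos⟩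

/-- The function `G / X i ^ d` on the chart `X i ≠ 0`, for `G` homogeneous of degree `d`. -/
def ProjSpace.dehomog (n : ℕ) (R : Type) [CommRing R] (i : Fin (n + 1)) (d : ℕ)
    (G : MvPolynomial (Fin (n + 1)) R) (hG : G ∈ projGrading n R d) :
    Γ(ProjSpace n R, (ProjSpace.chart n R i).1) :=
  (Proj.awayToSection (projGrading n R) (MvPolynomial.X i)).hom
    (HomogeneousLocalization.Away.mk (projGrading n R) (X_mem n R i) d G (by simpa using hG))

/-- The ideal sheaf generated by a set `E` of homogeneous polynomials: the smallest one which
contains all `G / X i ^ d`, for `G ∈ E` of degree `d`, on every chart `X i ≠ 0`. -/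
def idealSheaf (n : ℕ) (R : Type) [CommRing R] (E : Set (MvPolynomial (Fin (n + 1)) R)) :
    (ProjSpace n R).IdealSheafData :=
  sInf {J | ∀ (i : Fin (n + 1)) (d : ℕ), ∀ G ∈ E, ∀ hG : G ∈ projGrading n R d,
    ProjSpace.dehomog n R i d G hG ∈ J.ideal (ProjSpace.chart n R i)}

/-- The closed subscheme `𝕍(E) ⊆ ℙⁿ_R` cut out by a set `E` of homogeneous polynomials. -/
def vanishing (n : ℕ) (R : Type) [CommRing R] (E : Set (MvPolynomial (Fin (n + 1)) R)) :
    Scheme := (idealSheaf n R E).subscheme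

/-- The inclusion `𝕍(E) ⟶ ℙⁿ_R`. -/
def vanishing.ι (n : ℕ) (R : Type) [CommRing R] (E : Set (MvPolynomial (Fin (n + 1)) R)) :
    vanishing n R E ⟶ ProjSpace n R := (idealSheaf n R E).subschemeι

/-- A morphism to an affine scheme `Spec R` is projective if it factors as a closed immersion
into some `ℙⁿ_R` followed by the projection. -/
def IsProjective {M : Scheme} {R : Type} [CommRing R] (π : M ⟶ Spec (.of R)) : Prop :=
  ∃ (n : ℕ) (j : M ⟶ ProjSpace n R), IsClosedImmersion j ∧ j ≫ ProjSpace.str n R = π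

/-! ### Semi-invariants of the group `GL(α) = ℂ* × ℂ*` for the dimension vector `α = (1, 1)` -/

/-- `GL(α) = GL₁ × GL₁`. -/
abbrev GLα : Type := Fin 2 → ℂˣ

/-- The character `χ_θ (g₁, g₂) = g₁ ^ t₁ * g₂ ^ t₂` for `θ = (t₁, t₂)`. -/
def χ (θ : Fin 2 → ℤ) (g : GLα) : ℂˣ := ∏ i, g i ^ θ i

/-- Let `GL(α)` act on an affine scheme with coordinate ring `A`, and let `act g f` be the
function `V ↦ f (g • V)`. Then `f` is a `θ`-semi-invariant of weight `l` if
`f (g • V) = χ_θ (g) ^ l * f V` for all `g`. -/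
def semiInv {A : Type} [CommRing A] [Algebra ℂ A] (act : GLα → A →ₐ[ℂ] A) (θ : Fin 2 → ℤ)
    (l : ℕ) : Submodule ℂ A where
  carrier := {f | ∀ g, act g f = ((χ θ g ^ l : ℂˣ) : ℂ) • f}
  zero_mem' := by intro g; simp
  add_mem' := by
    intro f f' hf hf' g
    rw [map_add, hf g, hf' g, smul_add]
  smul_mem' := by
    intro c f hf g
    rw [map_smul, hf g, smul_comm]

instance {A : Type} [CommRing A] [Algebra ℂ A] (act : GLα → A →ₐ[ℂ] A) (θ : Fin 2 → ℤ) :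
    SetLike.GradedMonoid (semiInv act θ) where
  one_mem := by intro g; simp
  mul_mem := by
    intro i j f f' hf hf' g
    rw [map_mul, hf g, hf' g, smul_mul_smul_comm, pow_add]
    simp

/-- The ring of `θ`-semi-invariants `⨁ l, {f | f (g • V) = χ_θ (g) ^ l * f V for all g}`. -/
abbrev SemiInvRing {A : Type} [CommRing A] [Algebra ℂ A] (act : GLα → A →ₐ[ℂ] A)
    (θ : Fin 2 → ℤ) : Type := gradedRing (semiInv act θ)

/-- `Proj` of the ring of `θ`-semi-invariants. -/
abbrev ModuliSpace {A : Type} [CommRing A] [Algebra ℂ A] (act : GLα → A →ₐ[ℂ] A)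
    (θ : Fin 2 → ℤ) : Scheme := Proj (grading (semiInv act θ))

/-! ### Representation schemes of algebras with two idempotents, dimension vector `(1, 1)` -/

section Rep

variable {Λ : Type} [Ring Λ] [Algebra ℂ Λ] (e : Fin 2 → Λ)

/-- The relations which say that `a ↦ (X (a, i, j))` is a homomorphism of `ℂ`-algebras from `Λ`
to the `2 × 2` matrices which maps `e i` to the matrix unit `E i i`. -/
inductive RepRel : MvPolynomial (Λ × Fin 2 × Fin 2) ℂ → Prop
  | scalar (c : ℂ) (i j : Fin 2) : RepRel
      (MvPolynomial.X (algebraMap ℂ Λ c, i, j) - if i = j then MvPolynomial.C c else 0)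
  | add (a b : Λ) (i j : Fin 2) : RepRel
      (MvPolynomial.X (a + b, i, j) - (MvPolynomial.X (a, i, j) + MvPolynomial.X (b, i, j)))
  | mul (a b : Λ) (i j : Fin 2) : RepRel
      (MvPolynomial.X (a * b, i, j) -
        ∑ m, MvPolynomial.X (a, i, m) * MvPolynomial.X (b, m, j))
  | idem (m i j : Fin 2) : RepRel
      (MvPolynomial.X (e m, i, j) - if i = m ∧ j = m then 1 else 0)

/-- The coordinate ring `ℂ[rep_α Λ]` of the scheme of `α`-dimensional representations of `Λ`,
`α = (1, 1)`: it represents the functor which sends a commutative `ℂ`-algebra `B` to the set of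
algebra homomorphisms `Λ → M₂(B)` with `e i ↦ E i i`. -/
abbrev RepRing : Type :=
  MvPolynomial (Λ × Fin 2 × Fin 2) ℂ ⧸ Ideal.span {p | RepRel e p}

/-- The `(i, j)`-entry of the universal representation at `a ∈ Λ`. -/
def RepRing.entry (a : Λ) (i j : Fin 2) : RepRing e :=
  Ideal.Quotient.mk _ (MvPolynomial.X (a, i, j))

theorem RepRing.mk_eq_zero {p : MvPolynomial (Λ × Fin 2 × Fin 2) ℂ} (hp : RepRel e p) :
    (Ideal.Quotient.mk (Ideal.span {p | RepRel e p})) p = 0 :=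
  Ideal.Quotient.eq_zero_iff_mem.mpr (Ideal.subset_span hp)

/-- Families of entries in `B` which satisfy the relations define a homomorphism to `B`. -/
def RepRing.lift {B : Type} [CommRing B] [Algebra ℂ B] (x : Λ → Matrix (Fin 2) (Fin 2) B)
    (hc : ∀ c, x (algebraMap ℂ Λ c) = algebraMap ℂ _ c)
    (ha : ∀ a b, x (a + b) = x a + x b) (hm : ∀ a b, x (a * b) = x a * x b)
    (he : ∀ i, x (e i) = Matrix.single i i 1) : RepRing e →ₐ[ℂ] B :=
  Ideal.Quotient.liftₐ _ (MvPolynomial.aeval fun t => x t.1 t.2.1 t.2.2) (by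
    intro p hp
    rw [← RingHom.mem_ker]
    refine (Ideal.span_le.mpr ?_ : Ideal.span {p | RepRel e p} ≤ RingHom.ker _) hp
    rintro q (⟨c, i, j⟩ | ⟨a, b, i, j⟩ | ⟨a, b, i, j⟩ | ⟨m, i, j⟩)
    · rw [SetLike.mem_coe, RingHom.mem_ker]
      simp only [map_sub, MvPolynomial.aeval_X, hc, Matrix.algebraMap_matrix_apply]
      split_ifs <;> simp
    · rw [SetLike.mem_coe, RingHom.mem_ker]
      simp [ha]
    · rw [SetLike.mem_coe, RingHom.mem_ker]
      simp [hm, Matrix.mul_apply]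
    · rw [SetLike.mem_coe, RingHom.mem_ker]
      simp only [map_sub, MvPolynomial.aeval_X, he, Matrix.single_apply]
      rw [sub_eq_zero]
      by_cases h : i = m ∧ j = m
      · rw [if_pos h, if_pos ⟨h.1.symm, h.2.symm⟩, map_one]
      · rw [if_neg h, if_neg (fun h' => h ⟨h'.1.symm, h'.2.symm⟩), map_zero])

/-- The action of `GL(α)` on `rep_α Λ` by base change, `(g • V) a = g * V a * g⁻¹`: the
homomorphism sends a function `f` to `V ↦ f (g • V)`. -/
def repAct (g : GLα) : RepRing e →ₐ[ℂ] RepRing e :=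
  RepRing.lift e
    (fun a => Matrix.of fun i j => ((g i * (g j)⁻¹ : ℂˣ) : ℂ) • RepRing.entry e a i j)
    (by
      intro c
      ext i j
      have h := RepRing.mk_eq_zero e (RepRel.scalar c i j)
      rw [map_sub, sub_eq_zero] at h
      rw [Matrix.of_apply, RepRing.entry, h, Matrix.algebraMap_matrix_apply]
      split_ifs with hij
      · subst hij
        simp [Algebra.algebraMap_eq_smul_one, ← MvPolynomial.algebraMap_eq]
        rfl
      · simp)
    (by
      intro a b
      ext i j
      have h := RepRing.mk_eq_zero e (RepRel.add a b i j)
      rw [map_sub, sub_eq_zero, map_add] at h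
      simp only [Matrix.of_apply, Matrix.add_apply, RepRing.entry, h, smul_add])
    (by
      intro a b
      ext i j
      have h := RepRing.mk_eq_zero e (RepRel.mul a b i j)
      rw [map_sub, sub_eq_zero, map_sum] at h
      simp only [Matrix.of_apply, Matrix.mul_apply, RepRing.entry, h, Finset.smul_sum]
      refine Finset.sum_congr rfl fun m _ => ?_
      rw [map_mul, smul_mul_smul_comm]
      congr 1
      rw [← Units.val_mul]
      congr 1
      group)
    (by
      intro m
      ext i j
      have h := RepRing.mk_eq_zero e (RepRel.idem m i j)
      rw [map_sub, sub_eq_zero] at h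
      rw [Matrix.of_apply, RepRing.entry, h, Matrix.single_apply]
      by_cases hij : i = m ∧ j = m
      · obtain ⟨rfl, rfl⟩ := hij
        simp
      · rw [if_neg hij, if_neg (fun h' => hij ⟨h'.1.symm, h'.2.symm⟩), map_zero, smul_zero])

/-- A representation of `Λ` in `rep_α Λ`, `α = (1, 1)`. -/
structure Rep where
  hom : Λ →ₐ[ℂ] Matrix (Fin 2) (Fin 2) ℂ
  map_idem : ∀ i, hom (e i) = Matrix.single i i 1

variable {e}

/-- The value `f V` of a function `f` on `rep_α Λ` at a representation `V`. -/
def Rep.eval (V : Rep e) : RepRing e →ₐ[ℂ] ℂ :=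
  RepRing.lift e V.hom (fun c => V.hom.commutes c) (map_add V.hom) (map_mul V.hom) V.map_idem

/-- `W ⊆ ℂ²` is a subrepresentation of `V`. -/
def Rep.IsSubrep (V : Rep e) (W : Submodule ℂ (Fin 2 → ℂ)) : Prop :=
  ∀ a : Λ, ∀ w ∈ W, (V.hom a).mulVec w ∈ W

/-- The dimension vector `i ↦ dim (e i) W` of a subrepresentation `W` of `V`. -/
def Rep.dimVec (V : Rep e) (W : Submodule ℂ (Fin 2 → ℂ)) (i : Fin 2) : ℕ :=
  Module.finrank ℂ (W.map (V.hom (e i)).mulVecLin)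

/-- `V` is `θ`-semistable: `θ · dim W ≥ 0` for every proper subrepresentation `W`. -/
def Rep.IsSemistable (θ : Fin 2 → ℤ) (V : Rep e) : Prop :=
  ∀ W, V.IsSubrep W → W ≠ ⊤ → 0 ≤ ∑ i, θ i * (V.dimVec W i : ℤ)

/-- `V` is `θ`-stable: `θ · dim W > 0` for every proper nonzero subrepresentation `W`. -/
def Rep.IsStable (θ : Fin 2 → ℤ) (V : Rep e) : Prop :=
  ∀ W, V.IsSubrep W → W ≠ ⊥ → W ≠ ⊤ → 0 < ∑ i, θ i * (V.dimVec W i : ℤ)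

/-- Isomorphism of representations. -/
def Rep.Iso (V V' : Rep e) : Prop :=
  ∃ P : GL (Fin 2) ℂ, ∀ a : Λ, P.1 * V.hom a = V'.hom a * P.1

/-- The point `p` of `Proj` of the ring of `θ`-semi-invariants is the image of the
representation `V`: a homogeneous semi-invariant `f` vanishes at `p` iff `f V = 0`. -/
def Rep.Represents (θ : Fin 2 → ℤ) (V : Rep e) (p : ModuliSpace (repAct e) θ) : Prop :=
  ∀ (l : ℕ) (f : semiInv (repAct e) θ l),
    p ∈ Proj.basicOpen (grading (semiInv (repAct e) θ)) (homog _ l f) ↔ V.eval f.1 ≠ 0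

variable (e)

/-- For representations of dimension vector `(1, 1)`, semistable and stable agree, and the closed
points of `Proj` of the ring of `θ`-semi-invariants are in bijection with the isomorphism classes
of `θ`-stable representations. -/
structure ClassifiesStable (θ : Fin 2 → ℤ) : Prop where
  stable_iff : ∀ V : Rep e, V.IsStable θ ↔ V.IsSemistable θ
  point : ∀ V : Rep e, V.IsStable θ → ∃! p : ModuliSpace (repAct e) θ,
    V.Represents θ p
  closed : ∀ (V : Rep e) (p : ModuliSpace (repAct e) θ),
    V.IsStable θ → V.Represents θ p → IsClosed ({p} : Set (ModuliSpace (repAct e) θ))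
  surj : ∀ p : ModuliSpace (repAct e) θ, IsClosed ({p} : Set (ModuliSpace (repAct e) θ)) →
    ∃ V : Rep e, V.IsStable θ ∧ V.Represents θ p
  inj : ∀ (V V' : Rep e) (p : ModuliSpace (repAct e) θ), V.IsStable θ → V'.IsStable θ →
    V.Represents θ p → (V'.Represents θ p ↔ V.Iso V')

end Rep

/-! ### The conifold algebra -/

/-- The defining relations of the conifold algebra, with `X`, `Y`, `Z` the generators
`0`, `1`, `2`. -/
inductive ConifoldRel : FreeAlgebra ℂ (Fin 3) → FreeAlgebra ℂ (Fin 3) → Prop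
  | xz : ConifoldRel (FreeAlgebra.ι ℂ 0 * FreeAlgebra.ι ℂ 2)
      (-(FreeAlgebra.ι ℂ 2 * FreeAlgebra.ι ℂ 0))
  | yz : ConifoldRel (FreeAlgebra.ι ℂ 1 * FreeAlgebra.ι ℂ 2)
      (-(FreeAlgebra.ι ℂ 2 * FreeAlgebra.ι ℂ 1))
  | xxy : ConifoldRel (FreeAlgebra.ι ℂ 0 ^ 2 * FreeAlgebra.ι ℂ 1)
      (FreeAlgebra.ι ℂ 1 * FreeAlgebra.ι ℂ 0 ^ 2)
  | yyx : ConifoldRel (FreeAlgebra.ι ℂ 1 ^ 2 * FreeAlgebra.ι ℂ 0)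
      (FreeAlgebra.ι ℂ 0 * FreeAlgebra.ι ℂ 1 ^ 2)
  | zz : ConifoldRel (FreeAlgebra.ι ℂ 2 ^ 2) 1

/-- The conifold algebra `Λ_c`. -/
abbrev ConifoldAlgebra : Type := RingQuot ConifoldRel

/-- The generators `X`, `Y`, `Z` of `Λ_c`. -/
def ConifoldAlgebra.gen (i : Fin 3) : ConifoldAlgebra :=
  RingQuot.mkAlgHom ℂ ConifoldRel (FreeAlgebra.ι ℂ i)

/-- The orthogonal idempotents `(1 + Z) / 2` and `(1 - Z) / 2` of `Λ_c`. -/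
def ConifoldAlgebra.idem : Fin 2 → ConifoldAlgebra :=
  ![(1 / 2 : ℂ) • (1 + ConifoldAlgebra.gen 2), (1 / 2 : ℂ) • (1 - ConifoldAlgebra.gen 2)]

/-! ### The conifold quiver, with dimension vector `(1, 1)` -/

/-- The arrows of the quiver `Q` with two vertices `0`, `1`. -/
inductive Arrow : Type
  | x₂ | x₃ | y₂ | y₃

/-- The arrows `x₃`, `y₃` start in the vertex `0`, and `x₂`, `y₂` start in `1`. -/
def Arrow.src : Arrow → Fin 2
  | x₂ => 1 | x₃ => 0 | y₂ => 1 | y₃ => 0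

/-- The arrows `x₃`, `y₃` end in the vertex `1`, and `x₂`, `y₂` end in `0`. -/
def Arrow.tgt : Arrow → Fin 2
  | x₂ => 0 | x₃ => 1 | y₂ => 0 | y₃ => 1

/-- The coordinate ring `ℂ[rep_α Q] = ℂ[x₂, x₃, y₂, y₃]`. -/
abbrev QRing : Type := MvPolynomial Arrow ℂ

/-- The coordinate function of an arrow. -/
abbrev co (a : Arrow) : QRing := MvPolynomial.X a

/-- The action of `GL(α)` on `rep_α Q` by base change, `(g • V) a = g (tgt a) * V a * g (src a)⁻¹`:
the homomorphism sends a function `f` to `V ↦ f (g • V)`. -/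
def quiverAct (g : GLα) : QRing →ₐ[ℂ] QRing :=
  MvPolynomial.aeval fun a => ((g a.tgt * (g a.src)⁻¹ : ℂˣ) : ℂ) • co a

/-- `Ψ` identifies `rep_α Λ_c` with `rep_α Q`: it is `GL(α)`-equivariant, and it maps the universal
representation to `X ↦ !![0, x₂; x₃, 0]`, `Y ↦ !![0, y₂; y₃, 0]`, `Z ↦ !![1, 0; 0, -1]`. -/
structure IsCanonicalForm (Ψ : RepRing ConifoldAlgebra.idem ≃ₐ[ℂ] QRing) : Prop where
  matX : (Matrix.of fun i j => Ψ (RepRing.entry _ (ConifoldAlgebra.gen 0) i j)) =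
    !![0, co .x₂; co .x₃, 0]
  matY : (Matrix.of fun i j => Ψ (RepRing.entry _ (ConifoldAlgebra.gen 1) i j)) =
    !![0, co .y₂; co .y₃, 0]
  matZ : (Matrix.of fun i j => Ψ (RepRing.entry _ (ConifoldAlgebra.gen 2) i j)) =
    !![1, 0; 0, -1]
  equivariant : ∀ g f, Ψ (repAct _ g f) = quiverAct g (Ψ f)

/-- `Ψ` induces an isomorphism from the moduli space of `Λ_c` to the moduli space of `Q`, through
the homomorphism of graded rings which applies `Ψ⁻¹` to the semi-invariants of every weight. -/
def InducesIsoOfModuli (Ψ : RepRing ConifoldAlgebra.idem ≃ₐ[ℂ] QRing) (θ : Fin 2 → ℤ) : Prop :=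
  ∃ (Φ : GradedRingHom (grading (semiInv quiverAct θ))
      (grading (semiInv (repAct ConifoldAlgebra.idem) θ)))
    (hΦ : HomogeneousIdeal.irrelevant (grading (semiInv (repAct ConifoldAlgebra.idem) θ)) ≤
      (HomogeneousIdeal.irrelevant (grading (semiInv quiverAct θ))).map Φ),
    (∀ s l, (Φ s).1.coeff l = Ψ.symm (s.1.coeff l)) ∧ IsIso (Proj.map Φ hΦ)

/-! ### The conifold, and the structure morphism of the moduli spaces -/

/-- The polynomial ring `ℂ[a, b, c, d]`, with `a, b, c, d` the variables `0, 1, 2, 3`. -/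
abbrev R4 : Type := MvPolynomial (Fin 4) ℂ

/-- The ideal `(a d - b c)` of `ℂ[a, b, c, d]`. -/
abbrev conifoldIdeal : Ideal R4 :=
  Ideal.span {MvPolynomial.X 0 * MvPolynomial.X 3 - MvPolynomial.X 1 * MvPolynomial.X 2}

/-- The coordinate ring `R_c = ℂ[a, b, c, d] / (a d - b c)` of the conifold. -/
def ConifoldRing : Type := R4 ⧸ conifoldIdeal

instance : CommRing ConifoldRing := inferInstanceAs (CommRing (R4 ⧸ conifoldIdeal))

instance : Algebra ℂ ConifoldRing := inferInstanceAs (Algebra ℂ (R4 ⧸ conifoldIdeal))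

/-- The quotient map `ℂ[a, b, c, d] → R_c`. -/
def ConifoldRing.mk : R4 →ₐ[ℂ] ConifoldRing := Ideal.Quotient.mkₐ ℂ conifoldIdeal

/-- The homomorphism from `R_c` which maps `a, b, c, d` to elements with `a d = b c`. -/
def ConifoldRing.lift {B : Type} [CommRing B] [Algebra ℂ B] (x : Fin 4 → B)
    (hx : x 0 * x 3 = x 1 * x 2) : ConifoldRing →ₐ[ℂ] B :=
  Ideal.Quotient.liftₐ conifoldIdeal (MvPolynomial.aeval x) (by
    intro p hp
    rw [← RingHom.mem_ker]
    refine (Ideal.span_le.mpr ?_ : conifoldIdeal ≤ RingHom.ker _) hp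
    rintro q rfl
    rw [SetLike.mem_coe, RingHom.mem_ker]
    simp [hx])

/-- The conifold. -/
abbrev Conifold : Scheme := Spec (.of ConifoldRing)

/-- The coordinates `a, b, c, d` on the conifold. -/
def ConifoldRing.coord (i : Fin 4) : ConifoldRing := ConifoldRing.mk (MvPolynomial.X i)

/-- The inclusion of the conifold in `𝔸⁴`. -/
def Conifold.toA4 : Conifold ⟶ Spec (.of R4) :=
  Spec.map (CommRingCat.ofHom ConifoldRing.mk.toRingHom)

/-- The structure morphism of the conifold over `ℂ`. -/
def Conifold.str : Conifold ⟶ Spec (.of ℂ) :=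
  Spec.map (CommRingCat.ofHom (algebraMap ℂ ConifoldRing))

/-- Evaluation of functions on the conifold at the origin. -/
def ConifoldRing.evalOrigin : ConifoldRing →ₐ[ℂ] ℂ := ConifoldRing.lift (fun _ => 0) rfl

/-- The inclusion `Spec ℂ ⟶ Conifold` of the origin `(0, 0, 0, 0)`. -/
def Conifold.origin : Spec (.of ℂ) ⟶ Conifold :=
  Spec.map (CommRingCat.ofHom ConifoldRing.evalOrigin.toRingHom)

/-- The complement of the origin in the conifold. -/
def Conifold.punctured : Conifold.Opens :=
  ⨆ i, PrimeSpectrum.basicOpen (ConifoldRing.coord i)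

/-- The invariants `a = x₂ x₃`, `b = x₂ y₃`, `c = x₃ y₂`, `d = y₂ y₃`. -/
def invMonomial : Fin 4 → QRing :=
  ![co .x₂ * co .x₃, co .x₂ * co .y₃, co .x₃ * co .y₂, co .y₂ * co .y₃]

theorem invMonomial_mem (θ : Fin 2 → ℤ) (i : Fin 4) :
    invMonomial i ∈ semiInv quiverAct θ 0 := by
  intro g
  have h0 : ((g 0 : ℂˣ) : ℂ) ≠ 0 := (g 0).ne_zero
  have h1 : ((g 1 : ℂˣ) : ℂ) ≠ 0 := (g 1).ne_zero
  have h01 : (g 0 : ℂ) * (g 1 : ℂ)⁻¹ * ((g 1 : ℂ) * (g 0 : ℂ)⁻¹) = 1 := by field_simp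
  have h10 : (g 1 : ℂ) * (g 0 : ℂ)⁻¹ * ((g 0 : ℂ) * (g 1 : ℂ)⁻¹) = 1 := by field_simp
  fin_cases i <;>
    simp [invMonomial, quiverAct, Arrow.src, Arrow.tgt, smul_smul, h01, h10]

/-- The homomorphism `a ↦ x₂ x₃`, `b ↦ x₂ y₃`, `c ↦ x₃ y₂`, `d ↦ y₂ y₃` from `R_c` to the part of
degree zero of the ring of semi-invariants, that is, to the ring of polynomial invariants. -/
def toInvariants (θ : Fin 2 → ℤ) : ConifoldRing →ₐ[ℂ] grading (semiInv quiverAct θ) 0 :=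
  ConifoldRing.lift (B := grading (semiInv quiverAct θ) 0)
    (fun i => ⟨homog _ 0 ⟨invMonomial i, invMonomial_mem θ i⟩, homog_mem _ 0 _⟩) (by
    apply Subtype.ext
    apply Subtype.ext
    change Polynomial.monomial 0 _ * Polynomial.monomial 0 _ =
      Polynomial.monomial 0 _ * Polynomial.monomial 0 _
    rw [Polynomial.monomial_mul_monomial, Polynomial.monomial_mul_monomial]
    congr 1
    simp [invMonomial]
    ring)

/-- The morphism from the moduli space to the conifold given by the inclusion of the invariants
into the ring of semi-invariants. -/
def toConifold (θ : Fin 2 → ℤ) : ModuliSpace quiverAct θ ⟶ Conifold :=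
  Proj.toSpecZero (grading (semiInv quiverAct θ)) ≫
    Spec.map (CommRingCat.ofHom (toInvariants θ).toRingHom)

/-- The ring of `θ`-semi-invariants is `ℂ[x₂x₃, x₂y₃, x₃y₂, y₂y₃][u, v]`, with `u` and `v` of
degree one, and its part of degree zero is the coordinate ring of the conifold. -/
structure SemiInvRingDescription (θ : Fin 2 → ℤ) (u v : Arrow) : Prop where
  invariants : Function.Bijective (toInvariants θ)
  weight : ∀ l, semiInv quiverAct θ l = Submodule.span ℂ
    {f | ∃ m ∈ semiInv quiverAct θ 0, ∃ i j, i + j = l ∧ f = m * (co u ^ i * co v ^ j)}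
  injective : Function.Injective
    (fun s : SemiInvRing quiverAct θ => Polynomial.eval 1 (s : Polynomial QRing))
  range : Set.range
    (fun s : SemiInvRing quiverAct θ => Polynomial.eval 1 (s : Polynomial QRing)) =
      Algebra.adjoin ℂ (Set.range invMonomial ∪ {co u, co v})

/-- The homogeneous coordinates `e`, `f` on `𝔸⁴ × ℙ¹ = ℙ¹_{ℂ[a, b, c, d]}`. -/
def homCoord (i : Fin 2) : MvPolynomial (Fin 2) R4 := MvPolynomial.X i

/-- The coordinates `a`, `b`, `c`, `d` on `𝔸⁴`, as functions on `𝔸⁴ × ℙ¹`. -/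
def affCoord (i : Fin 4) : MvPolynomial (Fin 2) R4 := MvPolynomial.C (MvPolynomial.X i)

/-- The equations `a d - b c`, `a f - b e`, `c f - d e`. -/
def equations : Set (MvPolynomial (Fin 2) R4) :=
  {affCoord 0 * affCoord 3 - affCoord 1 * affCoord 2,
   affCoord 0 * homCoord 1 - affCoord 1 * homCoord 0,
   affCoord 2 * homCoord 1 - affCoord 3 * homCoord 0}

/-- The equations `a d - b c`, `a f - c e`, `b f - d e`. -/
def equations' : Set (MvPolynomial (Fin 2) R4) :=
  {affCoord 0 * affCoord 3 - affCoord 1 * affCoord 2,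
   affCoord 0 * homCoord 1 - affCoord 2 * homCoord 0,
   affCoord 1 * homCoord 1 - affCoord 3 * homCoord 0}

/-- The substitution `(a, b, c, d) = (x₂x₃, x₂y₃, x₃y₂, y₂y₃)`, `[e : f] = [u : v]` identifies the
ring of `θ`-semi-invariants with `ℂ[a, b, c, d][e, f] / (E)`, and its `Proj` with the closed
subscheme `𝕍(E)` of `𝔸⁴ × ℙ¹`, and the morphism to the conifold with the projection to `𝔸⁴`. -/
def IsSubvarietyDescription (θ : Fin 2 → ℤ) (u v : Arrow)
    (E : Set (MvPolynomial (Fin 2) R4)) : Prop :=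
  ∃ (Φ : GradedRingHom (projGrading 1 R4) (grading (semiInv quiverAct θ)))
    (hΦ : HomogeneousIdeal.irrelevant (grading (semiInv quiverAct θ)) ≤
      (HomogeneousIdeal.irrelevant (projGrading 1 R4)).map Φ)
    (w : ModuliSpace quiverAct θ ≅ vanishing 1 R4 E),
    (∀ z : ℂ, Φ (MvPolynomial.C (MvPolynomial.C z)) = algebraMap ℂ _ z) ∧
    (∀ i, (Φ (affCoord i)).1 = Polynomial.C (invMonomial i)) ∧
    (Φ (homCoord 0)).1 = Polynomial.monomial 1 (co u) ∧
    (Φ (homCoord 1)).1 = Polynomial.monomial 1 (co v) ∧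
    Function.Surjective Φ ∧
    RingHom.ker (Φ : MvPolynomial (Fin 2) R4 →+* SemiInvRing quiverAct θ) = Ideal.span E ∧
    w.hom ≫ vanishing.ι 1 R4 E = Proj.map Φ hΦ ∧
    w.hom ≫ vanishing.ι 1 R4 E ≫ ProjSpace.str 1 R4 = toConifold θ ≫ Conifold.toA4

/-! ### Small resolutions of the conifold, and the Atiyah flop -/

/-- The fibre of a morphism to the conifold over the origin. -/
abbrev exceptionalFiber {M : Scheme} (π : M ⟶ Conifold) : Scheme := pullback π Conifold.origin

/-- `π` is a small resolution of the conifold with exceptional fibre `ℙ¹`. -/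
structure IsSmallResolution {M : Scheme} (π : M ⟶ Conifold) : Prop where
  integral : IsIntegral M
  smooth : SmoothOfRelativeDimension 3 (π ≫ Conifold.str)
  projective : IsProjective π
  surjective : Function.Surjective π
  birational : Scheme.BirationalOver π (𝟙 Conifold)
  isIso_punctured : IsIso (π ∣_ Conifold.punctured)
  fiber : ∃ η : exceptionalFiber π ≅ ProjSpace 1 ℂ,
    η.hom ≫ ProjSpace.str 1 ℂ = pullback.snd π Conifold.origin
  small : ∀ x : M, π x ∉ Conifold.punctured → 2 ≤ ringKrullDim (M.presheaf.stalk x)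

/-- The ideal of the origin of the conifold. -/
def originIdeal : Ideal ConifoldRing := Ideal.span (Set.range ConifoldRing.coord)

/-- The powers of the ideal of the origin. -/
def originPow (l : ℕ) : Submodule ConifoldRing ConifoldRing := originIdeal ^ l

instance : SetLike.GradedMonoid originPow where
  one_mem := by
    change (1 : ConifoldRing) ∈ originIdeal ^ 0
    simp
  mul_mem := by
    intro i j f f' hf hf'
    change f * f' ∈ originIdeal ^ (i + j)
    have h := Ideal.mul_mem_mul hf hf'
    rwa [originPow, originPow, ← pow_add] at h

/-- The blow-up of the conifold in the origin: `Proj` of the Rees algebra. -/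
def Blowup : Scheme := Proj (grading originPow)

/-- The blow-up morphism. -/
def Blowup.toConifold : Blowup ⟶ Conifold := projStr ConifoldRing (grading originPow)

/-- The morphism between the fibres over the origin which is induced by a morphism `φ` over the
conifold. -/
def fiberMap {B M : Scheme} (β : B ⟶ Conifold) (π : M ⟶ Conifold) (φ : B ⟶ M)
    (h : φ ≫ π = β) : exceptionalFiber β ⟶ exceptionalFiber π :=
  pullback.lift (pullback.fst β Conifold.origin ≫ φ) (pullback.snd β Conifold.origin) (by
    rw [Category.assoc, h, pullback.condition])

/-- `π` and `π'` are related by the Atiyah flop: the blow-up of the origin dominates both of them,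
its exceptional fibre is `ℙ¹ × ℙ¹`, of which the two morphisms contract the two different rulings,
and the birational map between `M` and `M'` over the conifold does not extend to a morphism in
either direction. -/
structure IsAtiyahFlop {M M' : Scheme} (π : M ⟶ Conifold) (π' : M' ⟶ Conifold) : Prop where
  diagram : ∃ (φ : Blowup ⟶ M) (φ' : Blowup ⟶ M')
    (h : φ ≫ π = Blowup.toConifold) (h' : φ' ≫ π' = Blowup.toConifold)
    (ε : exceptionalFiber Blowup.toConifold ≅
      pullback (ProjSpace.str 1 ℂ) (ProjSpace.str 1 ℂ))
    (η : exceptionalFiber π ≅ ProjSpace 1 ℂ) (η' : exceptionalFiber π' ≅ ProjSpace 1 ℂ),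
    η.hom ≫ ProjSpace.str 1 ℂ = pullback.snd π Conifold.origin ∧
    η'.hom ≫ ProjSpace.str 1 ℂ = pullback.snd π' Conifold.origin ∧
    fiberMap _ π φ h ≫ η.hom = ε.hom ≫ pullback.fst _ _ ∧
    fiberMap _ π' φ' h' ≫ η'.hom = ε.hom ≫ pullback.snd _ _
  not_extend : ¬ ∃ r : M ⟶ M', r ≫ π' = π
  not_extend' : ¬ ∃ r : M' ⟶ M, r ≫ π = π'

end ConifoldModuli

end

noncomputable section

namespace ConifoldModuli

/-! ### Morphisms over a scheme into schemes which are generically isomorphic to it -/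

section Gluing

variable {X B M : Scheme.{0}}

/-! The group `GL(α)` acts on each arrow by a character: two arrows `u`, `v` by `χ_θ`, the other
two, `p` and `q`, by its inverse. A monomial `p^α q^β u^i v^j` is therefore semi-invariant of weight
`l` exactly when `i + j = α + β + l`, and all semi-invariants are combinations of such monomials.
The argument only uses these weights (`IsSide`), so it applies to both stability structures, and a
change of the names of the arrows carries one affine chart to all the others (`Side`).

Presentation: the rewriting rules `(p v)(q u) → (p u)(q v)`, `(p v) u → (p u) v`, `(q v) u → (q u)
v` lead from every monomial in `p u, p v, q u, q v, u, v` to a normal form that depends only on its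
image (`eq_normalForm`). So the three equations generate all relations. Surjections of graded rings
give closed immersions of `Proj`, and `idealSheaf_eq_ker` identifies the ideal sheaf of the image
with the one generated by the equations.

Geometry: where `u ≠ 0`, setting `u = 1` identifies the functions of degree zero with `ℂ[p u, q u, v
/ u]`. On the blow-up, where `p u ≠ 0`, they become `ℂ[p u, q / p, v / u]`. Both are instances of
`IsChart` and give an `Atlas` of copies of `𝔸³`. The ring maps from the conifold to the charts are
injective and become bijective when a suitable coordinate is inverted; smoothness, integrality,
birationality and the isomorphism outside the origin follow. The fibre over the origin is cut out by
`p = q = 0`, which leaves `ℂ[u, v]` and hence `ℙ¹` (`isPullback_fiber`).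

Flop: the blow-up is the fibre product of the two resolutions over the conifold
(`isPullback_blowup`, checked chart by chart), so its exceptional fibre is the product of the two
exceptional lines. A morphism over the conifold from one resolution to the other would make `q / p`
or `p / q` regular at the origin of a chart with independent coordinates `p u`, `q u`, which is
impossible (`not_exists_hom`).

Representations: `X` and `Y` anticommute with `Z = diag(1, -1)`, so they are off-diagonal, and their
entries are free (`canonicalForm`). A proper nonzero subrepresentation is a coordinate line, so
stability and semistability both say that `u` or `v` is nonzero. The coordinates `p u`, `q u`, `v /
u` of a chart separate the orbits, and by the Nullstellensatz they describe all closed points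
(`classifiesStable`). -/

theorem dense_preimage_of_cover {B : Scheme.{0}} (𝒰 : B.OpenCover) (S : Set B)
    (h : ∀ k, Dense ((𝒰.f k) ⁻¹' S)) : Dense S := by
  intro x
  obtain ⟨k, y, rfl⟩ := 𝒰.exists_eq x
  have hy : y ∈ closure ((𝒰.f k) ⁻¹' S) := h k y
  have := image_closure_subset_closure_image (𝒰.f k).continuous ⟨y, hy, rfl⟩
  exact closure_mono (Set.image_preimage_subset _ _) this

/-- Morphisms over `X` from a reduced scheme to a separated one are determined by their restriction
to a dense open subset, and the restriction to `U` is unique if `M` is isomorphic to `X` over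
`U`. -/
theorem hom_ext_of_dense [IsReduced B] (U : X.Opens) (β : B ⟶ X)
    (hβ : Dense ((β ⁻¹ᵁ U : B.Opens) : Set B)) (π : M ⟶ X) [IsSeparated π] [Mono (π ∣_ U)] {f g : B ⟶ M} (hf : f ≫ π = β)
    (hg : g ≫ π = β) : f = g := by
  have : IsDominant (β ⁻¹ᵁ U).ι := Opens.isDominant_ι (U := β ⁻¹ᵁ U) hβ
  refine ext_of_isDominant_of_isSeparated π (hf.trans hg.symm) (β ⁻¹ᵁ U).ι ?_
  -- Both morphisms send `β⁻¹ U` into `π⁻¹ U`, on which `π` is a monomorphism, so there they are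
  -- determined by `β`.
  have hm : Mono ((π ⁻¹ᵁ U).ι ≫ π) := by
    rw [← morphismRestrict_ι]; infer_instance
  have key : ∀ f : B ⟶ M, f ≫ π = β → Set.range ((β ⁻¹ᵁ U).ι ≫ f) ⊆ Set.range (π ⁻¹ᵁ U).ι := by
    rintro f rfl _ ⟨y, rfl⟩
    rw [Scheme.Opens.range_ι]
    exact y.2
  rw [← IsOpenImmersion.lift_fac (π ⁻¹ᵁ U).ι _ (key f hf),
    ← IsOpenImmersion.lift_fac (π ⁻¹ᵁ U).ι _ (key g hg)]
  congr 1
  rw [← cancel_mono ((π ⁻¹ᵁ U).ι ≫ π), IsOpenImmersion.lift_fac_assoc,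
    IsOpenImmersion.lift_fac_assoc, Category.assoc, Category.assoc, hf, hg]

/-- Local lifts of `β` through `π` glue. -/
theorem exists_lift_of_cover [IsReduced B] (U : X.Opens) (β : B ⟶ X)
    (hβ : Dense ((β ⁻¹ᵁ U : B.Opens) : Set B)) (π : M ⟶ X) [IsSeparated π] [Mono (π ∣_ U)]
    (𝒰 : B.OpenCover) (f : ∀ k, 𝒰.X k ⟶ M) (hf : ∀ k, f k ≫ π = 𝒰.f k ≫ β) :
    ∃ φ : B ⟶ M, φ ≫ π = β ∧ ∀ k, 𝒰.f k ≫ φ = f k := by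
  refine ⟨𝒰.glueMorphisms f fun k l => ?_, ?_, fun k => 𝒰.ι_glueMorphisms _ _ k⟩
  -- Compatibility on overlaps is automatic: an overlap is reduced and the preimage of `U` is dense
  -- in it, so two lifts of the same morphism agree.
  · have : IsReduced (pullback (𝒰.f k) (𝒰.f l)) :=
      isReduced_of_isOpenImmersion (pullback.fst (𝒰.f k) (𝒰.f l) ≫ 𝒰.f k)
    refine hom_ext_of_dense U (pullback.fst (𝒰.f k) (𝒰.f l) ≫ 𝒰.f k ≫ β) ?_ π ?_ ?_
    · have h := hβ.preimage
        (pullback.fst (𝒰.f k) (𝒰.f l) ≫ 𝒰.f k).isOpenEmbedding.isOpenMap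
      exact h
    · rw [Category.assoc, hf]
    · rw [Category.assoc, hf, pullback.condition_assoc]
  · refine 𝒰.hom_ext _ _ fun k => ?_
    rw [𝒰.ι_glueMorphisms_assoc, hf]

end Gluing

/-! ### Atlases of schemes over the conifold by affine spaces -/

/-- The coordinate ring of a chart. -/
abbrev C3 : Type := MvPolynomial (Fin 3) ℂ

/-- The open subset of the conifold where the function `r` does not vanish. -/
def Conifold.basicOpen (r : ConifoldRing) : Conifold.Opens := PrimeSpectrum.basicOpen r

/-- The conifold atlases: `M` is covered by copies of `𝔸³`, on which `π` is given by injective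
homomorphisms `ρ k`, and every `π⁻¹ D(c)`, for a coordinate function `c`, lies in a chart on which
the coordinates are rational functions with denominator `c` on the conifold. -/
structure Atlas {M : Scheme.{0}} (π : M ⟶ Conifold) (ι : Type)
    (ρ : ι → ConifoldRing →ₐ[ℂ] C3) (j : ι → (Spec (.of C3) ⟶ M)) : Prop where
  isOpen : ∀ k, IsOpenImmersion (j k)
  fac : ∀ k, j k ≫ π = Spec.map (CommRingCat.ofHom (ρ k).toRingHom)
  covers : ∀ x : M, ∃ k y, j k y = x
  inj : ∀ k, Function.Injective (ρ k)
  over_basicOpen : ∀ i, ∃ k, π ⁻¹ᵁ Conifold.basicOpen (ConifoldRing.coord i) ≤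
    (haveI := isOpen k; (j k).opensRange) ∧
    ∀ x, ∃ r, ρ k r = ρ k (ConifoldRing.coord i) * MvPolynomial.X x
  zero : ∀ k i, MvPolynomial.constantCoeff (ρ k (ConifoldRing.coord i)) = 0
  nonempty : Nonempty ι

/-- The image contains the constants, an inverse of `ρ c`, and each variable as the fraction `ρ r /
ρ c`, hence the whole localization. -/
theorem awayMap_surjective (ρ : ConifoldRing →ₐ[ℂ] C3) (c : ConifoldRing)
    (h : ∀ x, ∃ r, ρ r = ρ c * MvPolynomial.X x) :
    Function.Surjective (Localization.awayMap ρ.toRingHom c) := by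
  set T := Localization.Away (ρ.toRingHom c)
  set f := Localization.awayMap ρ.toRingHom c
  have hf : ∀ r, f (algebraMap _ _ r) = algebraMap C3 T (ρ r) := fun r =>
    IsLocalization.map_eq _ r
  have hu : IsUnit (algebraMap C3 T (ρ c)) :=
    IsLocalization.Away.algebraMap_isUnit (S := T) (ρ.toRingHom c)
  have hinv : ∃ z, f z * algebraMap C3 T (ρ c) = 1 := by
    obtain ⟨w, hw⟩ := (IsLocalization.Away.algebraMap_isUnit (S := Localization.Away c) c)
    refine ⟨(w⁻¹ : Units _), ?_⟩
    rw [← hf, ← hw, ← map_mul, Units.inv_mul, map_one]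
  obtain ⟨z, hz⟩ := hinv
  have hC : ∀ p : C3, algebraMap C3 T p ∈ f.range := by
    intro p
    induction p using MvPolynomial.induction_on with
    | C a =>
      refine ⟨algebraMap _ _ (algebraMap ℂ ConifoldRing a), ?_⟩
      rw [hf, AlgHom.commutes]; rfl
    | add p q hp hq => rw [map_add]; exact add_mem hp hq
    | mul_X p x hp =>
      rw [map_mul]
      refine mul_mem hp ?_
      obtain ⟨r, hr⟩ := h x
      refine ⟨z * algebraMap _ _ r, ?_⟩
      rw [map_mul, hf, hr, map_mul, ← mul_assoc, hz, one_mul]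
  intro t
  obtain ⟨n, p, hp⟩ := IsLocalization.Away.surj (S := T) (ρ.toRingHom c) t
  obtain ⟨w, hw⟩ := hC p
  refine ⟨w * z ^ n, ?_⟩
  rw [map_mul, hw, ← hp, map_pow, mul_assoc]
  change t * (algebraMap C3 T (ρ c) ^ n * _) = t
  rw [← mul_pow, mul_comm _ (f z), hz, one_pow, mul_one]

theorem ConifoldRing.lift_coord {B : Type} [CommRing B] [Algebra ℂ B] (x : Fin 4 → B)
    (hx : x 0 * x 3 = x 1 * x 2) (i : Fin 4) :
    ConifoldRing.lift x hx (ConifoldRing.coord i) = x i :=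
  MvPolynomial.aeval_X x i

/-- In the presentation by the variables without relations the Jacobian is the determinant of an
empty matrix, hence a unit. -/
theorem isStandardSmooth_mvPolynomial {k : Type} [CommRing k] {n : ℕ} :
    Algebra.IsStandardSmoothOfRelativeDimension n k (MvPolynomial (Fin n) k) := by
  let P : Algebra.SubmersivePresentation k (MvPolynomial (Fin n) k) (Fin n) PEmpty.{1} :=
    { Algebra.Generators.mvPolynomial k (Fin n) with
      relation := PEmpty.elim
      span_range_relation_eq_ker := by
        rw [Algebra.Generators.ker_mvPolynomial, Set.range_eq_empty, Ideal.span_empty]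
      map := PEmpty.elim
      map_inj := fun x => x.elim
      jacobian_isUnit := by
        rw [Algebra.PreSubmersivePresentation.jacobian_eq_jacobiMatrix_det, Matrix.det_isEmpty,
          map_one]
        exact isUnit_one }
  refine P.isStandardSmoothOfRelativeDimension ?_
  simp [Algebra.Presentation.dimension]

/-- A function differs from its value at the origin by an element of `originIdeal`, as one sees by
induction on a polynomial that represents it. -/
theorem ker_evalOrigin_le : RingHom.ker ConifoldRing.evalOrigin ≤ originIdeal := by
  have key : ∀ p : R4, ConifoldRing.mk p - algebraMap ℂ ConifoldRing
      (ConifoldRing.evalOrigin (ConifoldRing.mk p)) ∈ originIdeal := by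
    intro p
    induction p using MvPolynomial.induction_on with
    | C a =>
      have : (ConifoldRing.mk (MvPolynomial.C a)) = algebraMap ℂ ConifoldRing a :=
        ConifoldRing.mk.commutes a
      rw [this, AlgHom.commutes]
      simp
    | add p q hp hq =>
      have := add_mem hp hq
      rw [map_add, map_add, map_add]
      convert this using 1
      ring
    | mul_X p x hp =>
      have hx : ConifoldRing.mk (MvPolynomial.X x) ∈ originIdeal :=
        Ideal.subset_span ⟨x, rfl⟩
      have h0 : ConifoldRing.evalOrigin (ConifoldRing.mk (MvPolynomial.X x)) = 0 :=
        ConifoldRing.lift_coord _ _ x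
      rw [map_mul, map_mul, h0, mul_zero, map_zero, sub_zero]
      exact Ideal.mul_mem_left _ _ hx
  intro r hr
  obtain ⟨p, rfl⟩ := Ideal.Quotient.mk_surjective r
  have h := key p
  have hr' : ConifoldRing.evalOrigin (ConifoldRing.mk p) = 0 := hr
  rw [hr', map_zero, sub_zero] at h
  exact h

/-- The chain `0 ⊂ (X 0) ⊂ p` of primes is strict; at the second place because `X 1` is not in `(X
0)`. -/
theorem two_le_height {p : Ideal C3} [p.IsPrime] (h0 : MvPolynomial.X 0 ∈ p)
    (h1 : MvPolynomial.X 1 ∈ p) : 2 ≤ p.height := by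
  have hq : (Ideal.span {(MvPolynomial.X 0 : C3)}).IsPrime := by
    rw [Ideal.span_singleton_prime (MvPolynomial.X_ne_zero _)]
    exact MvPolynomial.X_prime
  have hlt1 : (⊥ : Ideal C3) < Ideal.span {(MvPolynomial.X 0 : C3)} := by
    rw [bot_lt_iff_ne_bot, Ne, Ideal.span_singleton_eq_bot]
    exact MvPolynomial.X_ne_zero _
  have hlt2 : Ideal.span {(MvPolynomial.X 0 : C3)} < p := by
    refine lt_of_le_of_ne ((Ideal.span_singleton_le_iff_mem _).mpr h0) fun h => ?_
    rw [← h, Ideal.mem_span_singleton, MvPolynomial.X_dvd_X] at h1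
    · simp at h1
  have a1 := Ideal.height_add_one_le_of_lt_of_isPrime hlt1
  have a2 := Ideal.height_add_one_le_of_lt_of_isPrime hlt2
  calc (2 : ℕ∞) = 0 + 1 + 1 := by norm_num
    _ ≤ (⊥ : Ideal C3).height + 1 + 1 := by gcongr; exact bot_le
    _ ≤ _ := (add_le_add_left a1 1).trans a2

namespace Atlas

variable {M : Scheme.{0}} {π : M ⟶ Conifold} {ι : Type}
  {ρ : ι → ConifoldRing →ₐ[ℂ] C3} {j : ι → (Spec (.of C3) ⟶ M)} (h : Atlas π ι ρ j)
include h

omit h in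
/-- The open cover given by an atlas. -/
def cover (h : Atlas π ι ρ j) : M.OpenCover :=
  Scheme.Cover.mkOfCovers ι (fun _ => Spec (.of C3)) j h.covers h.isOpen

theorem isReduced : IsReduced M :=
  haveI : ∀ k, IsReduced (h.cover.X k) := fun _ => inferInstanceAs (IsReduced (Spec (.of C3)))
  IsReduced.of_openCover M h.cover


theorem fac_apply (k : ι) (y : Spec (.of C3)) :
    π (j k y) = Spec.map (CommRingCat.ofHom (ρ k).toRingHom) y := by
  rw [← h.fac]; rfl

theorem mem_basicOpen_iff (k : ι) (y : Spec (.of C3)) (r : ConifoldRing) :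
    π (j k y) ∈ Conifold.basicOpen r ↔ ρ k r ∉ y.asIdeal := by
  rw [h.fac_apply]; rfl

/-- Every chart is irreducible, and its generic point lies over `D(r)` because `ρ k` is injective.
-/
theorem dense_basicOpen {r : ConifoldRing} (hr : r ≠ 0) :
    Dense ((π ⁻¹ᵁ Conifold.basicOpen r : M.Opens) : Set M) := by
  refine dense_preimage_of_cover h.cover _ fun k => ?_
  have : IrreducibleSpace (h.cover.X k) := inferInstanceAs (IrreducibleSpace (PrimeSpectrum C3))
  refine IsOpen.dense ((π ⁻¹ᵁ Conifold.basicOpen r).2.preimage (h.cover.f k).continuous)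
    ⟨(⊥ : PrimeSpectrum C3), ?_⟩
  refine (h.mem_basicOpen_iff k _ r).mpr fun hmem => hr ?_
  exact (map_eq_zero_iff _ (h.inj k)).mp hmem

omit h in
theorem coord_ne_zero (i : Fin 4) : ConifoldRing.coord i ≠ 0 := by
  intro h
  -- The point `(1, 1, 1, 1)` lies on the conifold.
  have h' := congrArg (ConifoldRing.lift (B := ℂ) (fun _ => 1) rfl) h
  rw [ConifoldRing.lift_coord] at h'
  simp at h'

omit h in
theorem basicOpen_le_punctured (i : Fin 4) :
    Conifold.basicOpen (ConifoldRing.coord i) ≤ Conifold.punctured :=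
  le_iSup (fun i => Conifold.basicOpen (ConifoldRing.coord i)) i

/-- Over `D(c)` a single chart is all of `M`, so there `π` is `Spec` of the localized `ρ k`, which
is injective with `ρ k` and surjective by `awayMap_surjective`. -/
theorem isIso_basicOpen (i : Fin 4) :
    IsIso (π ∣_ Conifold.basicOpen (ConifoldRing.coord i)) := by
  obtain ⟨k, hk, hx⟩ := h.over_basicOpen i
  have := h.isOpen k
  set c := ConifoldRing.coord i
  have h1 : IsIso (j k ∣_ (π ⁻¹ᵁ Conifold.basicOpen c)) := by
    rw [isIso_iff_isOpenImmersion_and_surjective]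
    refine ⟨inferInstance, ⟨fun x => ?_⟩⟩
    obtain ⟨y, hy⟩ := hk x.2
    have hy' : y ∈ j k ⁻¹ᵁ (π ⁻¹ᵁ Conifold.basicOpen c) := by
      change j k y ∈ π ⁻¹ᵁ Conifold.basicOpen c
      rw [hy]; exact x.2
    refine ⟨⟨y, hy'⟩, Subtype.ext ?_⟩
    exact (morphismRestrict_base_coe (j k) _ ⟨y, hy'⟩).trans hy
  have h2 : IsIso ((j k ≫ π) ∣_ Conifold.basicOpen c) := by
    rw [h.fac k]
    have e := SpecMapRestrictBasicOpenIso (CommRingCat.ofHom (ρ k).toRingHom) c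
    refine ((MorphismProperty.isomorphisms Scheme).arrow_mk_iso_iff e).mpr ?_
    rw [MorphismProperty.isomorphisms.iff, isIso_SpecMap_iff]
    constructor
    · exact IsLocalization.map_injective_of_injective _ _ _ (h.inj k)
    · exact awayMap_surjective (ρ k) c hx
  rw [morphismRestrict_comp] at h2
  have h3 : IsIso (j k ∣_ (π ⁻¹ᵁ Conifold.basicOpen c) ≫ π ∣_ Conifold.basicOpen c) := h2
  exact IsIso.of_isIso_comp_left (j k ∣_ (π ⁻¹ᵁ Conifold.basicOpen c)) _

theorem isIso_punctured : IsIso (π ∣_ Conifold.punctured) := by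
  refine (MorphismProperty.isomorphisms.iff _).mp ?_
  refine IsZariskiLocalAtTarget.of_forall_exists_morphismRestrict fun x => ?_
  obtain ⟨i, hi⟩ := TopologicalSpace.Opens.mem_iSup.mp x.2
  refine ⟨Conifold.punctured.ι ⁻¹ᵁ Conifold.basicOpen (ConifoldRing.coord i), hi, ?_⟩
  have he : Conifold.punctured.ι ''ᵁ
      (Conifold.punctured.ι ⁻¹ᵁ Conifold.basicOpen (ConifoldRing.coord i)) =
      Conifold.basicOpen (ConifoldRing.coord i) := by
    rw [Scheme.Hom.image_preimage_eq_opensRange_inf, Scheme.Opens.opensRange_ι]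
    exact inf_eq_right.mpr (basicOpen_le_punctured i)
  rw [(MorphismProperty.isomorphisms Scheme).arrow_mk_iso_iff
    (morphismRestrictRestrict π _ _ ≪≫ morphismRestrictEq π he)]
  exact h.isIso_basicOpen i

theorem dense_punctured : Dense ((π ⁻¹ᵁ Conifold.punctured : M.Opens) : Set M) :=
  (h.dense_basicOpen (coord_ne_zero 0)).mono fun _ hx => basicOpen_le_punctured 0 hx

/-- One chart contains the dense subset `π⁻¹ D(c)`, so `M` is the closure of an irreducible set. -/
theorem irreducibleSpace : IrreducibleSpace M := by
  obtain ⟨k, hk, -⟩ := h.over_basicOpen 0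
  have := h.isOpen k
  have hd : Dense (Set.range (j k)) :=
    (h.dense_basicOpen (coord_ne_zero 0)).mono fun x hx => hk hx
  have hi : IsIrreducible (Set.range (j k)) := by
    have : IrreducibleSpace (Spec (.of C3)) :=
      inferInstanceAs (IrreducibleSpace (PrimeSpectrum C3))
    rw [← Set.image_univ]
    exact (IrreducibleSpace.isIrreducible_univ _).image _ (j k).continuous.continuousOn
  have h2 := hi.closure
  rw [hd.closure_eq] at h2
  exact (irreducibleSpace_def M).mpr h2

theorem isIntegral : IsIntegral M :=
  haveI := h.isReduced
  haveI := h.irreducibleSpace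
  isIntegral_of_irreducibleSpace_of_isReduced M

theorem conifold_isDomain : IsDomain ConifoldRing := by
  obtain ⟨k⟩ := h.nonempty
  exact (h.inj k).isDomain (ρ k).toRingHom

theorem birationalOver : Scheme.BirationalOver π (𝟙 Conifold) := by
  have := h.isIso_punctured
  have := h.conifold_isDomain
  have : IrreducibleSpace Conifold :=
    inferInstanceAs (IrreducibleSpace (PrimeSpectrum ConifoldRing))
  refine ⟨⟨π ⁻¹ᵁ Conifold.punctured, h.dense_punctured, Conifold.punctured, ?_,
    asIso (π ∣_ Conifold.punctured)⟩, ?_⟩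
  · refine Conifold.punctured.2.dense ⟨(⊥ : PrimeSpectrum ConifoldRing), ?_⟩
    exact basicOpen_le_punctured 0 fun hmem => coord_ne_zero 0 hmem
  · change π ∣_ Conifold.punctured ≫ Conifold.punctured.ι ≫ 𝟙 _ = _
    rw [Category.comp_id, morphismRestrict_ι]

theorem smooth : SmoothOfRelativeDimension 3 (π ≫ Conifold.str) := by
  have h1 : ∀ k : ι, RingHom.Locally (RingHom.IsStandardSmoothOfRelativeDimension 3)
      (j k ≫ π ≫ Conifold.str).appTop.hom := by
    intro k
    have h2 : j k ≫ π ≫ Conifold.str = Spec.map (CommRingCat.ofHom (algebraMap ℂ C3)) := by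
      rw [← Category.assoc, h.fac, Conifold.str, ← Spec.map_comp, ← CommRingCat.ofHom_comp]
      congr 2
      exact (ρ k).comp_algebraMap
    rw [h2]
    refine (HasRingHomProperty.iff_of_isAffine (P := @SmoothOfRelativeDimension 3)).mp ?_
    rw [HasRingHomProperty.Spec_iff (P := @SmoothOfRelativeDimension 3)]
    refine RingHom.locally_of RingHom.isStandardSmoothOfRelativeDimension_respectsIso _ ?_
    exact (RingHom.isStandardSmoothOfRelativeDimension_algebraMap 3).mpr
      isStandardSmooth_mvPolynomial
  have : ∀ k, IsAffine (h.cover.X k) := fun k => inferInstanceAs (IsAffine (Spec (.of C3)))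
  exact HasRingHomProperty.of_source_openCover (P := @SmoothOfRelativeDimension 3) h.cover
    fun k => h1 k

omit h in
-- The ideal of the origin is maximal and contained in every prime that contains the four
-- coordinates.
theorem eq_of_coord_mem {x y : PrimeSpectrum ConifoldRing}
    (hx : ∀ i, ConifoldRing.coord i ∈ x.asIdeal) (hy : ∀ i, ConifoldRing.coord i ∈ y.asIdeal) :
    x = y := by
  have key : ∀ z : PrimeSpectrum ConifoldRing, (∀ i, ConifoldRing.coord i ∈ z.asIdeal) →
      z.asIdeal = RingHom.ker ConifoldRing.evalOrigin := by
    intro z hz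
    have hmax : (RingHom.ker ConifoldRing.evalOrigin).IsMaximal :=
      RingHom.ker_isMaximal_of_surjective _ fun c =>
        ⟨algebraMap ℂ ConifoldRing c, AlgHom.commutes _ c⟩
    refine (hmax.eq_of_le z.2.ne_top ?_).symm
    exact (ker_evalOrigin_le).trans (Ideal.span_le.mpr (Set.range_subset_iff.mpr hz))
  exact PrimeSpectrum.ext ((key x hx).trans (key y hy).symm)

/-- The isomorphism over the punctured conifold reaches everything but the origin, and the origin is
the image of the origin of any chart. -/
theorem surjective : Function.Surjective π := by
  intro x
  by_cases hx : x ∈ Conifold.punctured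
  · have := h.isIso_punctured
    obtain ⟨y, hy⟩ := (π ∣_ Conifold.punctured).surjective ⟨x, hx⟩
    refine ⟨y.1, ?_⟩
    rw [← morphismRestrict_base_coe, hy]
  · obtain ⟨k⟩ := h.nonempty
    let y : PrimeSpectrum C3 :=
      ⟨RingHom.ker (MvPolynomial.constantCoeff : C3 →+* ℂ), RingHom.ker_isPrime _⟩
    refine ⟨j k y, ?_⟩
    refine (h.fac_apply k y).trans (eq_of_coord_mem (fun i => ?_) fun i => ?_)
    · exact h.zero k i
    · by_contra hc
      exact hx (TopologicalSpace.Opens.mem_iSup.mpr ⟨i, hc⟩)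

theorem coord_mem_of_notMem (k : ι) (y : Spec (.of C3)) (hx : π (j k y) ∉ Conifold.punctured)
    (i : Fin 4) : ρ k (ConifoldRing.coord i) ∈ y.asIdeal := by
  by_contra hc
  refine hx (TopologicalSpace.Opens.mem_iSup.mpr ⟨i, ?_⟩)
  exact (h.mem_basicOpen_iff k y _).mpr hc

/-- Over the origin all coordinates vanish, among them two which are variables of the chart, and the
stalk is a localization of the polynomial ring of the chart. -/
theorem two_le_ringKrullDim
    (h0 : ∀ k, ∃ i, ρ k (ConifoldRing.coord i) = MvPolynomial.X 0)
    (h1 : ∀ k, ∃ i, ρ k (ConifoldRing.coord i) = MvPolynomial.X 1)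
    (x : M) (hx : π x ∉ Conifold.punctured) : 2 ≤ ringKrullDim (M.presheaf.stalk x) := by
  obtain ⟨k, y, rfl⟩ := h.covers x
  have := h.isOpen k
  obtain ⟨i0, hi0⟩ := h0 k
  obtain ⟨i1, hi1⟩ := h1 k
  have hy0 := h.coord_mem_of_notMem k y hx i0
  have hy1 := h.coord_mem_of_notMem k y hx i1
  rw [hi0] at hy0
  rw [hi1] at hy1
  let e1 := (asIso ((j k).stalkMap y)).commRingCatIsoToRingEquiv
  rw [ringKrullDim_eq_of_ringEquiv e1]
  have hprime : y.asIdeal.IsPrime := PrimeSpectrum.isPrime y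
  rw [ringKrullDim_eq_of_ringEquiv (Spec.stalkIso (.of C3) y).commRingCatIsoToRingEquiv,
    IsLocalization.AtPrime.ringKrullDim_eq_height y.asIdeal]
  exact WithBot.coe_le_coe.mpr (two_le_height hy0 hy1)

end Atlas

/-! ### Weights of monomials -/

instance : DecidableEq Arrow := fun a b => by
  cases a <;> cases b <;> first | exact isTrue rfl | exact isFalse (by rintro ⟨⟩)

instance : Fintype Arrow := ⟨{.x₂, .x₃, .y₂, .y₃}, fun a => by cases a <;> simp⟩

/-- For the stability structure `θ`, the arrows `u`, `v` have weight one, and `p`, `q` have weight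
minus one; the invariants, permuted by `e`, are `p u`, `p v`, `q u`, `q v`. -/
structure IsSide (θ : Fin 2 → ℤ) (u v p q : Arrow) (e : Equiv.Perm (Fin 4)) : Prop where
  act_u : ∀ g, quiverAct g (co u) = ((χ θ g : ℂˣ) : ℂ) • co u
  act_v : ∀ g, quiverAct g (co v) = ((χ θ g : ℂˣ) : ℂ) • co v
  act_p : ∀ g, quiverAct g (co p) = (((χ θ g)⁻¹ : ℂˣ) : ℂ) • co p
  act_q : ∀ g, quiverAct g (co q) = (((χ θ g)⁻¹ : ℂˣ) : ℂ) • co q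
  -- One value `2` of the character suffices to read off weights, since the powers of `2` are
  -- distinct.
  exists_two : ∃ g, ((χ θ g : ℂˣ) : ℂ) = 2
  univ_eq : (Finset.univ : Finset Arrow) = {u, v, p, q}
  nodup : [u, v, p, q].Nodup
  inv : ∀ k, invMonomial (e k) = ![co p * co u, co p * co v, co q * co u, co q * co v] k
  -- Reversal of the index exchanges `a` with `d` and `b` with `c`, so the permutation respects the
  -- relation `a d = b c`.
  rev : ∀ k, e k.rev = (e k).rev

theorem isSide : IsSide ![-1, 1] .x₃ .y₃ .x₂ .y₂ 1 where
  act_u g := by simp [quiverAct, χ, Arrow.src, Arrow.tgt, Fin.prod_univ_two, mul_comm]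
  act_v g := by simp [quiverAct, χ, Arrow.src, Arrow.tgt, Fin.prod_univ_two, mul_comm]
  act_p g := by simp [quiverAct, χ, Arrow.src, Arrow.tgt, Fin.prod_univ_two, mul_comm]
  act_q g := by simp [quiverAct, χ, Arrow.src, Arrow.tgt, Fin.prod_univ_two, mul_comm]
  exists_two := ⟨![1, Units.mk0 2 two_ne_zero], by simp [χ, Fin.prod_univ_two]⟩
  univ_eq := by decide
  nodup := by decide
  inv k := by fin_cases k <;> simp [invMonomial, mul_comm]
  rev k := rfl

/-- Here `p u, p v, q u, q v` are `a, c, b, d`, which explains the transposition. -/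
theorem isSide' : IsSide ![1, -1] .x₂ .y₂ .x₃ .y₃ (Equiv.swap 1 2) where
  act_u g := by simp [quiverAct, χ, Arrow.src, Arrow.tgt, Fin.prod_univ_two]
  act_v g := by simp [quiverAct, χ, Arrow.src, Arrow.tgt, Fin.prod_univ_two]
  act_p g := by simp [quiverAct, χ, Arrow.src, Arrow.tgt, Fin.prod_univ_two]
  act_q g := by simp [quiverAct, χ, Arrow.src, Arrow.tgt, Fin.prod_univ_two]
  exists_two := ⟨![Units.mk0 2 two_ne_zero, 1], by simp [χ, Fin.prod_univ_two]⟩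
  univ_eq := by decide
  nodup := by decide
  inv k := by
    fin_cases k
    · rw [show Equiv.swap (1 : Fin 4) 2 ⟨0, by decide⟩ = 0 by decide]; simp [invMonomial, mul_comm]
    · rw [show Equiv.swap (1 : Fin 4) 2 ⟨1, by decide⟩ = 2 by decide]; simp [invMonomial, mul_comm]
    · rw [show Equiv.swap (1 : Fin 4) 2 ⟨2, by decide⟩ = 1 by decide]; simp [invMonomial, mul_comm]
    · rw [show Equiv.swap (1 : Fin 4) 2 ⟨3, by decide⟩ = 3 by decide]; simp [invMonomial, mul_comm]
  rev := by decide

theorem coeff_aeval_smul_X {σ R : Type*} [CommRing R] (s : σ → R) (f : MvPolynomial σ R)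
    (m : σ →₀ ℕ) :
    (MvPolynomial.aeval (fun a => s a • (MvPolynomial.X a : MvPolynomial σ R)) f).coeff m =
      (m.prod fun a n => s a ^ n) * f.coeff m := by
  classical
  induction f using MvPolynomial.induction_on' with
  | monomial n c =>
    have : (MvPolynomial.aeval fun a => s a • (MvPolynomial.X a : MvPolynomial σ R))
        (MvPolynomial.monomial n c) =
        (n.prod fun a k => s a ^ k) • MvPolynomial.monomial n c := by
      rw [MvPolynomial.aeval_monomial, MvPolynomial.monomial_eq (s := n) (a := c)]
      simp only [mul_pow, MvPolynomial.smul_eq_C_mul, MvPolynomial.algebraMap_eq,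
        Finsupp.prod, map_prod, map_pow, Finset.prod_mul_distrib]
      ring
    rw [this, MvPolynomial.coeff_smul, MvPolynomial.coeff_monomial]
    split_ifs with h
    · subst h; rfl
    · simp
  | add p q hp hq => rw [map_add, MvPolynomial.coeff_add, hp, hq, MvPolynomial.coeff_add, mul_add]

namespace IsSide

variable {θ : Fin 2 → ℤ} {u v p q : Arrow} {e : Equiv.Perm (Fin 4)} (h : IsSide θ u v p q e)
include h

/-- Exchanges `u` and `v`, so that statements about the locus `u ≠ 0` also cover `v ≠ 0`. -/
theorem symm : IsSide θ v u p q (e * (Equiv.swap 0 1 * Equiv.swap 2 3)) where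
  act_u := h.act_v
  act_v := h.act_u
  act_p := h.act_p
  act_q := h.act_q
  exists_two := h.exists_two
  univ_eq := by rw [h.univ_eq, Finset.insert_comm]
  nodup := by
    have := h.nodup
    simp only [List.nodup_cons, List.mem_cons] at this ⊢
    tauto
  inv k := by
    rw [Equiv.Perm.mul_apply, h.inv]
    fin_cases k <;> rfl
  rev k := by
    rw [Equiv.Perm.mul_apply, Equiv.Perm.mul_apply _ _ k, ← h.rev]
    congr 1
    revert k
    decide

theorem coeff_act (g : GLα) (f : QRing) (m : Arrow →₀ ℕ) :
    (quiverAct g f).coeff m = ((χ θ g : ℂˣ) : ℂ) ^ (m u + m v) *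
      (((χ θ g)⁻¹ : ℂˣ) : ℂ) ^ (m p + m q) * f.coeff m := by
  -- The scalar by which `g` acts on an arrow is read off as the coefficient of that arrow.
  have hs : ∀ a (z : ℂ), quiverAct g (co a) = z • co a →
      ((g a.tgt * (g a.src)⁻¹ : ℂˣ) : ℂ) = z := by
    intro a z hz
    have := congrArg (MvPolynomial.coeff (Finsupp.single a 1)) hz
    simpa [quiverAct] using this
  rw [quiverAct, coeff_aeval_smul_X, Finsupp.prod_fintype _ _ (fun _ => pow_zero _), h.univ_eq]
  have hn := h.nodup
  simp only [List.nodup_cons, List.mem_cons, not_or, List.not_mem_nil, List.nodup_nil] at hn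
  obtain ⟨⟨h1, h2, h3, -⟩, ⟨h4, h5, -⟩, ⟨h6, -⟩, -⟩ := hn
  rw [Finset.prod_insert (by simp [h1, h2, h3]), Finset.prod_insert (by simp [h4, h5]),
    Finset.prod_insert (by simp [h6]), Finset.prod_singleton, hs u _ (h.act_u g),
    hs v _ (h.act_v g), hs p _ (h.act_p g), hs q _ (h.act_q g)]
  ring

/-- The semi-invariants of weight `l` are spanned by monomials. -/
theorem mem_semiInv_iff {l : ℕ} {f : QRing} :
    f ∈ semiInv quiverAct θ l ↔ ∀ m, f.coeff m ≠ 0 → m u + m v = m p + m q + l := by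
  constructor
  · intro hf m hm
    obtain ⟨g, hg⟩ := h.exists_two
    have := congrArg (MvPolynomial.coeff m) (hf g)
    rw [h.coeff_act, MvPolynomial.coeff_smul, smul_eq_mul] at this
    have h2 := mul_right_cancel₀ hm this
    rw [Units.val_inv_eq_inv_val, Units.val_pow_eq_pow_val, hg, inv_pow, mul_inv_eq_iff_eq_mul₀ (pow_ne_zero _ two_ne_zero),
      ← pow_add] at h2
    have h3 : (2 : ℕ) ^ (m u + m v) = 2 ^ (l + (m p + m q)) := by exact_mod_cast h2
    have := Nat.pow_right_injective le_rfl h3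
    omega
  · intro hf g
    ext m
    rw [h.coeff_act, MvPolynomial.coeff_smul, smul_eq_mul]
    by_cases hm : f.coeff m = 0
    · rw [hm, mul_zero, mul_zero]
    · rw [hf m hm, Units.val_inv_eq_inv_val, Units.val_pow_eq_pow_val]
      have : ((χ θ g : ℂˣ) : ℂ) ≠ 0 := Units.ne_zero _
      rw [pow_add _ (m p + m q), inv_pow]
      field_simp

theorem co_u_mem : co u ∈ semiInv quiverAct θ 1 := fun g => by rw [h.act_u, pow_one]

theorem co_v_mem : co v ∈ semiInv quiverAct θ 1 := h.symm.co_u_mem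

end IsSide

/-! ### Straightening -/

/-- The exponents of the normal form of a monomial `p ^ α * q ^ β * u ^ i * v ^ j * t ^ l` with
`i + j = α + β + l` in `p u`, `p v`, `q u`, `q v`, `u t`, `v t`. -/
def normalForm {S : Type*} [CommRing S] (x : Fin 4 → S) (y z : S) (α β i l : ℕ) : S :=
  x 0 ^ min i α * x 1 ^ (α - i) * x 2 ^ min (i - α) β * x 3 ^ (β - (i - α)) *
    y ^ (i - α - β) * z ^ (l - (i - α - β))

/-- The three relations are read as rewriting rules `x₁ x₂ → x₀ x₃`, `x₁ y → x₀ z`, `x₃ y → x₂ z`.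
Each of them lowers `n₂ + 2 n₄`; the factor `2` is needed for the last one, which trades a `y` for
an `x₂`. None of them changes the four sums of exponents on the right. When no rule applies, the
factors `u` are distributed greedily, first over the `p`, then over the `q`, and only the rest goes
to `y`, which is the normal form. -/
theorem eq_normalForm {S : Type*} [CommRing S] {x : Fin 4 → S} {y z : S}
    (h03 : x 1 * x 2 = x 0 * x 3) (h01 : x 1 * y = x 0 * z) (h23 : x 3 * y = x 2 * z)
    (N : ℕ) : ∀ n₀ n₁ n₂ n₃ n₄ n₅ : ℕ, n₂ + 2 * n₄ = N →
    x 0 ^ n₀ * x 1 ^ n₁ * x 2 ^ n₂ * x 3 ^ n₃ * y ^ n₄ * z ^ n₅ =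
      normalForm x y z (n₀ + n₁) (n₂ + n₃) (n₀ + n₂ + n₄) (n₄ + n₅) := by
  induction N using Nat.strong_induction_on with
  | _ N ih =>
  intro n₀ n₁ n₂ n₃ n₄ n₅ hN
  by_cases h12 : n₁ ≠ 0 ∧ n₂ ≠ 0
  · obtain ⟨⟨m₁, rfl⟩, ⟨m₂, rfl⟩⟩ := And.imp Nat.exists_eq_succ_of_ne_zero
      Nat.exists_eq_succ_of_ne_zero h12
    have := ih (m₂ + 2 * n₄) (by omega) (n₀ + 1) m₁ m₂ (n₃ + 1) n₄ n₅ rfl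
    rw [show n₀ + m₁.succ = n₀ + 1 + m₁ by omega, show m₂.succ + n₃ = m₂ + (n₃ + 1) by omega,
      show n₀ + m₂.succ + n₄ = n₀ + 1 + m₂ + n₄ by omega, ← this]
    simp only [Nat.succ_eq_add_one]
    linear_combination x 0 ^ n₀ * x 1 ^ m₁ * x 2 ^ m₂ * x 3 ^ n₃ * y ^ n₄ * z ^ n₅ * h03
  by_cases h14 : n₁ ≠ 0 ∧ n₄ ≠ 0
  · obtain ⟨⟨m₁, rfl⟩, ⟨m₄, rfl⟩⟩ := And.imp Nat.exists_eq_succ_of_ne_zero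
      Nat.exists_eq_succ_of_ne_zero h14
    have := ih (n₂ + 2 * m₄) (by omega) (n₀ + 1) m₁ n₂ n₃ m₄ (n₅ + 1) rfl
    rw [show n₀ + m₁.succ = n₀ + 1 + m₁ by omega, show m₄.succ + n₅ = m₄ + (n₅ + 1) by omega,
      show n₀ + n₂ + m₄.succ = n₀ + 1 + n₂ + m₄ by omega, ← this]
    simp only [Nat.succ_eq_add_one]
    linear_combination x 0 ^ n₀ * x 1 ^ m₁ * x 2 ^ n₂ * x 3 ^ n₃ * y ^ m₄ * z ^ n₅ * h01
  by_cases h34 : n₃ ≠ 0 ∧ n₄ ≠ 0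
  · obtain ⟨⟨m₃, rfl⟩, ⟨m₄, rfl⟩⟩ := And.imp Nat.exists_eq_succ_of_ne_zero
      Nat.exists_eq_succ_of_ne_zero h34
    have := ih (n₂ + 1 + 2 * m₄) (by omega) n₀ n₁ (n₂ + 1) m₃ m₄ (n₅ + 1) rfl
    rw [show n₂ + m₃.succ = n₂ + 1 + m₃ by omega, show m₄.succ + n₅ = m₄ + (n₅ + 1) by omega,
      show n₀ + n₂ + m₄.succ = n₀ + (n₂ + 1) + m₄ by omega, ← this]
    simp only [Nat.succ_eq_add_one]
    linear_combination x 0 ^ n₀ * x 1 ^ n₁ * x 2 ^ n₂ * x 3 ^ m₃ * y ^ m₄ * z ^ n₅ * h23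
  rw [normalForm, show min (n₀ + n₂ + n₄) (n₀ + n₁) = n₀ by omega,
    show n₀ + n₁ - (n₀ + n₂ + n₄) = n₁ by omega,
    show min (n₀ + n₂ + n₄ - (n₀ + n₁)) (n₂ + n₃) = n₂ by omega,
    show n₂ + n₃ - (n₀ + n₂ + n₄ - (n₀ + n₁)) = n₃ by omega,
    show n₀ + n₂ + n₄ - (n₀ + n₁) - (n₂ + n₃) = n₄ by omega,
    show n₄ + n₅ - n₄ = n₅ by omega]

/-! ### The ring of semi-invariants by generators and relations -/

/-- The equations `A₀ A₃ - A₁ A₂`, `A₀ f - A₁ e`, `A₂ f - A₃ e` for the coordinates `Aₖ` of `𝔸⁴`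
permuted by `e`. -/
def equationsPerm (e : Equiv.Perm (Fin 4)) : Set (MvPolynomial (Fin 2) R4) :=
  {affCoord (e 0) * affCoord (e 3) - affCoord (e 1) * affCoord (e 2),
   affCoord (e 0) * homCoord 1 - affCoord (e 1) * homCoord 0,
   affCoord (e 2) * homCoord 1 - affCoord (e 3) * homCoord 0}

theorem equationsPerm_one : equationsPerm 1 = equations := rfl

theorem equationsPerm_swap : equationsPerm (Equiv.swap 1 2) = equations' := by
  have h0 : Equiv.swap (1 : Fin 4) 2 0 = 0 := by decide
  have h3 : Equiv.swap (1 : Fin 4) 2 3 = 3 := by decide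
  rw [equationsPerm, equations', h0, h3, Equiv.swap_apply_left, Equiv.swap_apply_right,
    mul_comm (affCoord 2) (affCoord 1)]

/-- All products `x k * x k.rev` coincide, and both sides are of this form because `e` commutes with
the reversal. -/
theorem mul_rev_eq {S : Type*} [CommRing S] {e : Equiv.Perm (Fin 4)} (he : ∀ k, e k.rev = (e k).rev)
    {x : Fin 4 → S} (hx : x 0 * x 3 = x 1 * x 2) : x (e 0) * x (e 3) = x (e 1) * x (e 2) := by
  have key : ∀ k : Fin 4, x k * x k.rev = x 0 * x 3 := by
    intro k
    fin_cases k
    · rfl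
    · exact hx.symm
    · rw [hx]; exact mul_comm _ _
    · exact mul_comm _ _
  have h0 := key (e 0)
  have h1 := key (e 1)
  rw [← he] at h0 h1
  exact h0.trans h1.symm

theorem mul_pow_eq_monomial {S : Type*} [CommRing S] (u v p q : S) (n₀ n₁ n₂ n₃ n₄ n₅ : ℕ) :
    Polynomial.C (p * u) ^ n₀ * Polynomial.C (p * v) ^ n₁ * Polynomial.C (q * u) ^ n₂ *
      Polynomial.C (q * v) ^ n₃ * Polynomial.monomial 1 u ^ n₄ * Polynomial.monomial 1 v ^ n₅ =
    Polynomial.monomial (n₄ + n₅) (p ^ (n₀ + n₁) * q ^ (n₂ + n₃) *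
      u ^ (n₀ + n₂ + n₄) * v ^ (n₁ + n₃ + n₅)) := by
  simp only [← Polynomial.C_mul_X_pow_eq_monomial, Polynomial.C_mul, Polynomial.C_pow]
  ring

namespace IsSide

variable {θ : Fin 2 → ℤ} {u v p q : Arrow} {e : Equiv.Perm (Fin 4)} (h : IsSide θ u v p q e)

/-- The presentation of the ring of semi-invariants. -/
def presentation (h : IsSide θ u v p q e) : MvPolynomial (Fin 2) R4 →+* SemiInvRing quiverAct θ :=
  MvPolynomial.eval₂Hom
    (MvPolynomial.aeval fun i => homog (semiInv quiverAct θ) 0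
      ⟨invMonomial i, invMonomial_mem θ i⟩).toRingHom
    ![homog _ 1 ⟨co u, h.co_u_mem⟩, homog _ 1 ⟨co v, h.co_v_mem⟩]

theorem presentation_C (r : R4) : ((h.presentation (MvPolynomial.C r)).1 : Polynomial QRing) =
    Polynomial.C (MvPolynomial.aeval invMonomial r) := by
  have : (h.presentation (MvPolynomial.C r)) = MvPolynomial.aeval (fun i =>
      homog (semiInv quiverAct θ) 0 ⟨invMonomial i, invMonomial_mem θ i⟩) r :=
    MvPolynomial.eval₂Hom_C _ _ r
  rw [this]
  induction r using MvPolynomial.induction_on with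
  | C a => simp
  | add p q hp hq =>
    rw [map_add, map_add, map_add, ← hp (MvPolynomial.eval₂Hom_C _ _ p),
      ← hq (MvPolynomial.eval₂Hom_C _ _ q)]
    rfl
  | mul_X p i hp =>
    rw [map_mul, map_mul, map_mul, ← hp (MvPolynomial.eval₂Hom_C _ _ p), MvPolynomial.aeval_X,
      MvPolynomial.aeval_X]
    rfl

theorem presentation_C_C (z : ℂ) : h.presentation (MvPolynomial.C (MvPolynomial.C z)) =
    algebraMap ℂ _ z :=
  Subtype.ext ((h.presentation_C _).trans (by simp))

theorem presentation_affCoord (i : Fin 4) :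
    (h.presentation (affCoord i)).1 = Polynomial.C (invMonomial i) := by
  rw [affCoord, presentation_C, MvPolynomial.aeval_X]

theorem presentation_homCoord_zero :
    (h.presentation (homCoord 0)).1 = Polynomial.monomial 1 (co u) :=
  congrArg Subtype.val (MvPolynomial.eval₂Hom_X' _ _ _)

theorem presentation_homCoord_one :
    (h.presentation (homCoord 1)).1 = Polynomial.monomial 1 (co v) :=
  congrArg Subtype.val (MvPolynomial.eval₂Hom_X' _ _ _)

theorem presentation_mem {G : MvPolynomial (Fin 2) R4} {n : ℕ} (hG : G ∈ projGrading 1 R4 n) :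
    h.presentation G ∈ grading (semiInv quiverAct θ) n := by
  rw [G.as_sum, map_sum]
  refine Submodule.sum_mem _ fun k hk => ?_
  have hk' : k 0 + k 1 = n := by
    have := hG (MvPolynomial.mem_support_iff.mp hk)
    rw [← this, Finsupp.weight_apply, Finsupp.sum_fintype _ _ (fun _ => by simp)]
    simp
  intro m hm
  rw [MvPolynomial.monomial_eq, Finsupp.prod_fintype _ _ (fun _ => pow_zero _), Fin.prod_univ_two,
    map_mul, map_mul, map_pow, map_pow]
  change (((h.presentation (MvPolynomial.C _)).1 * ((h.presentation (homCoord 0)).1 ^ k 0 *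
    (h.presentation (homCoord 1)).1 ^ k 1)) : Polynomial QRing).coeff m = 0
  rw [presentation_C, presentation_homCoord_zero, presentation_homCoord_one,
    Polynomial.monomial_pow, Polynomial.monomial_pow, Polynomial.monomial_mul_monomial,
    Polynomial.coeff_C_mul, Polynomial.coeff_monomial_of_ne _ (by omega), mul_zero]

theorem presentation_mul_pow (n₀ n₁ n₂ n₃ n₄ n₅ : ℕ) :
    (h.presentation (affCoord (e 0) ^ n₀ * affCoord (e 1) ^ n₁ * affCoord (e 2) ^ n₂ *
      affCoord (e 3) ^ n₃ * homCoord 0 ^ n₄ * homCoord 1 ^ n₅)).1 =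
    Polynomial.monomial (n₄ + n₅) (co p ^ (n₀ + n₁) * co q ^ (n₂ + n₃) *
      co u ^ (n₀ + n₂ + n₄) * co v ^ (n₁ + n₃ + n₅)) := by
  obtain ⟨L, hL⟩ : ∃ L : MvPolynomial (Fin 2) R4 →+* Polynomial QRing,
      ∀ G, (h.presentation G).1 = L G :=
    ⟨(gradedRing (semiInv quiverAct θ)).val.toRingHom.comp h.presentation, fun _ => rfl⟩
  have hc : ∀ k, L (affCoord (e k)) =
      Polynomial.C (![co p * co u, co p * co v, co q * co u, co q * co v] k) := fun k => by
    rw [← hL, presentation_affCoord, h.inv]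
  have hu := h.presentation_homCoord_zero
  have hv := h.presentation_homCoord_one
  rw [hL] at hu hv ⊢
  rw [map_mul, map_mul, map_mul, map_mul, map_mul, map_pow, map_pow, map_pow, map_pow, map_pow,
    map_pow, hc, hc, hc, hc, hu, hv]
  exact mul_pow_eq_monomial _ _ _ _ _ _ _ _ _ _

/-- Each equation is a difference of two monomials with the same image. -/
theorem span_le_ker : Ideal.span (equationsPerm e) ≤ RingHom.ker h.presentation := by
  have key := h.presentation_mul_pow
  rw [Ideal.span_le]
  rintro G (rfl | rfl | rfl) <;>
    rw [SetLike.mem_coe, RingHom.mem_ker, map_sub, sub_eq_zero] <;> apply Subtype.ext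
  · simpa using (key 1 0 0 1 0 0).trans (key 0 1 1 0 0 0).symm
  · simpa using (key 1 0 0 0 0 1).trans (key 0 1 0 0 1 0).symm
  · simpa using (key 0 0 1 0 0 1).trans (key 0 0 0 1 1 0).symm

include h in
theorem monomial_eq (m : Arrow →₀ ℕ) (c : ℂ) : (MvPolynomial.monomial m c : QRing) =
    c • (co p ^ m p * co q ^ m q * co u ^ m u * co v ^ m v) := by
  rw [MvPolynomial.monomial_eq, Finsupp.prod_fintype _ _ (fun _ => pow_zero _), h.univ_eq]
  have hn := h.nodup
  simp only [List.nodup_cons, List.mem_cons, not_or, List.not_mem_nil, List.nodup_nil] at hn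
  obtain ⟨⟨h1, h2, h3, -⟩, ⟨h4, h5, -⟩, ⟨h6, -⟩, -⟩ := hn
  rw [Finset.prod_insert (by simp [h1, h2, h3]), Finset.prod_insert (by simp [h4, h5]),
    Finset.prod_insert (by simp [h6]), Finset.prod_singleton, MvPolynomial.smul_eq_C_mul]
  ring

include h in
theorem exists_exponent (α β i j : ℕ) :
    ∃ m : Arrow →₀ ℕ, m p = α ∧ m q = β ∧ m u = i ∧ m v = j := by
  have hn := h.nodup
  simp only [List.nodup_cons, List.mem_cons, not_or, List.not_mem_nil, List.nodup_nil] at hn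
  obtain ⟨⟨h1, h2, h3, -⟩, ⟨h4, h5, -⟩, ⟨h6, -⟩, -⟩ := hn
  refine ⟨Finsupp.single p α + Finsupp.single q β + Finsupp.single u i + Finsupp.single v j,
    ?_, ?_, ?_, ?_⟩ <;>
  simp [h1, h2, h3, h4, h5, h6, Ne.symm h1, Ne.symm h2, Ne.symm h3,
    Ne.symm h4, Ne.symm h5, Ne.symm h6]

/-- The polynomials in normal form which represent the monomials. -/
def straighten (p q u : Arrow) (e : Equiv.Perm (Fin 4)) :
    Polynomial QRing →ₗ[ℂ] MvPolynomial (Fin 2) R4 :=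
  Polynomial.lsum fun l => (MvPolynomial.basisMonomials Arrow ℂ).constr ℂ fun m =>
    normalForm (fun k => affCoord (e k)) (homCoord 0) (homCoord 1) (m p) (m q) (m u) l

theorem straighten_monomial (l : ℕ) (m : Arrow →₀ ℕ) (c : ℂ) :
    straighten p q u e (Polynomial.monomial l (MvPolynomial.monomial m c)) =
      c • normalForm (fun k => affCoord (e k)) (homCoord 0) (homCoord 1) (m p) (m q) (m u) l := by
  have : (MvPolynomial.monomial m c : QRing) = c • MvPolynomial.basisMonomials Arrow ℂ m := by
    rw [MvPolynomial.coe_basisMonomials, MvPolynomial.smul_monomial, smul_eq_mul, mul_one]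
  rw [straighten, Polynomial.lsum_apply]
  refine (Polynomial.sum_monomial_index _ _ ?_).trans ?_
  · exact map_zero _
  · rw [this, map_smul, Module.Basis.constr_basis]

theorem presentation_smul (c : ℂ) (G : MvPolynomial (Fin 2) R4) :
    h.presentation (c • G) = c • h.presentation G := by
  rw [Algebra.smul_def, map_mul, Algebra.smul_def]
  congr 1
  exact h.presentation_C_C c

/-- By linearity it suffices to treat monomials, for which this is `eq_normalForm` in the quotient
by the equations. A polynomial in the kernel of `presentation` is thereby in the ideal of the
equations. -/
theorem straighten_presentation_sub_mem (G : MvPolynomial (Fin 2) R4) :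
    straighten p q u e (h.presentation G).1 - G ∈ Ideal.span (equationsPerm e) := by
  induction G using MvPolynomial.induction_on' with
  | add G G' hG hG' =>
    rw [map_add, AddMemClass.coe_add, map_add, add_sub_add_comm]
    exact add_mem hG hG'
  | monomial k r =>
    induction r using MvPolynomial.induction_on' with
    | add r r' hr hr' =>
      rw [map_add, map_add, AddMemClass.coe_add, map_add, add_sub_add_comm]
      exact add_mem hr hr'
    | monomial n c =>
      have hG : (MvPolynomial.monomial k (MvPolynomial.monomial n c) : MvPolynomial (Fin 2) R4) =
          c • (affCoord (e 0) ^ n (e 0) * affCoord (e 1) ^ n (e 1) * affCoord (e 2) ^ n (e 2) *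
            affCoord (e 3) ^ n (e 3) * homCoord 0 ^ k 0 * homCoord 1 ^ k 1) := by
        rw [MvPolynomial.monomial_eq, MvPolynomial.monomial_eq,
          Finsupp.prod_fintype _ _ (fun _ => pow_zero _),
          Finsupp.prod_fintype _ _ (fun _ => pow_zero _), Fin.prod_univ_two,
          ← Equiv.prod_comp e, Fin.prod_univ_four, Algebra.smul_def]
        simp only [map_mul, map_pow, affCoord, homCoord]
        rw [show algebraMap ℂ (MvPolynomial (Fin 2) R4) c =
          MvPolynomial.C (MvPolynomial.C c) from rfl]
        ring
      obtain ⟨m, h1, h2, h3, h4⟩ := h.exists_exponent (n (e 0) + n (e 1)) (n (e 2) + n (e 3))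
        (n (e 0) + n (e 2) + k 0) (n (e 1) + n (e 3) + k 1)
      have hm := h.monomial_eq m 1
      rw [one_smul, h1, h2, h3, h4] at hm
      rw [hG, presentation_smul]
      change straighten p q u e (c • (h.presentation _).1) - _ ∈ _
      rw [map_smul, ← smul_sub, presentation_mul_pow, ← hm, straighten_monomial, one_smul,
        h1, h2, h3]
      refine Submodule.smul_of_tower_mem _ c ?_
      rw [← Ideal.Quotient.eq]
      have hmem : ∀ {a b : MvPolynomial (Fin 2) R4}, a - b ∈ equationsPerm e →
          Ideal.Quotient.mk (Ideal.span (equationsPerm e)) b =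
            Ideal.Quotient.mk (Ideal.span (equationsPerm e)) a := fun hab =>
        ((Ideal.Quotient.eq).mpr (Ideal.subset_span hab)).symm
      have := eq_normalForm (x := fun k => Ideal.Quotient.mk (Ideal.span (equationsPerm e))
        (affCoord (e k))) (y := Ideal.Quotient.mk _ (homCoord 0))
        (z := Ideal.Quotient.mk _ (homCoord 1))
        (by rw [← map_mul, ← map_mul]; exact hmem (Or.inl rfl))
        (by rw [← map_mul, ← map_mul]; exact hmem (Or.inr (Or.inl rfl)))
        (by rw [← map_mul, ← map_mul]; exact hmem (Or.inr (Or.inr rfl))) _ (n (e 0)) (n (e 1))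
        (n (e 2)) (n (e 3)) (k 0) (k 1) rfl
      simp only [normalForm, map_mul, map_pow] at this ⊢
      exact this.symm

theorem ker_presentation : RingHom.ker h.presentation = Ideal.span (equationsPerm e) := by
  refine le_antisymm (fun G hG => ?_) h.span_le_ker
  have := h.straighten_presentation_sub_mem G
  rw [(RingHom.mem_ker).mp hG] at this
  simpa using this

/-- The normal form of a monomial maps back to this monomial: the weight condition `hw` makes the
exponent of `v` and the degree in `t` come out right in spite of the truncated subtractions. -/
theorem presentation_straighten (s : SemiInvRing quiverAct θ) :
    h.presentation (straighten p q u e s.1) = s := by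
  apply Subtype.ext
  set L : Polynomial QRing →ₗ[ℂ] Polynomial QRing :=
    { toFun := fun s => (h.presentation (straighten p q u e s)).1
      map_add' := fun s t => by rw [map_add, map_add]; rfl
      map_smul' := fun c s => by rw [map_smul, presentation_smul]; rfl } with hL
  change L s.1 = s.1
  have hs := s.2
  rw [s.1.as_sum_support, map_sum]
  refine Finset.sum_congr rfl fun l _ => ?_
  have hl := h.mem_semiInv_iff.mp (hs l)
  rw [(s.1.coeff l).as_sum, map_sum, map_sum]
  refine Finset.sum_congr rfl fun m hm => ?_
  have hw := hl m (MvPolynomial.mem_support_iff.mp hm)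
  change (h.presentation (straighten p q u e _)).1 = _
  rw [straighten_monomial, presentation_smul]
  change _ • (h.presentation _).1 = _
  rw [normalForm, presentation_mul_pow, h.monomial_eq, Polynomial.smul_monomial,
    show min (m u) (m p) + (m p - m u) = m p by omega,
    show min (m u - m p) (m q) + (m q - (m u - m p)) = m q by omega,
    show min (m u) (m p) + min (m u - m p) (m q) + (m u - m p - m q) = m u by omega,
    show m p - m u + (m q - (m u - m p)) + (l - (m u - m p - m q)) = m v by omega,
    show m u - m p - m q + (l - (m u - m p - m q)) = l by omega]

theorem presentation_surjective : Function.Surjective h.presentation :=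
  fun s => ⟨_, h.presentation_straighten s⟩

end IsSide

/-! ### Generators of the ring of semi-invariants, and its part of weight zero -/

namespace IsSide

variable {θ : Fin 2 → ℤ} {u v p q : Arrow} {e : Equiv.Perm (Fin 4)} (h : IsSide θ u v p q e)

theorem toInvariants_mk (r : R4) : (toInvariants θ (ConifoldRing.mk r)).1 =
    h.presentation (MvPolynomial.C r) := by
  induction r using MvPolynomial.induction_on with
  | C a =>
    rw [presentation_C_C, show ConifoldRing.mk (MvPolynomial.C a) = algebraMap ℂ ConifoldRing a from
      ConifoldRing.mk.commutes a, AlgHom.commutes]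
    rfl
  | add p q hp hq => rw [map_add, map_add, map_add, map_add, ← hp, ← hq]; rfl
  | mul_X p i hp =>
    rw [map_mul, map_mul, map_mul, map_mul, ← hp]
    have h1 : (toInvariants θ (ConifoldRing.mk (MvPolynomial.X i))).1 =
        h.presentation (MvPolynomial.C (MvPolynomial.X i)) := by
      apply Subtype.ext
      have h2 := h.presentation_affCoord i
      rw [affCoord] at h2
      rw [h2, show toInvariants θ (ConifoldRing.mk (MvPolynomial.X i)) = _ from
        ConifoldRing.lift_coord _ _ i]
      rfl
    rw [← h1]
    rfl

include h in
-- A relation between the invariants is a constant polynomial in `e`, `f` in the kernel of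
-- `presentation`. Setting `e = f = 0` turns the three equations into a relation of the conifold and
-- twice zero.
theorem toInvariants_injective : Function.Injective (toInvariants θ) := by
  rw [injective_iff_map_eq_zero]
  intro r hr
  obtain ⟨r, rfl⟩ := Ideal.Quotient.mk_surjective r
  change toInvariants θ (ConifoldRing.mk r) = 0 at hr
  have h1 : MvPolynomial.C r ∈ RingHom.ker h.presentation := by
    rw [RingHom.mem_ker, ← toInvariants_mk, hr]; rfl
  rw [h.ker_presentation] at h1
  refine Ideal.Quotient.eq_zero_iff_mem.mpr ?_
  have h2 : Ideal.span (equationsPerm e) ≤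
      Ideal.comap (MvPolynomial.constantCoeff : MvPolynomial (Fin 2) R4 →+* R4) conifoldIdeal := by
    rw [Ideal.span_le]
    rintro G (rfl | rfl | rfl) <;> rw [SetLike.mem_coe, Ideal.mem_comap]
    · simp only [affCoord, map_sub, map_mul, MvPolynomial.constantCoeff_C]
      rw [← Ideal.Quotient.eq, map_mul, map_mul]
      refine mul_rev_eq (x := fun k => Ideal.Quotient.mk conifoldIdeal (MvPolynomial.X k)) h.rev ?_
      rw [← map_mul, ← map_mul, Ideal.Quotient.eq]
      exact Ideal.subset_span rfl
    · simp [affCoord, homCoord]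
    · simp [affCoord, homCoord]
  simpa using h2 h1

theorem eval_one_presentation (G : MvPolynomial (Fin 2) R4) :
    Polynomial.eval 1 (h.presentation G).1 =
      MvPolynomial.eval₂Hom (MvPolynomial.aeval invMonomial).toRingHom ![co u, co v] G := by
  have : ((Polynomial.evalRingHom 1).comp ((gradedRing (semiInv quiverAct θ)).val.toRingHom.comp
      h.presentation)) =
      MvPolynomial.eval₂Hom (MvPolynomial.aeval invMonomial).toRingHom ![co u, co v] := by
    refine MvPolynomial.ringHom_ext (fun r => ?_) fun i => ?_
    · refine (congrArg (Polynomial.eval 1) (h.presentation_C r)).trans ?_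
      rw [Polynomial.eval_C]
      exact (MvPolynomial.eval₂Hom_C _ _ r).symm
    · fin_cases i
      · refine (congrArg (Polynomial.eval 1) h.presentation_homCoord_zero).trans ?_
        simp
      · refine (congrArg (Polynomial.eval 1) h.presentation_homCoord_one).trans ?_
        simp
  exact RingHom.congr_fun this G

theorem coeff_zero_presentation (G : MvPolynomial (Fin 2) R4) :
    (h.presentation G).1.coeff 0 =
      MvPolynomial.aeval invMonomial (MvPolynomial.constantCoeff G) := by
  have : ((Polynomial.constantCoeff).comp ((gradedRing (semiInv quiverAct θ)).val.toRingHom.comp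
      h.presentation)) = (MvPolynomial.aeval invMonomial).toRingHom.comp
        MvPolynomial.constantCoeff := by
    refine MvPolynomial.ringHom_ext (fun r => ?_) fun i => ?_
    · refine (congrArg (Polynomial.coeff · 0) (h.presentation_C r)).trans ?_
      simp
    · fin_cases i
      · refine (congrArg (Polynomial.coeff · 0) h.presentation_homCoord_zero).trans ?_
        simp [Polynomial.coeff_monomial]
      · refine (congrArg (Polynomial.coeff · 0) h.presentation_homCoord_one).trans ?_
        simp [Polynomial.coeff_monomial]
  exact RingHom.congr_fun this G

include h in
theorem semiInvRingDescription : SemiInvRingDescription θ u v where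
  invariants := by
    refine ⟨h.toInvariants_injective, fun s => ?_⟩
    obtain ⟨G, hG⟩ := h.presentation_surjective s.1
    refine ⟨ConifoldRing.mk (MvPolynomial.constantCoeff G), Subtype.ext ?_⟩
    rw [h.toInvariants_mk]
    apply Subtype.ext
    rw [h.presentation_C, ← h.coeff_zero_presentation, hG]
    ext1 l
    by_cases hl : l = 0
    · rw [hl, Polynomial.coeff_C_zero]
    · rw [Polynomial.coeff_C_of_ne_zero hl, s.2 l hl]
  weight l := by
    refine le_antisymm (fun f hf => ?_) ?_
    · rw [f.as_sum]
      refine Submodule.sum_mem _ fun m hm => ?_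
      have hw := h.mem_semiInv_iff.mp hf m (MvPolynomial.mem_support_iff.mp hm)
      rw [h.monomial_eq]
      refine Submodule.smul_mem _ _ (Submodule.subset_span ?_)
      -- The exponents of the normal form split the monomial into an invariant and a monomial of
      -- degree `l` in `u`, `v`.
      obtain ⟨n₀, n₁, n₂, n₃, n₄, n₅, h1, h2, h3, h4, rfl⟩ : ∃ n₀ n₁ n₂ n₃ n₄ n₅, m p = n₀ + n₁ ∧
          m q = n₂ + n₃ ∧ m u = n₀ + n₂ + n₄ ∧ m v = n₁ + n₃ + n₅ ∧ n₄ + n₅ = l :=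
        ⟨min (m u) (m p), m p - m u, min (m u - m p) (m q), m q - (m u - m p), m u - m p - m q,
          l - (m u - m p - m q), by omega, by omega, by omega, by omega, by omega⟩
      -- The first factor is an invariant because it is the image of a monomial without `e` and `f`.
      have h0 := (h.presentation (affCoord (e 0) ^ n₀ * affCoord (e 1) ^ n₁ *
        affCoord (e 2) ^ n₂ * affCoord (e 3) ^ n₃ * homCoord 0 ^ 0 * homCoord 1 ^ 0)).2 0
      rw [h.presentation_mul_pow, Polynomial.coeff_monomial_same] at h0
      refine ⟨_, h0, n₄, n₅, rfl, ?_⟩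
      rw [h1, h2, h3, h4]
      ring
    · rw [Submodule.span_le]
      rintro _ ⟨m, hm, i, j, rfl, rfl⟩
      have h1 := SetLike.pow_mem_graded i h.co_u_mem
      have h2 := SetLike.pow_mem_graded j h.co_v_mem
      have h3 := SetLike.mul_mem_graded hm (SetLike.mul_mem_graded h1 h2)
      simpa using h3
  injective := by
    intro s t hst
    apply Subtype.ext
    -- A monomial determines its weight, so the components of different weights can still be told
    -- apart after `t` is set to `1`.
    have key : ∀ (s : SemiInvRing quiverAct θ) (l : ℕ) (m : Arrow →₀ ℕ),
        (s.1.coeff l).coeff m = if m u + m v = m p + m q + l then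
          (Polynomial.eval 1 s.1).coeff m else 0 := by
      intro s l m
      have hs : ∀ k, (s.1.coeff k).coeff m ≠ 0 → m u + m v = m p + m q + k :=
        fun k => h.mem_semiInv_iff.mp (s.2 k) m
      split_ifs with hm
      · rw [Polynomial.eval_eq_sum, Polynomial.sum, MvPolynomial.coeff_sum]
        simp only [one_pow, mul_one]
        rw [Finset.sum_eq_single l]
        · intro k _ hk
          by_contra h0
          exact hk (by have := hs k h0; omega)
        · intro hl
          rw [Polynomial.notMem_support_iff.mp hl, MvPolynomial.coeff_zero]
      · by_contra h0
        exact hm (hs l h0)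
    ext l m
    rw [key, key]
    simp only at hst
    rw [hst]
  range := by
    ext f
    constructor
    · rintro ⟨s, rfl⟩
      obtain ⟨G, rfl⟩ := h.presentation_surjective s
      simp only
      rw [h.eval_one_presentation]
      induction G using MvPolynomial.induction_on with
      | C r =>
        rw [MvPolynomial.eval₂Hom_C]
        induction r using MvPolynomial.induction_on with
        | C a =>
          have := (MvPolynomial.aeval_C invMonomial a (R := ℂ))
          exact Set.mem_of_eq_of_mem this (Subalgebra.algebraMap_mem _ a)
        | add p q hp hq => rw [map_add]; exact add_mem hp hq
        | mul_X p i hp =>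
          rw [map_mul]
          refine mul_mem hp ?_
          exact Algebra.subset_adjoin (Or.inl ⟨i, (MvPolynomial.aeval_X invMonomial i).symm⟩)
      | add p q hp hq => rw [map_add]; exact add_mem hp hq
      | mul_X p i hp =>
        rw [map_mul, MvPolynomial.eval₂Hom_X']
        refine mul_mem hp (Algebra.subset_adjoin (Or.inr ?_))
        fin_cases i
        · exact Or.inl rfl
        · exact Or.inr rfl
    · intro hf
      have hle : Algebra.adjoin ℂ (Set.range invMonomial ∪ {co u, co v}) ≤
          (((Polynomial.aeval (R := QRing) (1 : QRing)).restrictScalars ℂ).comp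
            (gradedRing (semiInv quiverAct θ)).val).range := by
        rw [Algebra.adjoin_le_iff]
        rintro _ (⟨i, rfl⟩ | rfl | rfl)
        · exact ⟨homog _ 0 ⟨_, invMonomial_mem θ i⟩, by simp [homog]⟩
        · exact ⟨homog _ 1 ⟨_, h.co_u_mem⟩, by simp [homog]⟩
        · exact ⟨homog _ 1 ⟨_, h.co_v_mem⟩, by simp [homog]⟩
      obtain ⟨s, hs⟩ := hle hf
      exact ⟨s, hs⟩

end IsSide

/-! ### Affine charts of `Proj (gradedRing F)` -/

section Chart

variable {k A C : Type} [CommRing k] [CommRing A] [Algebra k A] [CommRing C]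
  (F : ℕ → Submodule k A) [SetLike.GradedMonoid F]

theorem eq_homog_of_mem {n : ℕ} {s : gradedRing F} (hs : s ∈ grading F n) :
    s = homog F n ⟨s.1.coeff n, s.2 n⟩ := by
  apply Subtype.ext
  ext1 m
  by_cases hm : m = n
  · subst hm; exact (Polynomial.coeff_monomial_same _ _).symm
  · rw [hs m hm]; exact (Polynomial.coeff_monomial_of_ne _ hm).symm

theorem homog_mul_homog {m n : ℕ} (f : F m) (f' : F n) :
    homog F m f * homog F n f' =
      homog F (m + n) ⟨f.1 * f'.1, SetLike.mul_mem_graded f.2 f'.2⟩ :=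
  Subtype.ext (Polynomial.monomial_mul_monomial _ _ _ _)

/-- The element `f / g ^ n` of degree zero in the localization of the graded ring at `g`. -/
def fraction (g : F 1) (n : ℕ) (f : F n) : HomogeneousLocalization.Away (grading F) (homog F 1 g) :=
  HomogeneousLocalization.Away.mk (grading F) (homog_mem F 1 g) n (homog F n f)
    (by simpa using homog_mem F n f)

theorem exists_fraction_eq (g : F 1) (z : HomogeneousLocalization.Away (grading F) (homog F 1 g)) :
    ∃ n f, fraction F g n f = z := by
  obtain ⟨n, a, ha, rfl⟩ := HomogeneousLocalization.Away.mk_surjective (grading F) (homog_mem F 1 g) z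
  have ha' : a ∈ grading F n := by simpa using ha
  refine ⟨n, ⟨a.1.coeff n, a.2 n⟩, ?_⟩
  unfold fraction
  congr 1
  exact (eq_homog_of_mem F ha').symm

/-- The homomorphism `ev` from `A` to the domain `C` identifies the functions of degree zero on the
locus `g ≠ 0` with `C`, by `f / g ^ n ↦ ev f / ev g ^ n`. -/
structure IsChart (g : F 1) (ev : A →+* C) : Prop where
  ne_zero : ev g ≠ 0
  -- For semi-invariants `ev g = 1` and this is void. For the blow-up it says that the ideal of the
  -- origin lands in the principal ideal of `ev g`.
  dvd : ∀ n, ∀ f ∈ F n, ev g ^ n ∣ ev f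
  inj : ∀ n, ∀ f ∈ F n, ev f = 0 → f = 0
  surj : ∀ c, ∃ n, ∃ f ∈ F n, ev f = ev g ^ n * c

namespace IsChart

variable {F} {g : F 1} {ev : A →+* C} (h : IsChart F g ev)

section

variable (K : Type) [Field K] [Algebra C K]

/-- The evaluation of polynomials over `A` in the fraction field `K` of `C`, with `t ↦ 1`. -/
def evalPoly (_ : IsChart F g ev) : gradedRing F →+* K :=
  (algebraMap C K).comp ((Polynomial.eval₂RingHom ev 1).comp (gradedRing F).val.toRingHom)

theorem evalPoly_homog (n : ℕ) (f : F n) :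
    h.evalPoly K (homog F n f) = algebraMap C K (ev f) := by
  have : (Polynomial.eval₂RingHom ev 1) (homog F n f).1 = ev f := by simp [homog]
  exact congrArg (algebraMap C K) this

variable [IsFractionRing C K]

theorem isUnit_evalPoly : IsUnit (h.evalPoly K (homog F 1 g)) := by
  refine IsUnit.mk0 _ ?_
  rw [evalPoly_homog, Ne, FaithfulSMul.algebraMap_eq_zero_iff]
  exact h.ne_zero

/-- The evaluation of fractions in the fraction field `K` of `C`. -/
def evalFraction : HomogeneousLocalization.Away (grading F) (homog F 1 g) →+* K :=
  (IsLocalization.Away.lift (S := Localization.Away (homog F 1 g)) (homog F 1 g)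
    (h.isUnit_evalPoly K)).comp
  (algebraMap (HomogeneousLocalization.Away (grading F) (homog F 1 g))
    (Localization.Away (homog F 1 g)))

theorem evalFraction_mul (n : ℕ) (f : F n) :
    h.evalFraction K (fraction F g n f) * algebraMap C K (ev g) ^ n = algebraMap C K (ev f) := by
  rw [← h.evalPoly_homog K n f, ← h.evalPoly_homog K 1 g,
    ← IsLocalization.Away.lift_eq (S := Localization.Away (homog F 1 g)) (homog F 1 g)
      (h.isUnit_evalPoly K) (homog F n f),
    ← IsLocalization.Away.lift_eq (S := Localization.Away (homog F 1 g)) (homog F 1 g)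
      (h.isUnit_evalPoly K) (homog F 1 g), evalFraction, ← map_pow, RingHom.comp_apply, ← map_mul]
  congr 1
  rw [HomogeneousLocalization.algebraMap_apply, fraction, HomogeneousLocalization.Away.val_mk,
    ← map_pow, Localization.mk_eq_mk']
  exact IsLocalization.mk'_spec _ _ _

omit [SetLike.GradedMonoid F] in
include h in
theorem algebraMap_ne_zero : algebraMap C K (ev g) ≠ 0 := by
  rw [Ne, FaithfulSMul.algebraMap_eq_zero_iff]
  exact h.ne_zero

theorem evalFraction_injective : Function.Injective (h.evalFraction K) := by
  rw [injective_iff_map_eq_zero]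
  intro z hz
  obtain ⟨n, f, rfl⟩ := exists_fraction_eq F g z
  have := h.evalFraction_mul K n f
  rw [hz, zero_mul, eq_comm, FaithfulSMul.algebraMap_eq_zero_iff] at this
  have hf : homog F n f = 0 := by
    apply Subtype.ext
    change Polynomial.monomial n f.1 = 0
    rw [h.inj n f f.2 this, map_zero]
  apply HomogeneousLocalization.val_injective
  rw [fraction, HomogeneousLocalization.Away.val_mk, hf, Localization.mk_zero,
    HomogeneousLocalization.val_zero]

/-- The divisibility in `IsChart` makes the value of `f / g ^ n` an element of `C`. -/
theorem evalFraction_mem (z : HomogeneousLocalization.Away (grading F) (homog F 1 g)) :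
    h.evalFraction K z ∈ (algebraMap C K).range := by
  obtain ⟨n, f, rfl⟩ := exists_fraction_eq F g z
  obtain ⟨c, hc⟩ := h.dvd n f f.2
  refine ⟨c, ?_⟩
  apply mul_right_cancel₀ (pow_ne_zero n (h.algebraMap_ne_zero K))
  rw [h.evalFraction_mul, hc, map_mul, map_pow, mul_comm]

/-- `toRing`, with an explicit fraction field. -/
def toRingAux : HomogeneousLocalization.Away (grading F) (homog F 1 g) →+* C :=
  (RingEquiv.ofBijective (algebraMap C K).rangeRestrict
    ⟨fun _ _ hab => IsFractionRing.injective C K (congrArg Subtype.val hab),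
      (algebraMap C K).rangeRestrict_surjective⟩).symm.toRingHom.comp
  ((h.evalFraction K).codRestrict (algebraMap C K).range (h.evalFraction_mem K))

theorem algebraMap_toRingAux (z : HomogeneousLocalization.Away (grading F) (homog F 1 g)) :
    algebraMap C K (h.toRingAux K z) = h.evalFraction K z := by
  have := (RingEquiv.ofBijective (algebraMap C K).rangeRestrict
    ⟨fun _ _ hab => IsFractionRing.injective C K (congrArg Subtype.val hab),
      (algebraMap C K).rangeRestrict_surjective⟩).apply_symm_apply
    ⟨_, h.evalFraction_mem K z⟩
  exact congrArg Subtype.val this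

theorem mul_toRingAux (n : ℕ) (f : F n) :
    ev g ^ n * h.toRingAux K (fraction F g n f) = ev f := by
  apply IsFractionRing.injective C K
  rw [map_mul, map_pow, h.algebraMap_toRingAux, mul_comm, h.evalFraction_mul]

theorem toRingAux_injective : Function.Injective (h.toRingAux K) := fun _ _ hab =>
  h.evalFraction_injective K (by rw [← h.algebraMap_toRingAux, hab, h.algebraMap_toRingAux])

end

variable [IsDomain C]

/-- The isomorphism `f / g ^ n ↦ ev f / ev g ^ n` to the ring of functions on the chart. -/
def toRing : HomogeneousLocalization.Away (grading F) (homog F 1 g) →+* C :=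
  h.toRingAux (FractionRing C)

theorem mul_toRing (n : ℕ) (f : F n) : ev g ^ n * h.toRing (fraction F g n f) = ev f :=
  h.mul_toRingAux _ n f

theorem toRing_fraction {n : ℕ} {f : F n} {c : C} (hc : ev f = ev g ^ n * c) :
    h.toRing (fraction F g n f) = c :=
  mul_left_cancel₀ (pow_ne_zero n h.ne_zero) ((h.mul_toRing n f).trans hc)

theorem toRing_injective : Function.Injective h.toRing := h.toRingAux_injective _

theorem toRing_surjective : Function.Surjective h.toRing := fun c => by
  obtain ⟨n, f, hf, hc⟩ := h.surj c
  exact ⟨fraction F g n ⟨f, hf⟩, h.toRing_fraction hc⟩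

/-- The chart `Spec C ⟶ Proj (gradedRing F)`. -/
def chart : Spec (.of C) ⟶ Proj (grading F) :=
  Spec.map (CommRingCat.ofHom h.toRing) ≫
    Proj.awayι (grading F) (homog F 1 g) (homog_mem F 1 g) one_pos

instance : IsIso (Spec.map (CommRingCat.ofHom h.toRing)) := by
  rw [isIso_SpecMap_iff]
  exact ⟨h.toRing_injective, h.toRing_surjective⟩

instance isOpenImmersion_chart : IsOpenImmersion h.chart := by
  unfold chart
  infer_instance

theorem opensRange_chart : h.chart.opensRange = Proj.basicOpen (grading F) (homog F 1 g) := by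
  rw [← Proj.opensRange_awayι _ _ (homog_mem F 1 g) one_pos]
  exact Scheme.Hom.opensRange_comp_of_isIso _ _

theorem chart_toSpecZero : h.chart ≫ Proj.toSpecZero (grading F) =
    Spec.map (CommRingCat.ofHom
      (ev.comp (Polynomial.constantCoeff.comp ((gradedRing F).val.toRingHom.comp
        (algebraMap (grading F 0) (gradedRing F)))))) := by
  rw [chart, Category.assoc, Proj.awayι_toSpecZero, ← Spec.map_comp, ← CommRingCat.ofHom_comp]
  congr 2
  ext s
  have h1 : HomogeneousLocalization.fromZeroRingHom (grading F)
      (Submonoid.powers (homog F 1 g)) s = fraction F g 0 ⟨s.1.1.coeff 0, s.1.2 0⟩ := by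
    apply HomogeneousLocalization.val_injective
    rw [fraction, HomogeneousLocalization.Away.val_mk, ← eq_homog_of_mem F s.2]
    change Localization.mk _ _ = _
    congr 1
  have h2 := h.mul_toRing 0 ⟨s.1.1.coeff 0, s.1.2 0⟩
  rw [pow_zero, one_mul] at h2
  exact (congrArg h.toRing h1).trans h2

theorem chart_mem_basicOpen_iff_of_pos {n : ℕ} (hn : 0 < n) (f : F n) (c : C)
    (hc : ev f = ev g ^ n * c) (y : Spec (.of C)) :
    h.chart y ∈ Proj.basicOpen (grading F) (homog F n f) ↔ c ∉ y.asIdeal := by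
  have h1 := Proj.awayι_preimage_basicOpen (grading F) (homog_mem F 1 g) one_pos
    (homog_mem F n f) hn
  have h2 : HomogeneousLocalization.Away.isLocalizationElem (homog_mem F 1 g) (homog_mem F n f) =
      fraction F g n f := by
    rw [fraction, HomogeneousLocalization.Away.isLocalizationElem]
    congr 1
    exact pow_one _
  rw [h2] at h1
  have h3 : h.chart y ∈ Proj.basicOpen (grading F) (homog F n f) ↔
      Spec.map (CommRingCat.ofHom h.toRing) y ∈ PrimeSpectrum.basicOpen (fraction F g n f) := by
    rw [← h1]; rfl
  rw [h3, ← h.toRing_fraction hc]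
  rfl

theorem chart_mem_basicOpen (y : Spec (.of C)) :
    h.chart y ∈ Proj.basicOpen (grading F) (homog F 1 g) := by
  rw [← h.opensRange_chart]
  exact ⟨y, rfl⟩

theorem chart_mem_basicOpen_iff {n : ℕ} (f : F n) (c : C)
    (hc : ev f = ev g ^ n * c) (y : Spec (.of C)) :
    h.chart y ∈ Proj.basicOpen (grading F) (homog F n f) ↔ c ∉ y.asIdeal := by
  -- Multiplication by `g`, which vanishes nowhere on the chart, makes the degree positive.
  rw [← h.chart_mem_basicOpen_iff_of_pos (n := n + 1) (Nat.succ_pos n) ⟨_, SetLike.mul_mem_graded f.2 g.2⟩ c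
    (by rw [map_mul, hc, pow_succ]; ring), ← homog_mul_homog, Proj.basicOpen_mul]
  exact ⟨fun hf => ⟨hf, h.chart_mem_basicOpen y⟩, fun hf => hf.1⟩

end IsChart

/-- The product `r f` has degree one and the same zeros as `r` where `f ≠ 0`; in the chart of `f` it
corresponds to the function `r`. -/
theorem toSpecZero_mem_basicOpen_iff {B : Type} [CommRing B] {σ : Type} [SetLike σ B]
    [AddSubgroupClass σ B] (𝒜 : ℕ → σ) [GradedRing 𝒜] (f : B) (hf : f ∈ 𝒜 1) (r : 𝒜 0) (x : Proj 𝒜)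
    (hx : x ∈ Proj.basicOpen 𝒜 f) :
    Proj.toSpecZero 𝒜 x ∈ (PrimeSpectrum.basicOpen r : (Spec (.of (𝒜 0))).Opens) ↔
      x ∈ Proj.basicOpen 𝒜 r.1 := by
  rw [← Proj.opensRange_awayι _ _ hf one_pos] at hx
  obtain ⟨y, rfl⟩ := hx
  have hrf : r.1 * f ∈ 𝒜 1 := by simpa using SetLike.mul_mem_graded r.2 hf
  have h1 := Proj.awayι_preimage_basicOpen 𝒜 hf one_pos hrf one_pos
  have h2 : HomogeneousLocalization.Away.isLocalizationElem hf hrf =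
      HomogeneousLocalization.fromZeroRingHom 𝒜 _ r := by
    apply HomogeneousLocalization.val_injective
    rw [HomogeneousLocalization.Away.isLocalizationElem, HomogeneousLocalization.Away.val_mk]
    change _ = Localization.mk _ _
    rw [Localization.mk_eq_mk_iff, Localization.r_iff_exists]
    exact ⟨1, by simp; ring⟩
  rw [h2] at h1
  have h3 : Proj.awayι 𝒜 f hf one_pos y ∈ Proj.basicOpen 𝒜 (r.1 * f) ↔
      Proj.awayι 𝒜 f hf one_pos y ∈ Proj.basicOpen 𝒜 r.1 := by
    rw [Proj.basicOpen_mul]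
    refine ⟨fun hf => hf.1, fun hr => ⟨hr, ?_⟩⟩
    rw [← Proj.opensRange_awayι _ _ hf one_pos]
    exact ⟨y, rfl⟩
  have h4 : Proj.toSpecZero 𝒜 (Proj.awayι 𝒜 f hf one_pos y) =
      Spec.map (CommRingCat.ofHom (HomogeneousLocalization.fromZeroRingHom 𝒜 _)) y := by
    rw [← Proj.awayι_toSpecZero 𝒜 f hf one_pos]; rfl
  rw [h4, ← h3]
  change _ ↔ y ∈ Proj.awayι 𝒜 f hf one_pos ⁻¹ᵁ Proj.basicOpen 𝒜 (r.1 * f)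
  rw [h1]
  rfl

end Chart

/-! ### Ideals which contain the irrelevant ideal -/

section

variable {k A : Type} [CommRing k] [CommRing A] [Algebra k A] (F : ℕ → Submodule k A)
  [SetLike.GradedMonoid F]

/-- `homog` as a linear map. -/
def homogLinear (l : ℕ) : F l →ₗ[k] gradedRing F where
  toFun := homog F l
  map_add' f f' := Subtype.ext (map_add (Polynomial.monomial l) f.1 f'.1)
  map_smul' c f := Subtype.ext (Polynomial.smul_monomial c l f.1).symm

/-- The elements of `F l` whose product with `t ^ l` is in the ideal `J`. -/
def homogIn (J : Ideal (gradedRing F)) (l : ℕ) : Submodule k A :=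
  ((J.restrictScalars k).comap (homogLinear F l)).map (F l).subtype

theorem mem_homogIn {J : Ideal (gradedRing F)} {l : ℕ} {f : A} (hf : f ∈ F l)
    (h : homog F l ⟨f, hf⟩ ∈ J) : f ∈ homogIn F J l := ⟨⟨f, hf⟩, h, rfl⟩

theorem mul_mem_homogIn {J : Ideal (gradedRing F)} {l m : ℕ} {f : A} (hf : f ∈ F l) (g : F m)
    (h : homog F m g ∈ J) : f * g ∈ homogIn F J (l + m) := by
  refine mem_homogIn F (SetLike.mul_mem_graded hf g.2) ?_
  rw [← homog_mul_homog F ⟨f, hf⟩ g]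
  exact Ideal.mul_mem_left _ _ h

theorem irrelevant_le_of_le_homogIn {J : Ideal (gradedRing F)}
    (hJ : ∀ l, F (l + 1) ≤ homogIn F J (l + 1)) :
    (HomogeneousIdeal.irrelevant (grading F)).toIdeal ≤ J := by
  rw [HomogeneousIdeal.toIdeal_irrelevant_le]
  intro i hi s hs
  obtain ⟨l, rfl⟩ := Nat.exists_eq_succ_of_ne_zero hi.ne'
  have hs' : s ∈ grading F (l + 1) := hs
  obtain ⟨f, hf, hfs⟩ := hJ l (s.2 (l + 1))
  rw [eq_homog_of_mem F hs']
  have : f = ⟨s.1.coeff (l + 1), s.2 (l + 1)⟩ := Subtype.ext hfs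
  exact this ▸ hf

end

/-! ### The chart `u ≠ 0` of the moduli space -/

namespace IsSide

variable {θ : Fin 2 → ℤ} {u v p q : Arrow} {e : Equiv.Perm (Fin 4)} (h : IsSide θ u v p q e)

include h in
-- Exchanges `p` and `q`. Together with `symm` this allows any of the four invariants to play the
-- role of `p u`.
theorem swap : IsSide θ u v q p (e * (Equiv.swap 0 2 * Equiv.swap 1 3)) where
  act_u := h.act_u
  act_v := h.act_v
  act_p := h.act_q
  act_q := h.act_p
  exists_two := h.exists_two
  univ_eq := by rw [h.univ_eq]; congr 2; exact Finset.pair_comm _ _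
  nodup := by
    have := h.nodup
    simp only [List.nodup_cons, List.mem_cons] at this ⊢
    tauto
  inv k := by
    rw [Equiv.Perm.mul_apply, h.inv]
    fin_cases k <;> rfl
  rev k := by
    rw [Equiv.Perm.mul_apply, Equiv.Perm.mul_apply _ _ k, ← h.rev]
    congr 1
    revert k
    decide

/-- The coordinates on the chart `u ≠ 0`, in which `u = 1`. -/
def ev (u v p _q : Arrow) : QRing →ₐ[ℂ] C3 :=
  MvPolynomial.aeval fun a => if a = u then 1 else if a = v then MvPolynomial.X 2 else
    if a = p then MvPolynomial.X 0 else MvPolynomial.X 1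

include h in
theorem ev_co : ev u v p q (co u) = 1 ∧ ev u v p q (co v) = MvPolynomial.X 2 ∧
    ev u v p q (co p) = MvPolynomial.X 0 ∧ ev u v p q (co q) = MvPolynomial.X 1 := by
  have hn := h.nodup
  simp only [List.nodup_cons, List.mem_cons, not_or, List.not_mem_nil, List.nodup_nil] at hn
  obtain ⟨⟨h1, h2, h3, -⟩, ⟨h4, h5, -⟩, ⟨h6, -⟩, -⟩ := hn
  simp [ev, Ne.symm h1, Ne.symm h2, Ne.symm h3, Ne.symm h4, Ne.symm h5, Ne.symm h6]

include h in
/-- The value of a semi-invariant, from its value on the chart `u = 1`. -/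
theorem aeval_point {K : Type} [Field K] [Algebra ℂ K] {x : Arrow → K} (hx : x u ≠ 0) {n : ℕ}
    {f : QRing} (hf : f ∈ semiInv quiverAct θ n) :
    MvPolynomial.aeval ![x p * x u, x q * x u, x v / x u] (ev u v p q f) * x u ^ n =
      MvPolynomial.aeval x f := by
  obtain ⟨hu, hv, hp, hq⟩ := h.ev_co
  rw [f.as_sum, map_sum, map_sum, map_sum, Finset.sum_mul]
  refine Finset.sum_congr rfl fun m hm => ?_
  have hw := h.mem_semiInv_iff.mp hf m (MvPolynomial.mem_support_iff.mp hm)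
  rw [h.monomial_eq, map_smul, map_smul, map_smul, smul_mul_assoc]
  congr 1
  simp only [map_mul, map_pow, hu, hv, hp, hq, MvPolynomial.aeval_X, Matrix.cons_val,
    one_pow, mul_one]
  rw [div_pow]
  field_simp
  have : x u ^ (m u) * x u ^ (m v) = x u ^ (m p) * x u ^ (m q) * x u ^ n := by
    rw [← pow_add, hw, pow_add, pow_add]
  linear_combination -(x p ^ m p * x q ^ m q * x v ^ m v) * this

include h in
-- By `aeval_point` at the generic point of `rep_α Q`, with values in the fraction field of `QRing`,
-- a semi-invariant is recovered from its value under `ev`.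
theorem eq_zero_of_ev_eq_zero {n : ℕ} {f : QRing} (hf : f ∈ semiInv quiverAct θ n)
    (h0 : ev u v p q f = 0) : f = 0 := by
  have hu0 : algebraMap QRing (FractionRing QRing) (co u) ≠ 0 := by
    rw [Ne, FaithfulSMul.algebraMap_eq_zero_iff]
    exact MvPolynomial.X_ne_zero _
  have h1 := h.aeval_point (x := fun a => algebraMap QRing (FractionRing QRing) (co a)) hu0 hf
  have h2 : MvPolynomial.aeval (fun a => algebraMap QRing (FractionRing QRing) (co a)) f =
      algebraMap QRing (FractionRing QRing) f := by
    refine (MvPolynomial.aeval_algebraMap_apply (FractionRing QRing) (fun a => co a) f).trans ?_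
    rw [MvPolynomial.aeval_X_left_apply]
  rw [h0, map_zero, zero_mul, h2] at h1
  exact (FaithfulSMul.algebraMap_eq_zero_iff _ _).mp h1.symm

include h in
theorem mul_mem_zero : co p * co u ∈ semiInv quiverAct θ 0 := by
  have : co p * co u = invMonomial (e 0) := (h.inv 0).symm
  rw [this]
  exact invMonomial_mem θ _

/-- Injectivity is `eq_zero_of_ev_eq_zero`. For surjectivity, the variables are the values of `p u`,
`q u` and `v`, and semi-invariants of different weights are added after multiplication by powers of
`u`, which has the value `1`. -/
theorem isChart : IsChart (semiInv quiverAct θ) ⟨co u, h.co_u_mem⟩ (ev u v p q).toRingHom where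
  ne_zero := h.ev_co.1.trans_ne one_ne_zero
  dvd n f _ := by
    have : (ev u v p q).toRingHom (co u) = 1 := h.ev_co.1
    rw [this, one_pow]
    exact one_dvd _
  inj n f hf h0 := h.eq_zero_of_ev_eq_zero hf h0
  surj c := by
    have hu : ∀ n, (ev u v p q).toRingHom (co u) ^ n = 1 := fun n =>
      (congrArg (· ^ n) h.ev_co.1).trans (one_pow n)
    simp only [hu, one_mul]
    induction c using MvPolynomial.induction_on with
    | C a =>
      exact ⟨0, algebraMap ℂ _ a, SetLike.algebraMap_mem_graded _ a, AlgHom.commutes _ _⟩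
    | add c c' hc hc' =>
      obtain ⟨n, f, hf, rfl⟩ := hc
      obtain ⟨n', f', hf', rfl⟩ := hc'
      have h1 := SetLike.mul_mem_graded hf (SetLike.pow_mem_graded n' h.co_u_mem)
      have h2 := SetLike.mul_mem_graded hf' (SetLike.pow_mem_graded n h.co_u_mem)
      rw [smul_eq_mul, mul_one] at h1 h2
      rw [add_comm n'] at h2
      refine ⟨n + n', _, add_mem h1 h2, ?_⟩
      rw [map_add, map_mul, map_mul, map_pow, map_pow, hu, hu, mul_one, mul_one]
    | mul_X c i hc =>
      obtain ⟨n, f, hf, rfl⟩ := hc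
      fin_cases i
      · have := SetLike.mul_mem_graded hf h.mul_mem_zero
        rw [add_zero] at this
        refine ⟨n, _, this, ?_⟩
        change ev u v p q _ = ev u v p q _ * _
        rw [map_mul, map_mul, h.ev_co.1, h.ev_co.2.2.1, mul_one]; rfl
      · have := SetLike.mul_mem_graded hf h.swap.mul_mem_zero
        rw [add_zero] at this
        refine ⟨n, _, this, ?_⟩
        change ev u v p q _ = ev u v p q _ * _
        rw [map_mul, map_mul, h.ev_co.1, h.ev_co.2.2.2, mul_one]; rfl
      · refine ⟨n + 1, _, SetLike.mul_mem_graded hf h.co_v_mem, ?_⟩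
        change ev u v p q _ = ev u v p q _ * _
        rw [map_mul, h.ev_co.2.1]; rfl

/-- The morphism to the conifold on the chart `u ≠ 0`. -/
def chartHom (u v p q : Arrow) : ConifoldRing →ₐ[ℂ] C3 :=
  ConifoldRing.lift (fun i => ev u v p q (invMonomial i)) (by
    rw [← map_mul, ← map_mul]
    congr 1
    simp [invMonomial]
    ring)

include h in
theorem chartHom_coord (k : Fin 4) : chartHom u v p q (ConifoldRing.coord (e k)) =
    ![MvPolynomial.X 0, MvPolynomial.X 0 * MvPolynomial.X 2, MvPolynomial.X 1,
      MvPolynomial.X 1 * MvPolynomial.X 2] k := by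
  obtain ⟨hu, hv, hp, hq⟩ := h.ev_co
  rw [chartHom, ConifoldRing.lift_coord, h.inv]
  fin_cases k
  · exact (map_mul _ _ _).trans (by rw [hp, hu, mul_one]; rfl)
  · exact (map_mul _ _ _).trans (by rw [hp, hv]; rfl)
  · exact (map_mul _ _ _).trans (by rw [hq, hu, mul_one]; rfl)
  · exact (map_mul _ _ _).trans (by rw [hq, hv]; rfl)

include h in
theorem chartHom_eq (r : ConifoldRing) :
    chartHom u v p q r = ev u v p q ((toInvariants θ r).1.1.coeff 0) := by
  obtain ⟨r, rfl⟩ := Ideal.Quotient.mk_surjective r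
  change chartHom u v p q (ConifoldRing.mk r) =
    ev u v p q ((toInvariants θ (ConifoldRing.mk r)).1.1.coeff 0)
  rw [h.toInvariants_mk, h.presentation_C, Polynomial.coeff_C_zero]
  change MvPolynomial.aeval _ r = _
  rw [← AlgHom.comp_apply]
  congr 1
  ext i
  simp

include h in
theorem chartHom_injective : Function.Injective (chartHom u v p q) := by
  rw [injective_iff_map_eq_zero]
  intro r hr
  rw [h.chartHom_eq] at hr
  have h1 := h.eq_zero_of_ev_eq_zero ((toInvariants θ r).1.2 0) hr
  refine (map_eq_zero_iff _ h.toInvariants_injective).mp ?_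
  apply Subtype.ext
  apply Subtype.ext
  ext1 l
  by_cases hl : l = 0
  · rw [hl, h1]; rfl
  · rw [(toInvariants θ r).2 l hl]; rfl

theorem chart_toConifold : h.isChart.chart ≫ toConifold θ =
    Spec.map (CommRingCat.ofHom (chartHom u v p q).toRingHom) := by
  rw [toConifold, ← Category.assoc, IsChart.chart_toSpecZero, ← Spec.map_comp,
    ← CommRingCat.ofHom_comp]
  congr 2
  ext1 r
  exact (h.chartHom_eq r).symm

include h in
-- A semi-invariant of positive weight is a combination of products `m u^i v^j` with `i + j > 0` and
-- `m` invariant, so a factor `u` or `v` splits off. Hence the loci `u ≠ 0` and `v ≠ 0` cover.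
theorem irrelevant_le : (HomogeneousIdeal.irrelevant (grading (semiInv quiverAct θ))).toIdeal ≤
    Ideal.span {homog _ 1 ⟨co u, h.co_u_mem⟩, homog _ 1 ⟨co v, h.co_v_mem⟩} := by
  refine irrelevant_le_of_le_homogIn _ fun l => ?_
  rw [h.semiInvRingDescription.weight, Submodule.span_le]
  rintro _ ⟨m, hm, i, j, hij, rfl⟩
  have hmem : ∀ i j, i + j = l → m * (co u ^ i * co v ^ j) ∈ semiInv quiverAct θ l := by
    rintro i j rfl
    have h1 := SetLike.pow_mem_graded i h.co_u_mem
    have h2 := SetLike.pow_mem_graded j h.co_v_mem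
    simpa using SetLike.mul_mem_graded hm (SetLike.mul_mem_graded h1 h2)
  rcases i with _ | i
  · rcases j with _ | j
    · omega
    · rw [show m * (co u ^ 0 * co v ^ (j + 1)) = m * (co u ^ 0 * co v ^ j) * co v by ring]
      exact mul_mem_homogIn _ (hmem 0 j (by omega)) ⟨_, h.co_v_mem⟩ (Ideal.subset_span (Or.inr rfl))
  · rw [show m * (co u ^ (i + 1) * co v ^ j) = m * (co u ^ i * co v ^ j) * co u by ring]
    exact mul_mem_homogIn _ (hmem i j (by omega)) ⟨_, h.co_u_mem⟩ (Ideal.subset_span (Or.inl rfl))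

theorem mem_basicOpen_or (x : ModuliSpace quiverAct θ) :
    x ∈ Proj.basicOpen (grading (semiInv quiverAct θ)) (homog _ 1 ⟨co u, h.co_u_mem⟩) ∨
    x ∈ Proj.basicOpen (grading (semiInv quiverAct θ)) (homog _ 1 ⟨co v, h.co_v_mem⟩) := by
  have h1 := Proj.iSup_basicOpen_eq_top (grading (semiInv quiverAct θ))
    ![homog _ 1 ⟨co u, h.co_u_mem⟩, homog _ 1 ⟨co v, h.co_v_mem⟩]
    (by rw [Matrix.range_cons_cons_empty]; exact h.irrelevant_le)
  obtain ⟨i, hi⟩ := TopologicalSpace.Opens.mem_iSup.mp (h1.symm ▸ TopologicalSpace.Opens.mem_top x)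
  fin_cases i
  · exact Or.inl hi
  · exact Or.inr hi

include h in
theorem toConifold_mem_basicOpen_iff (x : ModuliSpace quiverAct θ) (k : Fin 4) :
    toConifold θ x ∈ Conifold.basicOpen (ConifoldRing.coord k) ↔
      x ∈ Proj.basicOpen (grading (semiInv quiverAct θ)) (homog _ 0 ⟨_, invMonomial_mem θ k⟩) := by
  have key : ∀ {f : QRing} (hf : f ∈ semiInv quiverAct θ 1),
      x ∈ Proj.basicOpen (grading (semiInv quiverAct θ)) (homog _ 1 ⟨f, hf⟩) → _ := fun hf hx =>
    toSpecZero_mem_basicOpen_iff (grading (semiInv quiverAct θ)) _ (homog_mem _ 1 ⟨_, hf⟩)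
      (toInvariants θ (ConifoldRing.coord k)) x hx
  have hc : (toInvariants θ (ConifoldRing.coord k)).1 = homog _ 0 ⟨_, invMonomial_mem θ k⟩ := by
    rw [toInvariants, ConifoldRing.lift_coord]
  rw [hc] at key
  rcases h.mem_basicOpen_or x with hx | hx
  · exact key h.co_u_mem hx
  · exact key h.co_v_mem hx

include h in
-- If `v ≠ 0` and `p u ≠ 0` at a point, then `(p u) v = (p v) u` forces `u ≠ 0`.
theorem mem_basicOpen_of_toConifold_mem (x : ModuliSpace quiverAct θ)
    (hx : toConifold θ x ∈ Conifold.basicOpen (ConifoldRing.coord (e 0))) :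
    x ∈ Proj.basicOpen (grading (semiInv quiverAct θ)) (homog _ 1 ⟨co u, h.co_u_mem⟩) := by
  rcases h.mem_basicOpen_or x with hu | hv
  · exact hu
  · rw [h.toConifold_mem_basicOpen_iff] at hx
    have h1 : x ∈ Proj.basicOpen (grading (semiInv quiverAct θ))
        (homog (semiInv quiverAct θ) 0 ⟨_, invMonomial_mem θ (e 0)⟩ *
          homog _ 1 ⟨co v, h.co_v_mem⟩) := by
      rw [Proj.basicOpen_mul]
      exact ⟨hx, hv⟩
    have h2 : homog (semiInv quiverAct θ) 0 ⟨_, invMonomial_mem θ (e 0)⟩ *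
        homog _ 1 ⟨co v, h.co_v_mem⟩ = homog _ 0 ⟨_, invMonomial_mem θ (e 1)⟩ *
        homog _ 1 ⟨co u, h.co_u_mem⟩ := by
      rw [homog_mul_homog, homog_mul_homog]
      congr 2
      simp only [h.inv]
      simp
      ring
    rw [h2, Proj.basicOpen_mul] at h1
    exact h1.2

end IsSide

/-- A choice of the names of the arrows for the stability structure `θ`. -/
structure Side (θ : Fin 2 → ℤ) where
  (u v p q : Arrow)
  e : Equiv.Perm (Fin 4)
  isSide : IsSide θ u v p q e

namespace Side

variable {θ : Fin 2 → ℤ} (s : Side θ)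

def symm : Side θ := ⟨_, _, _, _, _, s.isSide.symm⟩

def swap : Side θ := ⟨_, _, _, _, _, s.isSide.swap⟩

/-- `ℂ[p, q u, v / u]`, the ring of functions on the chart `u ≠ 0`. -/
def chartHom : ConifoldRing →ₐ[ℂ] C3 := IsSide.chartHom s.u s.v s.p s.q

theorem chartHom_coord (k : Fin 4) : s.chartHom (ConifoldRing.coord (s.e k)) =
    ![MvPolynomial.X 0, MvPolynomial.X 0 * MvPolynomial.X 2, MvPolynomial.X 1,
      MvPolynomial.X 1 * MvPolynomial.X 2] k :=
  s.isSide.chartHom_coord k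

theorem chartHom_injective : Function.Injective s.chartHom := s.isSide.chartHom_injective

/-- The chart `u ≠ 0`. -/
def chart : Spec (.of C3) ⟶ ModuliSpace quiverAct θ := s.isSide.isChart.chart

instance : IsOpenImmersion s.chart := IsChart.isOpenImmersion_chart _

theorem chart_toConifold : s.chart ≫ toConifold θ =
    Spec.map (CommRingCat.ofHom s.chartHom.toRingHom) := s.isSide.chart_toConifold

theorem opensRange_chart : s.chart.opensRange =
    Proj.basicOpen (grading (semiInv quiverAct θ)) (homog _ 1 ⟨co s.u, s.isSide.co_u_mem⟩) :=
  s.isSide.isChart.opensRange_chart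

theorem mem_range_or (x : ModuliSpace quiverAct θ) :
    x ∈ s.chart.opensRange ∨ x ∈ s.symm.chart.opensRange := by
  rw [opensRange_chart, opensRange_chart]
  exact s.isSide.mem_basicOpen_or x

include s in
-- The renamings `symm` and `swap` act transitively on the four invariants, so each of them becomes
-- `p u` for a suitable choice of names.
theorem exists_apply_zero (i : Fin 4) : ∃ s' : Side θ, s'.e 0 = i := by
  obtain ⟨k, rfl⟩ := s.e.surjective i
  fin_cases k
  · exact ⟨s, rfl⟩
  · exact ⟨s.symm, rfl⟩
  · exact ⟨s.swap, rfl⟩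
  · exact ⟨s.symm.swap, rfl⟩

include s in
theorem atlas : Atlas (toConifold θ) (Side θ) chartHom chart where
  isOpen := fun s => inferInstance
  fac := chart_toConifold
  covers x := by
    rcases s.mem_range_or x with ⟨y, hy⟩ | ⟨y, hy⟩
    · exact ⟨_, y, hy⟩
    · exact ⟨_, y, hy⟩
  inj := chartHom_injective
  over_basicOpen i := by
    obtain ⟨s, rfl⟩ := s.exists_apply_zero i
    refine ⟨s, fun x hx => ?_, fun x => ?_⟩
    · rw [opensRange_chart]
      exact s.isSide.mem_basicOpen_of_toConifold_mem x hx
    · rw [s.chartHom_coord 0]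
      -- The variables `X 0 = p u` and `X 1 = q u` are functions on the conifold, and `X 2 = v / u`
      -- is the quotient of `p v` by `p u`.
      fin_cases x
      · exact ⟨ConifoldRing.coord (s.e 0) * ConifoldRing.coord (s.e 0), by
          rw [map_mul, s.chartHom_coord 0]; rfl⟩
      · exact ⟨ConifoldRing.coord (s.e 0) * ConifoldRing.coord (s.e 2), by
          rw [map_mul, s.chartHom_coord 0, s.chartHom_coord 2]; rfl⟩
      · exact ⟨ConifoldRing.coord (s.e 1), by rw [s.chartHom_coord 1]; rfl⟩
  zero s i := by
    obtain ⟨k, rfl⟩ := s.e.surjective i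
    rw [s.chartHom_coord]
    fin_cases k <;> simp
  nonempty := ⟨s⟩

/-- The opposite stability structure. -/
theorem _root_.ConifoldModuli.IsSide.neg {θ : Fin 2 → ℤ} {u v p q : Arrow}
    {e : Equiv.Perm (Fin 4)} (h : IsSide θ u v p q e) :
    IsSide (-θ) p q u v (e * Equiv.swap 1 2) where
  act_u g := by rw [h.act_p]; simp [χ]
  act_v g := by rw [h.act_q]; simp [χ]
  act_p g := by rw [h.act_u]; simp [χ]
  act_q g := by rw [h.act_v]; simp [χ]
  exists_two := by
    obtain ⟨g, hg⟩ := h.exists_two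
    exact ⟨g⁻¹, by simpa [χ] using hg⟩
  univ_eq := by
    rw [h.univ_eq]
    ext a
    simp only [Finset.mem_insert, Finset.mem_singleton]
    tauto
  nodup := by
    have := h.nodup
    simp only [List.nodup_cons, List.mem_cons] at this ⊢
    tauto
  inv k := by
    have hk : ∀ k, Equiv.swap (1 : Fin 4) 2 k = ![0, 2, 1, 3] k := by decide
    rw [Equiv.Perm.mul_apply, h.inv, hk]
    fin_cases k <;> exact mul_comm _ _
  rev k := by
    rw [Equiv.Perm.mul_apply, Equiv.Perm.mul_apply _ _ k, ← h.rev]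
    congr 1
    revert k
    decide

def neg : Side (-θ) := ⟨_, _, _, _, _, s.isSide.neg⟩

/-! ### The charts of the blow-up -/

/-- The coordinates `p u`, `p u * s`, `t` on the chart of the blow-up: it maps `q u` to `p u * s`. -/
def blowupCoord : C3 →ₐ[ℂ] C3 :=
  MvPolynomial.aeval ![MvPolynomial.X 0, MvPolynomial.X 0 * MvPolynomial.X 1, MvPolynomial.X 2]

/-- In the fraction field the substitution is inverted by `X 1 ↦ X 1 / X 0`. -/
theorem blowupCoord_injective : Function.Injective blowupCoord := by
  let b : C3 →ₐ[ℂ] FractionRing C3 := MvPolynomial.aeval ![algebraMap C3 _ (MvPolynomial.X 0),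
    algebraMap C3 _ (MvPolynomial.X 1) / algebraMap C3 _ (MvPolynomial.X 0),
    algebraMap C3 _ (MvPolynomial.X 2)]
  have hb : b.comp blowupCoord = Algebra.algHom ℂ C3 (FractionRing C3) := by
    ext i
    fin_cases i
    · simp [b, blowupCoord]; rfl
    · have : algebraMap C3 (FractionRing C3) (MvPolynomial.X 0) ≠ 0 := by
        rw [Ne, FaithfulSMul.algebraMap_eq_zero_iff]
        exact MvPolynomial.X_ne_zero _
      simp [b, blowupCoord, mul_div_cancel₀, this]
      rfl
    · simp [b, blowupCoord]; rfl
  have h1 : Function.Injective (b.comp blowupCoord) := by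
    rw [hb]
    exact IsFractionRing.injective C3 (FractionRing C3)
  exact Function.Injective.of_comp (f := b) h1

/-- The blow-up morphism on the chart given by the coordinate function `p u`. -/
def blowupHom : ConifoldRing →ₐ[ℂ] C3 := blowupCoord.comp s.chartHom

theorem blowupHom_coord (k : Fin 4) : s.blowupHom (ConifoldRing.coord (s.e k)) =
    ![MvPolynomial.X 0, MvPolynomial.X 0 * MvPolynomial.X 2,
      MvPolynomial.X 0 * MvPolynomial.X 1,
      MvPolynomial.X 0 * MvPolynomial.X 1 * MvPolynomial.X 2] k := by
  rw [blowupHom, AlgHom.comp_apply, chartHom_coord]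
  fin_cases k <;> simp [blowupCoord]

theorem blowupHom_injective : Function.Injective s.blowupHom :=
  blowupCoord_injective.comp s.chartHom_injective

theorem coord_mem (i : Fin 4) : ConifoldRing.coord i ∈ originPow 1 := by
  change _ ∈ originIdeal ^ 1
  rw [pow_one]
  exact Ideal.subset_span ⟨i, rfl⟩

/-- The four coordinates are sent to multiples of the image `X 0` of `p u`, which gives the
divisibility. The variables `X 1` and `X 2` are the quotients of `q u` and `p v` by `p u`. -/
theorem isChart_blowup : IsChart originPow ⟨ConifoldRing.coord (s.e 0), coord_mem _⟩
    s.blowupHom.toRingHom where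
  ne_zero := (s.blowupHom_coord 0).trans_ne (MvPolynomial.X_ne_zero _)
  dvd n f hf := by
    have h0 : s.blowupHom.toRingHom (ConifoldRing.coord (s.e 0)) = MvPolynomial.X 0 :=
      s.blowupHom_coord 0
    simp only [h0]
    rw [← Ideal.mem_span_singleton, ← Ideal.span_singleton_pow]
    have h1 : Ideal.map s.blowupHom.toRingHom originIdeal ≤
        Ideal.span {(MvPolynomial.X 0 : C3)} := by
      rw [originIdeal, Ideal.map_span, Ideal.span_le]
      rintro _ ⟨_, ⟨i, rfl⟩, rfl⟩
      obtain ⟨k, rfl⟩ := s.e.surjective i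
      refine Ideal.mem_span_singleton.mpr ?_
      change _ ∣ s.blowupHom _
      rw [s.blowupHom_coord]
      fin_cases k
      · exact dvd_rfl
      · exact Dvd.intro _ rfl
      · exact Dvd.intro _ rfl
      · exact ⟨_, mul_assoc _ _ _⟩
    have h2 := Ideal.mem_map_of_mem s.blowupHom.toRingHom (show f ∈ originIdeal ^ n from hf)
    rw [Ideal.map_pow] at h2
    exact Ideal.pow_right_mono h1 n h2
  inj n f _ h0 := (map_eq_zero_iff _ s.blowupHom_injective).mp h0
  surj c := by
    have h0 : s.blowupHom.toRingHom (ConifoldRing.coord (s.e 0)) = MvPolynomial.X 0 :=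
      s.blowupHom_coord 0
    simp only [h0]
    induction c using MvPolynomial.induction_on with
    | C a =>
      refine ⟨0, algebraMap ℂ _ a, ?_, ?_⟩
      · change _ ∈ originIdeal ^ 0
        simp
      · rw [pow_zero, one_mul]
        exact AlgHom.commutes _ _
    | add c c' hc hc' =>
      obtain ⟨n, f, hf, hfc⟩ := hc
      obtain ⟨n', f', hf', hfc'⟩ := hc'
      have h1 := SetLike.mul_mem_graded hf (SetLike.pow_mem_graded n' (coord_mem (s.e 0)))
      have h2 := SetLike.mul_mem_graded hf' (SetLike.pow_mem_graded n (coord_mem (s.e 0)))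
      rw [smul_eq_mul, mul_one] at h1 h2
      rw [add_comm n'] at h2
      refine ⟨n + n', _, add_mem h1 h2, ?_⟩
      rw [map_add, map_mul, map_mul, map_pow, map_pow, h0, hfc, hfc', pow_add]
      ring
    | mul_X c i hc =>
      obtain ⟨n, f, hf, hfc⟩ := hc
      fin_cases i
      · refine ⟨n, f * ConifoldRing.coord (s.e 0), ?_, ?_⟩
        · exact Ideal.mul_mem_right _ _ hf
        · rw [map_mul, hfc, h0, mul_assoc]; rfl
      · refine ⟨n + 1, _, SetLike.mul_mem_graded hf (coord_mem (s.e 2)), ?_⟩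
        have h2 : s.blowupHom.toRingHom (ConifoldRing.coord (s.e 2)) =
          MvPolynomial.X 0 * MvPolynomial.X 1 := s.blowupHom_coord 2
        rw [map_mul, hfc, h2, pow_succ]
        change _ = _ * (_ * MvPolynomial.X 1)
        ring
      · refine ⟨n + 1, _, SetLike.mul_mem_graded hf (coord_mem (s.e 1)), ?_⟩
        have h1 : s.blowupHom.toRingHom (ConifoldRing.coord (s.e 1)) =
          MvPolynomial.X 0 * MvPolynomial.X 2 := s.blowupHom_coord 1
        rw [map_mul, hfc, h1, pow_succ]
        change _ = _ * (_ * MvPolynomial.X 2)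
        ring

/-- The chart of the blow-up given by the coordinate function `p u`. -/
def blowupChart : Spec (.of C3) ⟶ Blowup := s.isChart_blowup.chart

instance : IsOpenImmersion s.blowupChart := IsChart.isOpenImmersion_chart _

theorem opensRange_blowupChart : s.blowupChart.opensRange =
    Proj.basicOpen (grading originPow) (homog _ 1 ⟨ConifoldRing.coord (s.e 0), coord_mem _⟩) :=
  s.isChart_blowup.opensRange_chart

theorem blowupChart_toConifold : s.blowupChart ≫ Blowup.toConifold =
    Spec.map (CommRingCat.ofHom s.blowupHom.toRingHom) := by
  have h := s.isChart_blowup.chart_toSpecZero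
  have h1 : s.blowupChart ≫ Blowup.toConifold =
      (s.isChart_blowup.chart ≫ Proj.toSpecZero (grading originPow)) ≫
    Spec.map (CommRingCat.ofHom (algebraMap ConifoldRing (grading originPow 0))) :=
    (Category.assoc _ _ _).symm
  rw [h1, h, ← Spec.map_comp, ← CommRingCat.ofHom_comp]
  congr 2
  ext1 r
  refine congrArg s.blowupHom ?_
  change Polynomial.coeff (algebraMap ConifoldRing (Polynomial ConifoldRing) r) 0 = r
  simp

theorem _root_.ConifoldModuli.Blowup.irrelevant_le :
    (HomogeneousIdeal.irrelevant (grading originPow)).toIdeal ≤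
      Ideal.span (Set.range fun i => homog originPow 1 ⟨ConifoldRing.coord i, coord_mem i⟩) := by
  refine irrelevant_le_of_le_homogIn _ fun l => ?_
  change originIdeal ^ (l + 1) ≤ homogIn originPow _ (l + 1)
  rw [pow_succ]
  refine Submodule.mul_le.mpr fun f hf g hg => ?_
  induction hg using Submodule.span_induction with
  | zero => rw [mul_zero]; exact zero_mem _
  | add g g' _ _ h1 h2 => rw [mul_add]; exact add_mem h1 h2
  | smul c g _ h1 => rw [mul_smul_comm]; exact Submodule.smul_mem _ _ h1
  | mem g hg =>
    obtain ⟨i, rfl⟩ := hg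
    exact mul_mem_homogIn _ hf ⟨_, coord_mem i⟩ (Ideal.subset_span ⟨i, rfl⟩)

theorem _root_.ConifoldModuli.Blowup.exists_mem_basicOpen (x : Blowup) : ∃ i,
    x ∈ Proj.basicOpen (grading originPow) (homog _ 1 ⟨ConifoldRing.coord i, coord_mem i⟩) := by
  have h1 := Proj.iSup_basicOpen_eq_top (grading originPow) _ Blowup.irrelevant_le
  exact TopologicalSpace.Opens.mem_iSup.mp (h1.symm ▸ TopologicalSpace.Opens.mem_top x)

/-- In the Rees algebra `x_i · (x_k t) = x_k · (x_i t)`, so `x_i t` does not vanish where neither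
`x_i` nor `x_k t` does. -/
theorem _root_.ConifoldModuli.Blowup.mem_basicOpen_of_toConifold_mem (x : Blowup) (i : Fin 4)
    (hx : Blowup.toConifold x ∈ Conifold.basicOpen (ConifoldRing.coord i)) :
    x ∈ Proj.basicOpen (grading originPow) (homog _ 1 ⟨ConifoldRing.coord i, coord_mem i⟩) := by
  obtain ⟨k, hk⟩ := Blowup.exists_mem_basicOpen x
  have h0 : ∀ i, ConifoldRing.coord i ∈ originPow 0 := fun i => by
    change _ ∈ originIdeal ^ 0
    simp
  have h1 : x ∈ Proj.basicOpen (grading originPow)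
      (homog originPow 0 ⟨ConifoldRing.coord i, h0 i⟩) :=
    (toSpecZero_mem_basicOpen_iff (grading originPow) _ (homog_mem _ 1 _)
      (algebraMap ConifoldRing (grading originPow 0) (ConifoldRing.coord i)) x hk).mp hx
  have h2 : x ∈ Proj.basicOpen (grading originPow)
      (homog originPow 0 ⟨ConifoldRing.coord i, h0 i⟩ *
        homog _ 1 ⟨ConifoldRing.coord k, coord_mem k⟩) := by
    rw [Proj.basicOpen_mul]
    exact ⟨h1, hk⟩
  have h3 : homog originPow 0 ⟨ConifoldRing.coord i, h0 i⟩ *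
      homog _ 1 ⟨ConifoldRing.coord k, coord_mem k⟩ =
      homog originPow 0 ⟨ConifoldRing.coord k, h0 k⟩ *
        homog _ 1 ⟨ConifoldRing.coord i, coord_mem i⟩ := by
    rw [homog_mul_homog, homog_mul_homog]
    congr 2
    exact mul_comm _ _
  rw [h3, Proj.basicOpen_mul] at h2
  exact h2.2

include s in
theorem blowup_atlas : Atlas Blowup.toConifold (Side θ) blowupHom blowupChart where
  isOpen := fun s => inferInstance
  fac := blowupChart_toConifold
  covers x := by
    obtain ⟨i, hi⟩ := Blowup.exists_mem_basicOpen x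
    obtain ⟨s, rfl⟩ := s.exists_apply_zero i
    rw [← s.opensRange_blowupChart] at hi
    exact ⟨s, hi⟩
  inj := blowupHom_injective
  over_basicOpen i := by
    obtain ⟨s, rfl⟩ := s.exists_apply_zero i
    refine ⟨s, fun x hx => ?_, fun x => ?_⟩
    · rw [opensRange_blowupChart]
      exact Blowup.mem_basicOpen_of_toConifold_mem x _ hx
    · rw [s.blowupHom_coord 0]
      fin_cases x
      · exact ⟨ConifoldRing.coord (s.e 0) * ConifoldRing.coord (s.e 0), by
          rw [map_mul, s.blowupHom_coord 0]; rfl⟩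
      · exact ⟨ConifoldRing.coord (s.e 2), by rw [s.blowupHom_coord 2]; rfl⟩
      · exact ⟨ConifoldRing.coord (s.e 1), by rw [s.blowupHom_coord 1]; rfl⟩
  zero s i := by
    obtain ⟨k, rfl⟩ := s.e.surjective i
    rw [s.blowupHom_coord]
    fin_cases k <;> simp
  nonempty := ⟨s⟩

end Side

/-! ### Surjective homomorphisms of graded rings and closed immersions -/

section ProjMap

variable {k k' A B : Type} [CommRing k] [CommRing k'] [CommRing A] [CommRing B]
  [Algebra k A] [Algebra k' B] {𝒜 : ℕ → Submodule k A} {ℬ : ℕ → Submodule k' B}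
  [GradedAlgebra 𝒜] [GradedAlgebra ℬ] (f : GradedRingHom 𝒜 ℬ)
  (hf : HomogeneousIdeal.irrelevant ℬ ≤ (HomogeneousIdeal.irrelevant 𝒜).map f)

theorem exists_mem_map_eq (hs : Function.Surjective f) {n : ℕ} {b : B} (hb : b ∈ ℬ n) :
    ∃ a ∈ 𝒜 n, f a = b := by
  obtain ⟨a, rfl⟩ := hs b
  refine ⟨GradedRing.proj 𝒜 n a, SetLike.coe_mem _, ?_⟩
  have h1 := GradedRingHom.map_directSumDecompose 𝒜 ℬ f (x := a) (i := n)
  exact h1.trans (DirectSum.decompose_of_mem_same ℬ hb)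

theorem away_map_surjective (hs : Function.Surjective f) {i : ℕ} {s : A} (hi : s ∈ 𝒜 i) :
    Function.Surjective (HomogeneousLocalization.Away.map f s) := by
  intro z
  obtain ⟨n, b, hb, rfl⟩ := HomogeneousLocalization.Away.mk_surjective ℬ (f.map_mem hi) z
  obtain ⟨a, ha, rfl⟩ := exists_mem_map_eq f hs hb
  exact ⟨HomogeneousLocalization.Away.mk 𝒜 hi n a ha, HomogeneousLocalization.Away.map_mk ..⟩

theorem isPullback_projMap {i : ℕ} (hi : 0 < i) {s : A} (hs : s ∈ 𝒜 i) :
    IsPullback (Spec.map (CommRingCat.ofHom (HomogeneousLocalization.Away.map f s)))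
      (Proj.awayι ℬ (f s) (f.map_mem hs) hi) (Proj.awayι 𝒜 s hs hi) (Proj.map f hf) := by
  refine IsOpenImmersion.isPullback _ _ _ _ (Proj.awayι_comp_map f hf hi s hs) ?_
  rw [Proj.opensRange_awayι, Proj.opensRange_awayι]
  rfl

/-- The assertion is local on the target, and over the locus `s ≠ 0` the morphism is `Spec` of a
surjection between the localizations in degree zero. -/
theorem isClosedImmersion_projMap (hs : Function.Surjective f) :
    IsClosedImmersion (Proj.map f hf) := by
  refine IsZariskiLocalAtTarget.of_openCover (Proj.affineOpenCover 𝒜).openCover fun i => ?_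
  have key : ∀ {i : ℕ} (hi : 0 < i) (s : A) (hs' : s ∈ 𝒜 i),
      IsClosedImmersion (pullback.snd (Proj.map f hf) (Proj.awayι 𝒜 s hs' hi)) := by
    intro i hi s hs'
    have h := isPullback_projMap f hf hi hs'
    have h1 : IsClosedImmersion
        (Spec.map (CommRingCat.ofHom (HomogeneousLocalization.Away.map f s))) :=
      IsClosedImmersion.spec_of_surjective _ (away_map_surjective f hs hs')
    rw [← h.flip.isoPullback_inv_snd]
    infer_instance
  exact key i.1.2 i.2 i.2.2

/-- The element `r / 1` of the localization, for `r` of degree zero. -/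
theorem fromZeroRingHom_eq_mk {i : ℕ} {s : A} (hs : s ∈ 𝒜 i) (r : 𝒜 0) :
    HomogeneousLocalization.fromZeroRingHom 𝒜 (Submonoid.powers s) r =
      HomogeneousLocalization.Away.mk 𝒜 hs 0 r.1 (by rw [zero_smul]; exact r.2) := by
  apply HomogeneousLocalization.val_injective
  rw [HomogeneousLocalization.Away.val_mk]
  change Localization.mk _ _ = _
  congr 1
  exact Subtype.ext (pow_zero s).symm

/-- Used for the compatibility of `Proj.map` with the projections to an affine base. On each chart
both sides are given by `r ↦ τ r / 1`. -/
theorem projMap_toSpecZero {R : Type} [CommRing R] (σ : R →+* 𝒜 0) (τ : R →+* ℬ 0)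
    (h : ∀ r, f (σ r).1 = (τ r).1) :
    Proj.map f hf ≫ Proj.toSpecZero 𝒜 ≫ Spec.map (CommRingCat.ofHom σ) =
      Proj.toSpecZero ℬ ≫ Spec.map (CommRingCat.ofHom τ) := by
  refine (Proj.mapAffineOpenCover f hf).openCover.hom_ext _ _ fun s => ?_
  have key : ∀ {i : ℕ} (hi : 0 < i) (s : A) (hs : s ∈ 𝒜 i),
      Proj.awayι ℬ (f s) (f.map_mem hs) hi ≫ Proj.map f hf ≫ Proj.toSpecZero 𝒜 ≫
        Spec.map (CommRingCat.ofHom σ) =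
      Proj.awayι ℬ (f s) (f.map_mem hs) hi ≫ Proj.toSpecZero ℬ ≫
        Spec.map (CommRingCat.ofHom τ) := by
    intro i hi s hs
    rw [Proj.awayι_comp_map_assoc f hf hi s hs, Proj.awayι_toSpecZero_assoc,
      Proj.awayι_toSpecZero_assoc, ← Spec.map_comp, ← Spec.map_comp, ← Spec.map_comp]
    congr 1
    ext1
    ext1 r
    change HomogeneousLocalization.Away.map f s (HomogeneousLocalization.fromZeroRingHom 𝒜 _ (σ r)) =
      HomogeneousLocalization.fromZeroRingHom ℬ _ (τ r)
    rw [fromZeroRingHom_eq_mk hs, fromZeroRingHom_eq_mk (show f s ∈ ℬ i from f.map_mem hs),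
      HomogeneousLocalization.Away.map_mk]
    congr 1
    exact h r
  exact key s.1.2 s.2 s.2.2

theorem awayToSection_mem_ker_iff [QuasiCompact (Proj.map f hf)] {i : ℕ} (hi : 0 < i) {s : A}
    (hs : s ∈ 𝒜 i) (x : HomogeneousLocalization.Away 𝒜 s) :
    (Proj.awayToSection 𝒜 s).hom x ∈ (Proj.map f hf).ker.ideal
      ⟨Proj.basicOpen 𝒜 s, Proj.isAffineOpen_basicOpen 𝒜 s hs hi⟩ ↔
    HomogeneousLocalization.Away.map f s x = 0 := by
  rw [Scheme.Hom.ker_apply, RingHom.mem_ker]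
  have h1 := congrArg (fun g => g.hom x) (Proj.awayToSection_comp_appLE f hf hs)
  have h2 : Function.Injective (Proj.awayToSection ℬ (f s)).hom :=
    (Proj.basicOpenIsoAway ℬ (f s) (f.map_mem hs) hi).commRingCatIsoToRingEquiv.injective
  rw [← map_eq_zero_iff _ h2]
  refine Iff.of_eq (congrArg (· = 0) ?_)
  refine Eq.trans ?_ h1
  rw [Scheme.Hom.app_eq_appLE]
  rfl

end ProjMap

/-! ### Ideal sheaves generated by homogeneous polynomials -/

namespace ProjSpace

variable {n : ℕ} {R : Type} [CommRing R]

theorem sum_eq_of_mem {d : ℕ} {G : MvPolynomial (Fin (n + 1)) R} (hG : G ∈ projGrading n R d)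
    {m : Fin (n + 1) →₀ ℕ} (hm : m ∈ G.support) : ∑ i, m i = d := by
  have := hG (MvPolynomial.mem_support_iff.mp hm)
  rw [← this, Finsupp.weight_apply, Finsupp.sum_fintype _ _ (fun _ => by simp)]
  simp

theorem irrelevant_le : (HomogeneousIdeal.irrelevant (projGrading n R)).toIdeal ≤
    Ideal.span (Set.range MvPolynomial.X) := by
  rw [HomogeneousIdeal.toIdeal_irrelevant_le]
  intro d hd G hG
  rw [← Set.image_univ]
  change G ∈ Ideal.span (MvPolynomial.X '' Set.univ)
  rw [MvPolynomial.mem_ideal_span_X_image]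
  intro m hm
  have hs := sum_eq_of_mem (show G ∈ projGrading n R d from hG) hm
  by_contra! h
  rw [Finset.sum_eq_zero (fun i _ => h i trivial)] at hs
  omega

theorem iSup_chart : ⨆ i, (chart n R i).1 = ⊤ :=
  Proj.iSup_basicOpen_eq_top (projGrading n R) _ irrelevant_le

/-- The homomorphism `X j ↦ X j / X i`. -/
def dehomogHom (n : ℕ) (R : Type) [CommRing R] (i : Fin (n + 1)) :
    MvPolynomial (Fin (n + 1)) R →+*
      HomogeneousLocalization.Away (projGrading n R) (MvPolynomial.X i) :=
  MvPolynomial.eval₂Hom ((HomogeneousLocalization.fromZeroRingHom (projGrading n R) _).comp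
    (algebraMap R (projGrading n R 0)))
    fun j => HomogeneousLocalization.Away.mk (projGrading n R) (X_mem n R i) 1 (MvPolynomial.X j)
      (by simpa using X_mem n R j)

theorem val_dehomogHom_mul {d : ℕ} (i : Fin (n + 1)) {G : MvPolynomial (Fin (n + 1)) R}
    (hG : G ∈ projGrading n R d) : (dehomogHom n R i G).val *
      algebraMap (MvPolynomial (Fin (n + 1)) R)
        (Localization.Away (MvPolynomial.X i : MvPolynomial (Fin (n + 1)) R))
        (MvPolynomial.X i : MvPolynomial (Fin (n + 1)) R) ^ d = algebraMap (MvPolynomial (Fin (n + 1)) R)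
          (Localization.Away (MvPolynomial.X i : MvPolynomial (Fin (n + 1)) R)) G := by
  set L := Localization.Away (MvPolynomial.X i : MvPolynomial (Fin (n + 1)) R)
  set v : HomogeneousLocalization.Away (projGrading n R) (MvPolynomial.X i) →+* L := algebraMap _ _
  have hX : ∀ j, v (dehomogHom n R i (MvPolynomial.X j)) *
      algebraMap (MvPolynomial (Fin (n + 1)) R) L (MvPolynomial.X i) =
      algebraMap (MvPolynomial (Fin (n + 1)) R) L (MvPolynomial.X j) := by
    intro j
    rw [dehomogHom, MvPolynomial.eval₂Hom_X']
    change (HomogeneousLocalization.val 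
      (HomogeneousLocalization.Away.mk (projGrading n R) (X_mem n R i) 1 _ _)) * _ = _
    rw [HomogeneousLocalization.Away.val_mk, Localization.mk_eq_mk']
    have := IsLocalization.mk'_spec L (MvPolynomial.X j : MvPolynomial (Fin (n + 1)) R)
      (⟨MvPolynomial.X i ^ 1, 1, rfl⟩ : Submonoid.powers (MvPolynomial.X i : MvPolynomial (Fin (n + 1)) R))
    simp only [pow_one] at this ⊢
    exact this
  have hC : ∀ r, v (dehomogHom n R i (MvPolynomial.C r)) =
      algebraMap (MvPolynomial (Fin (n + 1)) R) L (MvPolynomial.C r) := by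
    intro r
    rw [dehomogHom, MvPolynomial.eval₂Hom_C, RingHom.comp_apply]
    exact Localization.mk_one_eq_algebraMap _
  change v (dehomogHom n R i G) * _ = _
  rw [G.as_sum, map_sum, map_sum, map_sum, Finset.sum_mul]
  refine Finset.sum_congr rfl fun m hm => ?_
  rw [← sum_eq_of_mem hG hm, MvPolynomial.monomial_eq,
    Finsupp.prod_fintype _ _ (fun _ => pow_zero _), map_mul, map_mul, map_mul, map_prod, map_prod,
    map_prod, hC, mul_assoc, ← Finset.prod_pow_eq_pow_sum, ← Finset.prod_mul_distrib]
  congr 1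
  refine Finset.prod_congr rfl fun j _ => ?_
  rw [map_pow, map_pow, map_pow, ← mul_pow, hX]

/-- Division by `X i ^ d` is the restriction of a ring homomorphism to the polynomials of degree
`d`. This lets membership in an ideal generated by homogeneous polynomials pass to the charts. -/
theorem dehomogHom_eq {d : ℕ} (i : Fin (n + 1)) {G : MvPolynomial (Fin (n + 1)) R}
    (hG : G ∈ projGrading n R d) : dehomogHom n R i G =
      HomogeneousLocalization.Away.mk (projGrading n R) (X_mem n R i) d G (by simpa using hG) := by
  apply HomogeneousLocalization.val_injective
  rw [HomogeneousLocalization.Away.val_mk, Localization.mk_eq_mk', IsLocalization.eq_mk'_iff_mul_eq,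
    ← val_dehomogHom_mul i hG, map_pow]

end ProjSpace

/-- If the kernel of a homomorphism from `R[X₀, …, Xₙ]` is generated by `E`, then the ideal sheaf
generated by `E` is the kernel of the induced morphism to the projective space. -/
theorem idealSheaf_eq_ker {n : ℕ} {R k B : Type} [CommRing R] [CommRing k] [CommRing B]
    [Algebra k B] {ℬ : ℕ → Submodule k B} [GradedAlgebra ℬ]
    (E : Set (MvPolynomial (Fin (n + 1)) R)) (f : GradedRingHom (projGrading n R) ℬ)
    (hf : HomogeneousIdeal.irrelevant ℬ ≤ (HomogeneousIdeal.irrelevant (projGrading n R)).map f)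
    [QuasiCompact (Proj.map f hf)]
    (hker : RingHom.ker (f : MvPolynomial (Fin (n + 1)) R →+* B) = Ideal.span E)
    (hE : ∀ G ∈ E, ∃ d, G ∈ projGrading n R d) :
    idealSheaf n R E = (Proj.map f hf).ker := by
  refine le_antisymm (sInf_le ?_) (le_sInf fun J hJ => ?_)
  · intro i d G hGE hG
    refine (awayToSection_mem_ker_iff f hf one_pos (X_mem n R i) _).mpr ?_
    rw [HomogeneousLocalization.Away.map_mk]
    have h0 : f G = 0 := by
      have : G ∈ RingHom.ker (f : MvPolynomial (Fin (n + 1)) R →+* B) :=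
        hker ▸ Ideal.subset_span hGE
      exact this
    apply HomogeneousLocalization.val_injective
    rw [HomogeneousLocalization.Away.val_mk, h0, Localization.mk_zero,
      HomogeneousLocalization.val_zero]
  · refine Scheme.IdealSheafData.le_of_iSup_eq_top (ProjSpace.chart n R) ProjSpace.iSup_chart
      fun i z hz => ?_
    obtain ⟨x, rfl⟩ := (Proj.basicOpenIsoAway (projGrading n R) _ (X_mem n R i)
      one_pos).commRingCatIsoToRingEquiv.surjective z
    change (Proj.awayToSection _ _).hom x ∈ _ at hz
    change (Proj.awayToSection _ _).hom x ∈ _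
    have hx := (awayToSection_mem_ker_iff f hf one_pos (X_mem n R i) x).mp hz
    -- If the fraction `G / X i ^ d` is in the kernel, then `f` kills some `X i ^ m * G`. This
    -- product lies in the ideal of `E` and defines the same function on the chart.
    obtain ⟨d, G, hG, rfl⟩ := HomogeneousLocalization.Away.mk_surjective _ (X_mem n R i) x
    rw [HomogeneousLocalization.Away.map_mk] at hx
    have hx' := congrArg HomogeneousLocalization.val hx
    rw [HomogeneousLocalization.Away.val_mk, HomogeneousLocalization.val_zero,
      Localization.mk_eq_mk', IsLocalization.mk'_eq_zero_iff] at hx'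
    obtain ⟨⟨_, m, rfl⟩, hm⟩ := hx'
    have hmem : MvPolynomial.X i ^ m * G ∈ Ideal.span E := by
      rw [← hker, RingHom.mem_ker]
      change f _ = 0
      rw [map_mul, map_pow]
      exact hm
    have hG' : G ∈ projGrading n R d := by simpa using hG
    have hXG : MvPolynomial.X i ^ m * G ∈ projGrading n R (m + d) := by
      have := SetLike.mul_mem_graded (SetLike.pow_mem_graded m (X_mem n R i)) hG'
      simpa using this
    have h1 : HomogeneousLocalization.Away.mk (projGrading n R) (X_mem n R i) d G hG =
        ProjSpace.dehomogHom n R i (MvPolynomial.X i ^ m * G) := by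
      rw [map_mul, map_pow, ProjSpace.dehomogHom_eq i hG', ProjSpace.dehomogHom_eq i (X_mem n R i)]
      have : HomogeneousLocalization.Away.mk (projGrading n R) (X_mem n R i) 1 (MvPolynomial.X i)
          (by simpa using X_mem n R i) = 1 := by
        apply HomogeneousLocalization.val_injective
        rw [HomogeneousLocalization.Away.val_mk, HomogeneousLocalization.val_one]
        simp only [pow_one]
        exact Localization.mk_self (⟨MvPolynomial.X i, 1, pow_one _⟩ :
          Submonoid.powers (MvPolynomial.X i : MvPolynomial (Fin (n + 1)) R))
      rw [this, one_pow, one_mul]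
    rw [h1]
    have h2 : Ideal.span E ≤ (J.ideal (ProjSpace.chart n R i)).comap
        ((Proj.awayToSection (projGrading n R) (MvPolynomial.X i)).hom.comp
          (ProjSpace.dehomogHom n R i)) := by
      rw [Ideal.span_le]
      intro G hGE
      obtain ⟨d, hGd⟩ := hE G hGE
      have := hJ i d G hGE hGd
      rw [ProjSpace.dehomog, ← ProjSpace.dehomogHom_eq i hGd] at this
      exact this
    exact h2 hmem

theorem homogeneous_of_mem_equationsPerm (e : Equiv.Perm (Fin 4)) {G : MvPolynomial (Fin 2) R4}
    (hG : G ∈ equationsPerm e) : ∃ d, G ∈ projGrading 1 R4 d := by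
  have hC : ∀ i, affCoord i ∈ projGrading 1 R4 0 := fun i =>
    (MvPolynomial.mem_homogeneousSubmodule _ _).mpr (MvPolynomial.isHomogeneous_C _ _)
  have hX : ∀ i, homCoord i ∈ projGrading 1 R4 1 := X_mem 1 R4
  rcases hG with rfl | rfl | rfl
  · exact ⟨0, sub_mem (SetLike.mul_mem_graded (hC _) (hC _)) (SetLike.mul_mem_graded (hC _) (hC _))⟩
  · exact ⟨0 + 1, sub_mem (SetLike.mul_mem_graded (hC _) (hX _))
      (SetLike.mul_mem_graded (hC _) (hX _))⟩
  · exact ⟨0 + 1, sub_mem (SetLike.mul_mem_graded (hC _) (hX _))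
      (SetLike.mul_mem_graded (hC _) (hX _))⟩

/-! ### The closed embedding in `𝔸⁴ × ℙ¹` -/

namespace IsSide

variable {θ : Fin 2 → ℤ} {u v p q : Arrow} {e : Equiv.Perm (Fin 4)} (h : IsSide θ u v p q e)

/-- The presentation of the ring of semi-invariants as a homomorphism of graded rings. -/
def gradedPresentation : GradedRingHom (projGrading 1 R4) (grading (semiInv quiverAct θ)) where
  toRingHom := h.presentation
  map_mem := h.presentation_mem

include h in
/-- A homomorphism of graded rings which hits `u` and `v` defines a morphism between `Proj`s. -/
theorem irrelevant_le_map {k A : Type} [CommRing k] [CommRing A] [Algebra k A]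
    {𝒜 : ℕ → Submodule k A} [GradedAlgebra 𝒜]
    (f : GradedRingHom 𝒜 (grading (semiInv quiverAct θ))) {a b : A} (ha : a ∈ 𝒜 1) (hb : b ∈ 𝒜 1)
    (hau : (f a).1 = Polynomial.monomial 1 (co u)) (hbv : (f b).1 = Polynomial.monomial 1 (co v)) :
    HomogeneousIdeal.irrelevant (grading (semiInv quiverAct θ)) ≤
      (HomogeneousIdeal.irrelevant 𝒜).map f := by
  rw [← toIdeal_le_toIdeal_iff]
  refine h.irrelevant_le.trans (Ideal.span_le.mpr ?_)
  rintro _ (rfl | rfl)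
  · have : f a = homog _ 1 ⟨co u, h.co_u_mem⟩ := Subtype.ext hau
    rw [← this]
    exact Ideal.mem_map_of_mem f (HomogeneousIdeal.mem_irrelevant_of_mem _ one_pos ha)
  · have : f b = homog _ 1 ⟨co v, h.co_v_mem⟩ := Subtype.ext hbv
    rw [← this]
    exact Ideal.mem_map_of_mem f (HomogeneousIdeal.mem_irrelevant_of_mem _ one_pos hb)

include h in
-- The surjective `presentation` gives a closed immersion in `𝔸⁴ × ℙ¹`. By `idealSheaf_eq_ker` it
-- has the same ideal sheaf as the inclusion of `𝕍(E)`, and closed immersions with the same ideal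
-- sheaf have isomorphic sources.
theorem isSubvarietyDescription : IsSubvarietyDescription θ u v (equationsPerm e) := by
  have hΦ := h.irrelevant_le_map h.gradedPresentation (X_mem 1 R4 0) (X_mem 1 R4 1)
    h.presentation_homCoord_zero h.presentation_homCoord_one
  have hcl := isClosedImmersion_projMap h.gradedPresentation hΦ h.presentation_surjective
  have hker : RingHom.ker (h.gradedPresentation : MvPolynomial (Fin 2) R4 →+* SemiInvRing quiverAct θ) =
      Ideal.span (equationsPerm e) := h.ker_presentation
  have hI : (vanishing.ι 1 R4 (equationsPerm e)).ker = (Proj.map h.gradedPresentation hΦ).ker := by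
    refine (Scheme.IdealSheafData.ker_subschemeι _).trans ?_
    exact idealSheaf_eq_ker _ h.gradedPresentation hΦ hker
      fun _ => homogeneous_of_mem_equationsPerm e
  have : IsClosedImmersion (vanishing.ι 1 R4 (equationsPerm e)) :=
    inferInstanceAs (IsClosedImmersion (idealSheaf 1 R4 (equationsPerm e)).subschemeι)
  let w := IsClosedImmersion.lift (vanishing.ι 1 R4 (equationsPerm e))
    (Proj.map h.gradedPresentation hΦ) hI.le
  have hw : w ≫ vanishing.ι 1 R4 (equationsPerm e) = Proj.map h.gradedPresentation hΦ :=
    IsClosedImmersion.lift_fac _ _ _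
  have : IsIso w := IsClosedImmersion.isIso_of_ker_eq _ _ w hw hI.symm
  refine ⟨h.gradedPresentation, hΦ, asIso w, h.presentation_C_C, h.presentation_affCoord,
    h.presentation_homCoord_zero, h.presentation_homCoord_one, h.presentation_surjective, hker,
    hw, ?_⟩
  rw [asIso_hom, reassoc_of% hw, toConifold, Conifold.toA4, Category.assoc, ← Spec.map_comp,
    ← CommRingCat.ofHom_comp, ProjSpace.str, projStr]
  refine projMap_toSpecZero h.gradedPresentation hΦ _ _ fun r => ?_
  exact (h.toInvariants_mk r).symm

/-! ### Projectivity -/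

/-- The surjection from `R_c[e, f]`. -/
def relPresentation : MvPolynomial (Fin 2) ConifoldRing →+* SemiInvRing quiverAct θ :=
  MvPolynomial.eval₂Hom ((algebraMap (grading (semiInv quiverAct θ) 0) _).comp
    (toInvariants θ).toRingHom) ![homog _ 1 ⟨co u, h.co_u_mem⟩, homog _ 1 ⟨co v, h.co_v_mem⟩]

theorem relPresentation_map (G : MvPolynomial (Fin 2) R4) :
    h.relPresentation (MvPolynomial.map ConifoldRing.mk.toRingHom G) = h.presentation G := by
  have : h.relPresentation.comp (MvPolynomial.map ConifoldRing.mk.toRingHom) = h.presentation := by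
    refine MvPolynomial.ringHom_ext (fun r => ?_) fun i => ?_
    · rw [RingHom.comp_apply, MvPolynomial.map_C, relPresentation, MvPolynomial.eval₂Hom_C]
      exact h.toInvariants_mk r
    · rw [RingHom.comp_apply, MvPolynomial.map_X, relPresentation, MvPolynomial.eval₂Hom_X']
      exact (MvPolynomial.eval₂Hom_X' _ _ _).symm
  exact RingHom.congr_fun this G

theorem relPresentation_surjective : Function.Surjective h.relPresentation := fun s => by
  obtain ⟨G, rfl⟩ := h.presentation_surjective s
  exact ⟨_, h.relPresentation_map G⟩

theorem relPresentation_mem {G : MvPolynomial (Fin 2) ConifoldRing} {n : ℕ}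
    (hG : G ∈ projGrading 1 ConifoldRing n) :
    h.relPresentation G ∈ grading (semiInv quiverAct θ) n := by
  rw [G.as_sum, map_sum]
  refine Submodule.sum_mem _ fun k hk => ?_
  have hk' : k 0 + k 1 = n := by
    rw [← ProjSpace.sum_eq_of_mem hG hk, Fin.sum_univ_two]
  rw [MvPolynomial.monomial_eq, Finsupp.prod_fintype _ _ (fun _ => pow_zero _), Fin.prod_univ_two,
    map_mul, map_mul, map_pow, map_pow, relPresentation, MvPolynomial.eval₂Hom_C,
    MvPolynomial.eval₂Hom_X', MvPolynomial.eval₂Hom_X']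
  have h1 := SetLike.mul_mem_graded (toInvariants θ (G.coeff k)).2 (SetLike.mul_mem_graded
    (SetLike.pow_mem_graded (k 0) (homog_mem (semiInv quiverAct θ) 1 ⟨co u, h.co_u_mem⟩))
    (SetLike.pow_mem_graded (k 1) (homog_mem (semiInv quiverAct θ) 1 ⟨co v, h.co_v_mem⟩)))
  rw [smul_eq_mul, smul_eq_mul, mul_one, mul_one, hk', zero_add] at h1
  exact h1

/-- The surjection from `R_c[e, f]` as a homomorphism of graded rings. -/
def gradedRelPresentation :
    GradedRingHom (projGrading 1 ConifoldRing) (grading (semiInv quiverAct θ)) where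
  toRingHom := h.relPresentation
  map_mem := h.relPresentation_mem

include h in
-- Over the coordinate ring of the conifold `u` and `v` generate the ring of semi-invariants, so the
-- moduli space is closed in the projective line over the conifold.
theorem isProjective : IsProjective (toConifold θ) := by
  have hf := h.irrelevant_le_map h.gradedRelPresentation (X_mem 1 _ 0) (X_mem 1 _ 1)
    (congrArg Subtype.val (MvPolynomial.eval₂Hom_X' _ _ _))
    (congrArg Subtype.val (MvPolynomial.eval₂Hom_X' _ _ _))
  refine ⟨1, Proj.map h.gradedRelPresentation hf,
    isClosedImmersion_projMap _ hf h.relPresentation_surjective, ?_⟩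
  exact projMap_toSpecZero h.gradedRelPresentation hf _ _ fun r =>
    MvPolynomial.eval₂Hom_C _ _ r

/-! ### The fibre over the origin -/

/-- The restriction of semi-invariants to the locus `p = q = 0`. -/
def toFiberEv (u v : Arrow) : QRing →ₐ[ℂ] MvPolynomial (Fin 2) ℂ :=
  MvPolynomial.aeval fun a => if a = u then MvPolynomial.X 0 else
    if a = v then MvPolynomial.X 1 else 0

include h in
theorem toFiberEv_co : toFiberEv u v (co u) = MvPolynomial.X 0 ∧
    toFiberEv u v (co v) = MvPolynomial.X 1 ∧ toFiberEv u v (co p) = 0 ∧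
    toFiberEv u v (co q) = 0 := by
  have hn := h.nodup
  simp only [List.nodup_cons, List.mem_cons, not_or, List.not_mem_nil, List.nodup_nil] at hn
  obtain ⟨⟨h1, h2, h3, -⟩, ⟨h4, h5, -⟩, ⟨h6, -⟩, -⟩ := hn
  simp [toFiberEv, Ne.symm h1, Ne.symm h2, Ne.symm h3, Ne.symm h4, Ne.symm h5]

include h in
-- The monomials which contain `p` or `q` vanish, and the others have as degree in `u`, `v` their
-- weight.
theorem toFiberEv_mem {n : ℕ} {f : QRing} (hf : f ∈ semiInv quiverAct θ n) :
    toFiberEv u v f ∈ projGrading 1 ℂ n := by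
  obtain ⟨hu, hv, hp, hq⟩ := h.toFiberEv_co
  rw [f.as_sum, map_sum]
  refine Submodule.sum_mem _ fun m hm => ?_
  have hw := h.mem_semiInv_iff.mp hf m (MvPolynomial.mem_support_iff.mp hm)
  rw [h.monomial_eq, map_smul, map_mul, map_mul, map_mul, map_pow, map_pow, map_pow, map_pow,
    hu, hv, hp, hq]
  refine Submodule.smul_mem _ _ ?_
  by_cases hp0 : m p = 0
  · by_cases hq0 : m q = 0
    · rw [hp0, hq0, pow_zero, one_mul, one_mul]
      have h1 := SetLike.mul_mem_graded (SetLike.pow_mem_graded (m u) (X_mem 1 ℂ 0))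
        (SetLike.pow_mem_graded (m v) (X_mem 1 ℂ 1))
      rw [smul_eq_mul, smul_eq_mul, mul_one, mul_one, hw, hp0, hq0, zero_add, zero_add] at h1
      exact h1
    · rw [zero_pow hq0]; simp
  · rw [zero_pow hp0]; simp

/-- The restriction of the semi-invariants to the locus `p = q = 0`, as a homomorphism of graded
rings. -/
def toFiber : GradedRingHom (grading (semiInv quiverAct θ)) (projGrading 1 ℂ) where
  toRingHom := ((toFiberEv u v).toRingHom.comp (Polynomial.evalRingHom 1)).comp
    (gradedRing (semiInv quiverAct θ)).val.toRingHom
  map_mem {n s} hs := by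
    have hs' : s ∈ grading (semiInv quiverAct θ) n := hs
    rw [eq_homog_of_mem _ hs']
    have : Polynomial.eval 1 (Polynomial.monomial n (s.1.coeff n)) = s.1.coeff n := by simp
    exact Set.mem_of_eq_of_mem (congrArg (toFiberEv u v) this) (h.toFiberEv_mem (s.2 n))

theorem toFiber_homog {n : ℕ} (f : semiInv quiverAct θ n) :
    h.toFiber (homog _ n f) = toFiberEv u v f.1 := by
  have : Polynomial.eval 1 (Polynomial.monomial n f.1) = f.1 := by simp
  exact congrArg (toFiberEv u v) this

theorem toFiber_algebraMap (c : ℂ) : h.toFiber (algebraMap ℂ _ c) = MvPolynomial.C c := by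
  have : Polynomial.eval 1 (algebraMap ℂ (Polynomial QRing) c) = algebraMap ℂ QRing c := by
    simp [Polynomial.algebraMap_apply]
  exact (congrArg (toFiberEv u v) this).trans (AlgHom.commutes _ _)

theorem toFiber_surjective : Function.Surjective h.toFiber := by
  intro G
  induction G using MvPolynomial.induction_on with
  | C a => exact ⟨_, h.toFiber_algebraMap a⟩
  | add G G' hG hG' =>
    obtain ⟨s, rfl⟩ := hG
    obtain ⟨s', rfl⟩ := hG'
    exact ⟨s + s', map_add _ _ _⟩
  | mul_X G i hG =>
    obtain ⟨s, rfl⟩ := hG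
    fin_cases i
    · exact ⟨s * homog _ 1 ⟨co u, h.co_u_mem⟩, by
        rw [map_mul, h.toFiber_homog, h.toFiberEv_co.1]; rfl⟩
    · exact ⟨s * homog _ 1 ⟨co v, h.co_v_mem⟩, by
        rw [map_mul, h.toFiber_homog, h.toFiberEv_co.2.1]; rfl⟩

theorem toFiber_irrelevant_le : HomogeneousIdeal.irrelevant (projGrading 1 ℂ) ≤
    (HomogeneousIdeal.irrelevant (grading (semiInv quiverAct θ))).map h.toFiber := by
  rw [← toIdeal_le_toIdeal_iff]
  refine ProjSpace.irrelevant_le.trans (Ideal.span_le.mpr ?_)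
  rintro _ ⟨i, rfl⟩
  fin_cases i
  · have : MvPolynomial.X 0 = h.toFiber (homog _ 1 ⟨co u, h.co_u_mem⟩) := by
      rw [h.toFiber_homog, h.toFiberEv_co.1]
    exact Set.mem_of_eq_of_mem this (Ideal.mem_map_of_mem h.toFiber
      (HomogeneousIdeal.mem_irrelevant_of_mem _ one_pos (homog_mem _ 1 _)))
  · have : MvPolynomial.X 1 = h.toFiber (homog _ 1 ⟨co v, h.co_v_mem⟩) := by
      rw [h.toFiber_homog, h.toFiberEv_co.2.1]
    exact Set.mem_of_eq_of_mem this (Ideal.mem_map_of_mem h.toFiber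
      (HomogeneousIdeal.mem_irrelevant_of_mem _ one_pos (homog_mem _ 1 _)))

/-- The inclusion of the projective line in the moduli space. -/
def fiberι : ProjSpace 1 ℂ ⟶ ModuliSpace quiverAct θ := Proj.map h.toFiber h.toFiber_irrelevant_le

/-- Each of the four generating invariants contains `p` or `q`, so on the locus `p = q = 0` only the
constant term survives. -/
theorem toFiber_toInvariants (r : ConifoldRing) :
    h.toFiber (toInvariants θ r).1 = MvPolynomial.C (ConifoldRing.evalOrigin r) := by
  obtain ⟨r, rfl⟩ := Ideal.Quotient.mk_surjective r
  obtain ⟨hu, hv, hp, hq⟩ := h.toFiberEv_co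
  have key : (h.toFiber.toRingHom.comp h.presentation).comp MvPolynomial.C =
      MvPolynomial.C.comp (ConifoldRing.evalOrigin.comp ConifoldRing.mk).toRingHom := by
    refine MvPolynomial.ringHom_ext (fun a => ?_) fun i => ?_
    · have h2 := AlgHom.commutes (ConifoldRing.evalOrigin.comp ConifoldRing.mk) a
      refine (congrArg h.toFiber (h.presentation_C_C a)).trans ((h.toFiber_algebraMap a).trans ?_)
      exact congrArg MvPolynomial.C h2.symm
    · have h2 : h.presentation (affCoord i) = homog _ 0 ⟨invMonomial i, invMonomial_mem θ i⟩ :=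
        Subtype.ext (h.presentation_affCoord i)
      have h3 : ConifoldRing.evalOrigin (ConifoldRing.mk (MvPolynomial.X i)) = 0 :=
        MvPolynomial.aeval_X _ _
      refine (congrArg h.toFiber h2).trans ((h.toFiber_homog _).trans ?_)
      refine Eq.trans ?_ (congrArg MvPolynomial.C h3).symm
      obtain ⟨k, rfl⟩ := e.surjective i
      rw [map_zero]
      change toFiberEv u v (invMonomial (e k)) = 0
      rw [h.inv]
      fin_cases k <;> simp [hp, hq]
  exact (congrArg h.toFiber (h.toInvariants_mk r)).trans (RingHom.congr_fun key r)

theorem fiberι_toConifold : h.fiberι ≫ toConifold θ = ProjSpace.str 1 ℂ ≫ Conifold.origin := by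
  rw [fiberι, toConifold, ProjSpace.str, projStr, Conifold.origin, Category.assoc, ← Spec.map_comp,
    ← CommRingCat.ofHom_comp]
  refine projMap_toSpecZero h.toFiber h.toFiber_irrelevant_le _ _ fun r => ?_
  exact h.toFiber_toInvariants r

end IsSide

/-! ### Cartesian squares -/

/-- A commutative square of schemes is cartesian if it is so on an open cover. -/
theorem isPullback_of_cover {P X Y Z : Scheme.{0}} {f : P ⟶ X} {g : P ⟶ Y} {h : X ⟶ Z} {k : Y ⟶ Z}
    (comm : f ≫ h = g ≫ k) {I : Type} {P' X' Y' : I → Scheme.{0}}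
    (c : ∀ i, P' i ⟶ P) (a : ∀ i, X' i ⟶ X) (b : ∀ i, Y' i ⟶ Y)
    [∀ i, IsOpenImmersion (c i)] [∀ i, IsOpenImmersion (a i)] [∀ i, IsOpenImmersion (b i)]
    (f' : ∀ i, P' i ⟶ X' i) (g' : ∀ i, P' i ⟶ Y' i) (hf : ∀ i, f' i ≫ a i = c i ≫ f)
    (hg : ∀ i, g' i ≫ b i = c i ≫ g)
    (hp : ∀ i, IsPullback (f' i) (g' i) (a i ≫ h) (b i ≫ k))
    (cov : ∀ x y, h x = k y → ∃ i, x ∈ (a i).opensRange ∧ y ∈ (b i).opensRange)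
    (hr : ∀ i z, f z ∈ (a i).opensRange → g z ∈ (b i).opensRange → z ∈ (c i).opensRange) :
    IsPullback f g h k := by
  let w : P ⟶ pullback h k := pullback.lift f g comm
  have hw1 : w ≫ pullback.fst h k = f := pullback.lift_fst _ _ _
  have hw2 : w ≫ pullback.snd h k = g := pullback.lift_snd _ _ _
  let m : ∀ i, pullback (a i ≫ h) (b i ≫ k) ⟶ pullback h k := fun i =>
    pullback.map (a i ≫ h) (b i ≫ k) h k (a i) (b i) (𝟙 Z) (by simp) (by simp)
  have hm1 : ∀ i, m i ≫ pullback.fst h k = pullback.fst _ _ ≫ a i := fun i =>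
    pullback.lift_fst _ _ _
  have hm2 : ∀ i, m i ≫ pullback.snd h k = pullback.snd _ _ ≫ b i := fun i =>
    pullback.lift_snd _ _ _
  have hrange : ∀ i z, z ∈ (m i).opensRange ↔
      pullback.fst h k z ∈ (a i).opensRange ∧ pullback.snd h k z ∈ (b i).opensRange := by
    intro i z
    have := Scheme.Pullback.range_map (f := a i ≫ h) (g := b i ≫ k) h k (a i) (b i) (𝟙 Z)
      (by simp) (by simp)
    exact Set.ext_iff.mp this z
  -- Over the open piece `m i` of the fibre product, the comparison morphism `w` is that of the
  -- `i`-th small square, an isomorphism by `hp`. The hypothesis `hr` ensures that the preimage of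
  -- this piece is not larger than `c i`.
  have hsq : ∀ i, IsPullback (hp i).isoPullback.hom (c i) (m i) w := by
    intro i
    refine IsOpenImmersion.isPullback _ _ _ _ ?_ ?_
    · apply pullback.hom_ext
      · rw [Category.assoc, hw1, Category.assoc, hm1, IsPullback.isoPullback_hom_fst_assoc, hf]
      · rw [Category.assoc, hw2, Category.assoc, hm2, IsPullback.isoPullback_hom_snd_assoc, hg]
    · ext z
      change w z ∈ (m i).opensRange ↔ z ∈ (c i).opensRange
      rw [hrange, ← Scheme.Hom.comp_apply, ← Scheme.Hom.comp_apply, hw1, hw2]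
      refine ⟨fun hz => hr i z hz.1 hz.2, ?_⟩
      rintro ⟨y, rfl⟩
      rw [← Scheme.Hom.comp_apply, ← Scheme.Hom.comp_apply, ← hf, ← hg]
      exact ⟨⟨_, rfl⟩, ⟨_, rfl⟩⟩
  have : IsIso w := by
    have hcov : ∀ z : ↥(pullback h k), ∃ i, z ∈ (m i).opensRange := by
      intro z
      obtain ⟨i, hi⟩ := cov (pullback.fst h k z) (pullback.snd h k z) (by
        rw [← Scheme.Hom.comp_apply, ← Scheme.Hom.comp_apply, pullback.condition])
      exact ⟨i, (hrange i z).mpr hi⟩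
    let 𝒰 : (pullback h k).OpenCover := Scheme.Cover.mkOfCovers I _ m
      (fun z => ⟨(hcov z).choose, (hcov z).choose_spec⟩) fun _ => inferInstance
    refine IsZariskiLocalAtTarget.of_openCover (P := MorphismProperty.isomorphisms _) 𝒰 fun i => ?_
    change IsIso (pullback.snd w (m i))
    rw [← (hsq i).flip.isoPullback_inv_snd]
    infer_instance
  exact IsPullback.of_iso_pullback ⟨comm⟩ (asIso w) hw1 hw2

/-- The universal property of a pushout of commutative rings. -/
theorem isPushout_of_desc {R A K D : Type} [CommRing R] [CommRing A] [CommRing K] [CommRing D]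
    {f : R →+* A} {g : R →+* K} {g' : A →+* D} {f' : K →+* D} (comm : g'.comp f = f'.comp g)
    (desc : ∀ (T : Type) [CommRing T] (α : A →+* T) (β : K →+* T), α.comp f = β.comp g →
      ∃ γ : D →+* T, γ.comp g' = α ∧ γ.comp f' = β)
    (uniq : ∀ (T : Type) [CommRing T] (γ γ' : D →+* T), γ.comp g' = γ'.comp g' →
      γ.comp f' = γ'.comp f' → γ = γ') :
    IsPushout (CommRingCat.ofHom f) (CommRingCat.ofHom g) (CommRingCat.ofHom g')
      (CommRingCat.ofHom f') := by
  have key := fun s : PushoutCocone (CommRingCat.ofHom f) (CommRingCat.ofHom g) =>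
    desc s.pt s.inl.hom s.inr.hom (congrArg CommRingCat.Hom.hom s.condition)
  refine ⟨⟨congrArg CommRingCat.ofHom comm⟩, ⟨PushoutCocone.IsColimit.mk _
    (fun s => CommRingCat.ofHom (key s).choose)
    (fun s => CommRingCat.hom_ext (key s).choose_spec.1)
    (fun s => CommRingCat.hom_ext (key s).choose_spec.2) fun s m h1 h2 => ?_⟩⟩
  refine CommRingCat.hom_ext (uniq s.pt _ _ ?_ ?_)
  · exact (congrArg CommRingCat.Hom.hom h1).trans (key s).choose_spec.1.symm
  · exact (congrArg CommRingCat.Hom.hom h2).trans (key s).choose_spec.2.symm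

/-- For surjective `g` the tensor product `A ⊗_R K` is the quotient of `A` by the ideal generated by
the image of `ker g`. -/
theorem isPushout_of_ker {R A K D : Type} [CommRing R] [CommRing A] [CommRing K] [CommRing D]
    {f : R →+* A} {g : R →+* K} {g' : A →+* D} {f' : K →+* D} (comm : g'.comp f = f'.comp g)
    (hg : Function.Surjective g) (hg' : Function.Surjective g')
    (hk : RingHom.ker g' ≤ (RingHom.ker g).map f) :
    IsPushout (CommRingCat.ofHom f) (CommRingCat.ofHom g) (CommRingCat.ofHom g')
      (CommRingCat.ofHom f') := by
  refine isPushout_of_desc comm (fun T _ α β h => ?_) fun T _ γ γ' h _ =>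
    (RingHom.cancel_right hg').mp h
  have hα : RingHom.ker g' ≤ RingHom.ker α := by
    refine hk.trans (Ideal.map_le_iff_le_comap.mpr fun r hr => ?_)
    refine (RingHom.congr_fun h r).trans ?_
    rw [RingHom.comp_apply, (RingHom.mem_ker).mp hr, map_zero]
  have h1 : (g'.liftOfSurjective hg' ⟨α, hα⟩).comp g' = α :=
    g'.liftOfRightInverse_comp _ (Function.rightInverse_surjInv hg') ⟨α, hα⟩
  refine ⟨_, h1, (RingHom.cancel_right hg).mp ?_⟩
  rw [RingHom.comp_assoc, ← comm, ← RingHom.comp_assoc, h1, h]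

/-! ### The fibre over the origin, computed on the two charts -/

namespace IsSide

variable {θ : Fin 2 → ℤ} {u v p q : Arrow} {e : Equiv.Perm (Fin 4)} (h : IsSide θ u v p q e)

/-- The functions on a chart modulo the ideal of the fibre over the origin. -/
theorem sub_mem_span (c : C3) : c - MvPolynomial.aeval ![0, 0, MvPolynomial.X 2] c ∈
    Ideal.span {(MvPolynomial.X 0 : C3), MvPolynomial.X 1} := by
  induction c using MvPolynomial.induction_on with
  | C a => rw [MvPolynomial.aeval_C, MvPolynomial.algebraMap_eq, sub_self]; exact zero_mem _
  | add c c' hc hc' => rw [map_add, add_sub_add_comm]; exact add_mem hc hc'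
  | mul_X c i hc =>
    rw [map_mul, ← sub_add_sub_cancel _ (MvPolynomial.aeval _ c * MvPolynomial.X i),
      ← sub_mul, ← mul_sub, MvPolynomial.aeval_X]
    refine add_mem (Ideal.mul_mem_right _ _ hc) (Ideal.mul_mem_left _ _ ?_)
    fin_cases i
    · exact (sub_zero (MvPolynomial.X 0 : C3)).symm ▸ Ideal.subset_span (Set.mem_insert _ _)
    · exact (sub_zero (MvPolynomial.X 1 : C3)).symm ▸
        Ideal.subset_span (Set.mem_insert_of_mem _ rfl)
    · exact (sub_self (MvPolynomial.X 2 : C3)).symm ▸ zero_mem _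

include h in
-- The substitutions `u = 1` and `p = q = 0` commute.
theorem aeval_ev (f : QRing) : MvPolynomial.aeval ![0, 0, (MvPolynomial.X 2 : C3)] (ev u v p q f) =
    MvPolynomial.aeval ![1, (MvPolynomial.X 2 : C3)] (toFiberEv u v f) := by
  have key : (MvPolynomial.aeval ![0, 0, (MvPolynomial.X 2 : C3)]).comp (ev u v p q) =
      (MvPolynomial.aeval ![1, (MvPolynomial.X 2 : C3)]).comp (toFiberEv u v) := by
    obtain ⟨hu, hv, hp, hq⟩ := h.ev_co
    obtain ⟨hu', hv', hp', hq'⟩ := h.toFiberEv_co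
    refine MvPolynomial.algHom_ext fun a => ?_
    have ha : a = u ∨ a = v ∨ a = p ∨ a = q := by
      have := Finset.mem_univ a
      rw [h.univ_eq] at this
      simpa using this
    rw [AlgHom.comp_apply, AlgHom.comp_apply]
    change MvPolynomial.aeval _ (ev u v p q (co a)) = MvPolynomial.aeval _ (toFiberEv u v (co a))
    rcases ha with rfl | rfl | rfl | rfl
    · rw [hu, hu']; simp
    · rw [hv, hv']; simp
    · rw [hp, hp']; simp
    · rw [hq, hq']; simp
  exact DFunLike.congr_fun key f

variable (θ) in
/-- The homomorphism from `R_c` to the functions of degree zero on the locus `g ≠ 0`. -/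
def toAway (g : semiInv quiverAct θ 1) : ConifoldRing →+*
    HomogeneousLocalization.Away (grading (semiInv quiverAct θ)) (homog _ 1 g) :=
  (HomogeneousLocalization.fromZeroRingHom _ _).comp (toInvariants θ).toRingHom

theorem toRing_toAway (r : ConifoldRing) :
    h.isChart.toRing (toAway θ ⟨co u, h.co_u_mem⟩ r) = chartHom u v p q r := by
  have h1 := h.chart_toConifold
  rw [IsChart.chart, toConifold, Category.assoc, Proj.awayι_toSpecZero_assoc, ← Spec.map_comp,
    ← Spec.map_comp, ← CommRingCat.ofHom_comp, ← CommRingCat.ofHom_comp] at h1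
  exact RingHom.congr_fun (congrArg CommRingCat.Hom.hom (Spec.map_injective h1)) r

theorem toFiberEv_eq_zero {g : semiInv quiverAct θ 1} (hg : toFiberEv u v g.1 ≠ 0) {n : ℕ}
    {f : semiInv quiverAct θ n}
    (hf : HomogeneousLocalization.Away.map h.toFiber (homog _ 1 g) (fraction _ g n f) = 0) :
    toFiberEv u v f.1 = 0 := by
  rw [fraction] at hf
  erw [HomogeneousLocalization.Away.map_mk] at hf
  have h1 := congrArg HomogeneousLocalization.val hf
  rw [HomogeneousLocalization.Away.val_mk, HomogeneousLocalization.val_zero,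
    Localization.mk_eq_mk', IsLocalization.mk'_eq_zero_iff] at h1
  obtain ⟨⟨_, k, rfl⟩, hm⟩ := h1
  rw [h.toFiber_homog, h.toFiber_homog] at hm
  exact (mul_eq_zero.mp hm).resolve_left (pow_ne_zero _ hg)

include h in
theorem toFiberEv_symm (f : QRing) :
    toFiberEv v u f = MvPolynomial.rename (Equiv.swap 0 1) (toFiberEv u v f) := by
  obtain ⟨hu, hv, hp, hq⟩ := h.toFiberEv_co
  obtain ⟨hu', hv', hp', hq'⟩ := h.symm.toFiberEv_co
  have key : toFiberEv v u = (MvPolynomial.rename (Equiv.swap 0 1)).comp (toFiberEv u v) := by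
    refine MvPolynomial.algHom_ext fun a => ?_
    have ha : a = u ∨ a = v ∨ a = p ∨ a = q := by
      have := Finset.mem_univ a
      rw [h.univ_eq] at this
      simpa using this
    rw [AlgHom.comp_apply]
    change toFiberEv v u (co a) = MvPolynomial.rename _ (toFiberEv u v (co a))
    rcases ha with rfl | rfl | rfl | rfl
    · rw [hu, hv']; simp
    · rw [hv, hu']; simp
    · rw [hp, hp']; simp
    · rw [hq, hq']; simp
  exact DFunLike.congr_fun key f

include h in
-- On the chart, a function which vanishes for `p = q = 0` is in the ideal `(X 0, X 1)`, by
-- `sub_mem_span`. This ideal is generated by images of the invariants `p u` and `q u`, which vanish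
-- at the origin, and the isomorphism `toRing` carries the statement back to fractions.
theorem fraction_mem {n : ℕ} {f : semiInv quiverAct θ n} (hf : toFiberEv u v f.1 = 0) :
    fraction _ ⟨co u, h.co_u_mem⟩ n f ∈
      (RingHom.ker ConifoldRing.evalOrigin.toRingHom).map (toAway θ ⟨co u, h.co_u_mem⟩) := by
  have h3 : h.isChart.toRing (fraction _ _ n f) ∈
      Ideal.span {(MvPolynomial.X 0 : C3), MvPolynomial.X 1} := by
    have h4 := sub_mem_span (ev u v p q f.1)
    rw [h.aeval_ev, hf, map_zero, sub_zero] at h4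
    have h5 : h.isChart.toRing (fraction _ _ n f) = ev u v p q f.1 := by
      refine h.isChart.toRing_fraction ?_
      have h6 : (ev u v p q).toRingHom (co u) = 1 := h.ev_co.1
      rw [h6, one_pow, one_mul]
      rfl
    rwa [h5]
  have h6 : Ideal.span {(MvPolynomial.X 0 : C3), MvPolynomial.X 1} ≤
      ((RingHom.ker ConifoldRing.evalOrigin.toRingHom).map
        (toAway θ ⟨co u, h.co_u_mem⟩)).map h.isChart.toRing := by
    rw [Ideal.map_map, Ideal.span_le]
    have key : ∀ k, chartHom u v p q (ConifoldRing.coord k) ∈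
        (RingHom.ker ConifoldRing.evalOrigin.toRingHom).map
          (h.isChart.toRing.comp (toAway θ ⟨co u, h.co_u_mem⟩)) := fun k => by
      rw [← h.toRing_toAway]
      have hk : ConifoldRing.coord k ∈ RingHom.ker ConifoldRing.evalOrigin.toRingHom :=
        MvPolynomial.aeval_X _ _
      exact Ideal.mem_map_of_mem (h.isChart.toRing.comp (toAway θ ⟨co u, h.co_u_mem⟩)) hk
    rintro _ (rfl | rfl)
    · exact Set.mem_of_eq_of_mem (h.chartHom_coord 0).symm (key (e 0))
    · exact Set.mem_of_eq_of_mem (h.chartHom_coord 2).symm (key (e 2))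
  obtain ⟨y, hy, hyz⟩ := (Ideal.mem_map_iff_of_surjective _ h.isChart.toRing_surjective).mp (h6 h3)
  rwa [← h.isChart.toRing_injective hyz]

/-- This determines the fibre as a scheme and not only its points: the functions which vanish on the
projective line are generated by pullbacks from the maximal ideal of the origin. -/
theorem ker_le {g : semiInv quiverAct θ 1} (hg : g.1 = co u ∨ g.1 = co v) :
    RingHom.ker (HomogeneousLocalization.Away.map h.toFiber (homog _ 1 g)) ≤
      (RingHom.ker ConifoldRing.evalOrigin.toRingHom).map (toAway θ g) := by
  intro z hz
  obtain ⟨n, f, rfl⟩ := exists_fraction_eq _ _ z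
  obtain ⟨hu, hv, -⟩ := h.toFiberEv_co
  have hg0 : toFiberEv u v g.1 ≠ 0 := by
    rcases hg with hg | hg
    · rw [hg, hu]; exact MvPolynomial.X_ne_zero _
    · rw [hg, hv]; exact MvPolynomial.X_ne_zero _
  have h1 := h.toFiberEv_eq_zero hg0 hz
  obtain ⟨g, hg'⟩ := g
  rcases hg with rfl | rfl
  · exact h.fraction_mem h1
  · exact h.symm.fraction_mem (by rw [h.toFiberEv_symm, h1, map_zero])

theorem awayι_toConifold (g : semiInv quiverAct θ 1) :
    Proj.awayι (grading (semiInv quiverAct θ)) (homog _ 1 g) (homog_mem _ 1 g) one_pos ≫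
      toConifold θ = Spec.map (CommRingCat.ofHom (toAway θ g)) := by
  rw [toConifold, Proj.awayι_toSpecZero_assoc, ← Spec.map_comp, ← CommRingCat.ofHom_comp]
  rfl

theorem awayι_str {s : MvPolynomial (Fin 2) ℂ} (hs : s ∈ projGrading 1 ℂ 1) :
    Proj.awayι (projGrading 1 ℂ) s hs one_pos ≫ ProjSpace.str 1 ℂ =
      Spec.map (CommRingCat.ofHom ((HomogeneousLocalization.fromZeroRingHom _ _).comp
        (algebraMap ℂ (projGrading 1 ℂ 0)))) := by
  rw [ProjSpace.str, projStr, Proj.awayι_toSpecZero_assoc, ← Spec.map_comp,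
    ← CommRingCat.ofHom_comp]

theorem toFiber_homog_mem (g : semiInv quiverAct θ 1) :
    h.toFiber (homog _ 1 g) ∈ projGrading 1 ℂ 1 := h.toFiber.map_mem (homog_mem _ 1 g)

/-- The inclusion of the projective line on a chart. -/
def awayFiberι (g : semiInv quiverAct θ 1) :
    Spec (.of (HomogeneousLocalization.Away (projGrading 1 ℂ) (h.toFiber (homog _ 1 g)))) ⟶
    Spec (.of (HomogeneousLocalization.Away (grading (semiInv quiverAct θ)) (homog _ 1 g))) :=
  Spec.map (CommRingCat.ofHom (HomogeneousLocalization.Away.map h.toFiber (homog _ 1 g)))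

theorem awayFiberι_awayι (g : semiInv quiverAct θ 1) :
    h.awayFiberι g ≫ Proj.awayι _ _ (homog_mem _ 1 g) one_pos =
      Proj.awayι _ _ (h.toFiber_homog_mem g) one_pos ≫ h.fiberι :=
  (Proj.awayι_comp_map h.toFiber h.toFiber_irrelevant_le one_pos _ (homog_mem _ 1 g)).symm

theorem toFiber_comp_toAway (g : semiInv quiverAct θ 1) :
    (HomogeneousLocalization.Away.map h.toFiber (homog _ 1 g)).comp (toAway θ g) =
      ((HomogeneousLocalization.fromZeroRingHom _ _).comp
        (algebraMap ℂ (projGrading 1 ℂ 0))).comp ConifoldRing.evalOrigin.toRingHom := by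
  have h1 : (h.awayFiberι g ≫ Proj.awayι _ _ (homog_mem _ 1 g) one_pos) ≫ toConifold θ =
      (Proj.awayι _ _ (h.toFiber_homog_mem g) one_pos ≫ ProjSpace.str 1 ℂ) ≫ Conifold.origin := by
    rw [awayFiberι_awayι, Category.assoc, Category.assoc, fiberι_toConifold]
  rw [Category.assoc, awayι_toConifold, awayι_str, awayFiberι, Conifold.origin, ← Spec.map_comp,
    ← Spec.map_comp, ← CommRingCat.ofHom_comp, ← CommRingCat.ofHom_comp] at h1
  exact congrArg CommRingCat.Hom.hom (Spec.map_injective h1)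

theorem isPullback_awayFiberι {g : semiInv quiverAct θ 1} (hg : g.1 = co u ∨ g.1 = co v) :
    IsPullback (h.awayFiberι g)
      (Proj.awayι _ _ (h.toFiber_homog_mem g) one_pos ≫ ProjSpace.str 1 ℂ)
      (Proj.awayι _ _ (homog_mem _ 1 g) one_pos ≫ toConifold θ) Conifold.origin := by
  rw [awayι_toConifold, awayι_str]
  exact isPullback_SpecMap_of_isPushout _ _ _ _ (isPushout_of_ker (h.toFiber_comp_toAway g)
    (fun z => ⟨algebraMap ℂ _ z, AlgHom.commutes _ z⟩)
    (away_map_surjective _ h.toFiber_surjective (homog_mem _ 1 g)) (h.ker_le hg))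

theorem isPullback_fiber :
    IsPullback h.fiberι (ProjSpace.str 1 ℂ) (toConifold θ) Conifold.origin := by
  refine isPullback_of_cover h.fiberι_toConifold
    (I := {g : semiInv quiverAct θ 1 // g.1 = co u ∨ g.1 = co v})
    (fun g => Proj.awayι _ _ (h.toFiber_homog_mem g.1) one_pos)
    (fun g => Proj.awayι _ _ (homog_mem _ 1 g.1) one_pos) (fun _ => 𝟙 _)
    (fun g => h.awayFiberι g.1) (fun g => Proj.awayι _ _ (h.toFiber_homog_mem g.1) one_pos ≫
      ProjSpace.str 1 ℂ) (fun g => h.awayFiberι_awayι g.1) (fun _ => Category.comp_id _)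
    (fun g => ?_) (fun x y _ => ?_) fun g z hz _ => ?_
  · rw [Category.id_comp]
    exact h.isPullback_awayFiberι g.2
  · refine (h.mem_basicOpen_or x).elim (fun hx => ⟨⟨⟨co u, h.co_u_mem⟩, Or.inl rfl⟩, ?_, y, rfl⟩)
      fun hx => ⟨⟨⟨co v, h.co_v_mem⟩, Or.inr rfl⟩, ?_, y, rfl⟩
    · rw [Proj.opensRange_awayι]; exact hx
    · rw [Proj.opensRange_awayι]; exact hx
  · rw [Proj.opensRange_awayι] at hz ⊢
    exact hz

/-- The fibre of the moduli space over the origin is the projective line. -/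
def fiberIso : exceptionalFiber (toConifold θ) ≅ ProjSpace 1 ℂ := h.isPullback_fiber.isoPullback.symm

theorem fiberIso_hom_str : h.fiberIso.hom ≫ ProjSpace.str 1 ℂ = pullback.snd _ _ :=
  h.isPullback_fiber.isoPullback_inv_snd

end IsSide

/-! ### The moduli spaces as small resolutions -/

namespace Side

variable {θ : Fin 2 → ℤ} (s : Side θ)

include s in
/-- The moduli space is a small resolution of the conifold. -/
theorem isSmallResolution : IsSmallResolution (toConifold θ) where
  integral := s.atlas.isIntegral
  smooth := s.atlas.smooth
  projective := s.isSide.isProjective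
  surjective := s.atlas.surjective
  birational := s.atlas.birationalOver
  isIso_punctured := s.atlas.isIso_punctured
  fiber := ⟨s.isSide.fiberIso, s.isSide.fiberIso_hom_str⟩
  small := s.atlas.two_le_ringKrullDim (fun s => ⟨s.e 0, s.chartHom_coord 0⟩)
    fun s => ⟨s.e 2, s.chartHom_coord 2⟩

end Side

/-! ### The Atiyah flop -/

/-- The fibre of a fibre product over the conifold is the product of the fibres. -/
theorem isPullback_fiberMap {B M M' : Scheme} {β : B ⟶ Conifold} {π : M ⟶ Conifold}
    {π' : M' ⟶ Conifold} {φ : B ⟶ M} {φ' : B ⟶ M'} (h : φ ≫ π = β) (h' : φ' ≫ π' = β)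
    (hp : IsPullback φ φ' π π') :
    IsPullback (fiberMap β π φ h) (fiberMap β π' φ' h') (pullback.snd π Conifold.origin)
      (pullback.snd π' Conifold.origin) := by
  have h1 : fiberMap β π φ h ≫ pullback.fst _ _ = pullback.fst _ _ ≫ φ := pullback.lift_fst _ _ _
  have h2 : fiberMap β π φ h ≫ pullback.snd _ _ = pullback.snd _ _ := pullback.lift_snd _ _ _
  have h1' : fiberMap β π' φ' h' ≫ pullback.fst _ _ = pullback.fst _ _ ≫ φ' :=
    pullback.lift_fst _ _ _
  have h2' : fiberMap β π' φ' h' ≫ pullback.snd _ _ = pullback.snd _ _ := pullback.lift_snd _ _ _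
  have hw : ∀ t : PullbackCone (pullback.snd π Conifold.origin) (pullback.snd π' Conifold.origin),
      (t.fst ≫ pullback.fst _ _) ≫ π = (t.snd ≫ pullback.fst _ _) ≫ π' := fun t => by
    rw [Category.assoc, Category.assoc, pullback.condition, pullback.condition, ← Category.assoc,
      ← Category.assoc, t.condition]
  have hv : ∀ t : PullbackCone (pullback.snd π Conifold.origin) (pullback.snd π' Conifold.origin),
      hp.lift _ _ (hw t) ≫ β = (t.fst ≫ pullback.snd _ _) ≫ Conifold.origin := fun t => by
    rw [← h, hp.lift_fst_assoc, Category.assoc, Category.assoc, pullback.condition]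
  refine ⟨⟨h2.trans h2'.symm⟩, ⟨PullbackCone.IsLimit.mk _ (fun t => pullback.lift _ _ (hv t))
    (fun t => ?_) (fun t => ?_) fun t m hm hm' => ?_⟩⟩
  · apply pullback.hom_ext
    · rw [Category.assoc, h1, pullback.lift_fst_assoc, hp.lift_fst]
    · rw [Category.assoc, h2, pullback.lift_snd]
  · apply pullback.hom_ext
    · rw [Category.assoc, h1', pullback.lift_fst_assoc, hp.lift_snd]
    · rw [Category.assoc, h2', pullback.lift_snd, t.condition]
  · apply pullback.hom_ext
    · rw [pullback.lift_fst]
      apply hp.hom_ext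
      · rw [hp.lift_fst, Category.assoc, ← h1, reassoc_of% hm]
      · rw [hp.lift_snd, Category.assoc, ← h1', reassoc_of% hm']
    · rw [pullback.lift_snd, ← h2, reassoc_of% hm]

instance (θ : Fin 2 → ℤ) : IsSeparated (toConifold θ) := by
  unfold toConifold
  infer_instance

/-! ### The morphisms from the blow-up to the two moduli spaces -/

namespace Side

variable {θ : Fin 2 → ℤ} (s : Side θ)

/-- The coordinates `p u`, `p v`, `q / p` on the chart of the blow-up. -/
def blowupCoord' : C3 →ₐ[ℂ] C3 :=
  MvPolynomial.aeval ![MvPolynomial.X 0, MvPolynomial.X 0 * MvPolynomial.X 2, MvPolynomial.X 1]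

/-- The chart of `p u` lies over the locus `u ≠ 0` on one side and over `p ≠ 0` on the other. Since
`neg` exchanges the pairs `u, v` and `p, q`, the products `p v` and `q u` change places in the list
of invariants. -/
theorem blowupCoord'_comp : blowupCoord'.comp s.neg.chartHom = s.blowupHom := by
  have key : ∀ k, blowupCoord' (s.neg.chartHom (ConifoldRing.coord (s.neg.e k))) =
      s.blowupHom (ConifoldRing.coord (s.neg.e k)) := by
    intro k
    rw [s.neg.chartHom_coord]
    have h := fun k => s.blowupHom_coord k
    fin_cases k
    · refine Eq.trans ?_ (h 0).symm
      simp [blowupCoord']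
    · refine Eq.trans ?_ (h 2).symm
      simp [blowupCoord']
    · refine Eq.trans ?_ (h 1).symm
      simp [blowupCoord']
    · refine Eq.trans ?_ (h 3).symm
      simp [blowupCoord']
      ring
  have key' : (blowupCoord'.comp s.neg.chartHom).comp ConifoldRing.mk =
      s.blowupHom.comp ConifoldRing.mk := MvPolynomial.algHom_ext fun i => by
    obtain ⟨k, rfl⟩ := s.neg.e.surjective i
    exact key k
  refine AlgHom.ext fun r => ?_
  obtain ⟨r, rfl⟩ := Ideal.Quotient.mk_surjective r
  exact DFunLike.congr_fun key' r

theorem blowupCoord_chart_toConifold :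
    (Spec.map (CommRingCat.ofHom blowupCoord.toRingHom) ≫ s.chart) ≫ toConifold θ =
      s.blowupChart ≫ Blowup.toConifold := by
  rw [Category.assoc, chart_toConifold, blowupChart_toConifold, ← Spec.map_comp,
    ← CommRingCat.ofHom_comp]
  rfl

theorem blowupCoord'_chart_toConifold :
    (Spec.map (CommRingCat.ofHom blowupCoord'.toRingHom) ≫ s.neg.chart) ≫ toConifold (-θ) =
      s.blowupChart ≫ Blowup.toConifold := by
  rw [Category.assoc, chart_toConifold, blowupChart_toConifold, ← Spec.map_comp,
    ← CommRingCat.ofHom_comp, ← blowupCoord'_comp]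
  rfl

include s in
theorem exists_blowup_lift {M : Scheme.{0}} (π : M ⟶ Conifold) [IsSeparated π]
    [IsIso (π ∣_ Conifold.punctured)] (f : Side θ → (Spec (.of C3) ⟶ M))
    (hf : ∀ s, f s ≫ π = s.blowupChart ≫ Blowup.toConifold) :
    ∃ φ : Blowup ⟶ M, φ ≫ π = Blowup.toConifold ∧ ∀ s : Side θ, s.blowupChart ≫ φ = f s :=
  haveI := s.blowup_atlas.isReduced
  exists_lift_of_cover Conifold.punctured Blowup.toConifold s.blowup_atlas.dense_punctured π
    s.blowup_atlas.cover f hf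

/-- Let `α` and `β` be homomorphisms from the rings of the charts `u ≠ 0` and `p ≠ 0` which agree on
the conifold. Comparing the invariants, they agree on `p u`, and `q u` and `p v` are the products of
`p u` with `q / p` and `v / u`. So the pair amounts to a free choice of `p u`, `q / p` and `v / u`,
the coordinates of the chart of the blow-up. -/
theorem isPullback_blowupCoord :
    IsPullback (Spec.map (CommRingCat.ofHom blowupCoord.toRingHom))
      (Spec.map (CommRingCat.ofHom blowupCoord'.toRingHom)) (s.chart ≫ toConifold θ)
      (s.neg.chart ≫ toConifold (-θ)) := by
  rw [chart_toConifold, chart_toConifold]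
  refine isPullback_SpecMap_of_isPushout _ _ _ _ (isPushout_of_desc ?_ (fun T _ α β h => ?_)
    fun T _ γ γ' h h' => ?_)
  · exact congrArg AlgHom.toRingHom s.blowupCoord'_comp.symm
  · have hc : ∀ c : ℂ, α (MvPolynomial.C c) = β (MvPolynomial.C c) := fun c => by
      have h1 := RingHom.congr_fun h (algebraMap ℂ ConifoldRing c)
      have h2 := s.chartHom.commutes c
      have h3 := s.neg.chartHom.commutes c
      exact (congrArg α h2.symm).trans (h1.trans (congrArg β h3))
    have hk : ∀ k, α (s.chartHom (ConifoldRing.coord (s.e k))) =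
        β (s.neg.chartHom (ConifoldRing.coord (s.e k))) := fun k => RingHom.congr_fun h _
    have hβ := s.neg.chartHom_coord
    have h0 : α (MvPolynomial.X 0) = β (MvPolynomial.X 0) := by
      have := hk 0
      rw [s.chartHom_coord] at this
      exact this.trans (congrArg β (hβ 0))
    have h1 : α (MvPolynomial.X 1) = β (MvPolynomial.X 0) * β (MvPolynomial.X 2) := by
      have := hk 2
      rw [s.chartHom_coord] at this
      exact this.trans ((congrArg β (hβ 1)).trans (map_mul _ _ _))
    have h2 : β (MvPolynomial.X 1) = α (MvPolynomial.X 0) * α (MvPolynomial.X 2) := by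
      have := hk 1
      rw [s.chartHom_coord] at this
      exact ((congrArg β (hβ 2)).symm.trans this.symm).trans (map_mul _ _ _)
    refine ⟨MvPolynomial.eval₂Hom (α.comp MvPolynomial.C)
      ![α (MvPolynomial.X 0), β (MvPolynomial.X 2), α (MvPolynomial.X 2)],
      MvPolynomial.ringHom_ext (fun c => ?_) fun i => ?_,
      MvPolynomial.ringHom_ext (fun c => ?_) fun i => ?_⟩
    · simp [blowupCoord]
    · fin_cases i <;> simp [blowupCoord, h1, h0]
    · simp [blowupCoord', hc]
    · fin_cases i <;> simp [blowupCoord', h2, h0]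
  · refine MvPolynomial.ringHom_ext (fun c => ?_) fun i => ?_
    · simpa [blowupCoord] using RingHom.congr_fun h (MvPolynomial.C c)
    · have h0 := RingHom.congr_fun h (MvPolynomial.X 0)
      have h1 := RingHom.congr_fun h' (MvPolynomial.X 2)
      have h2 := RingHom.congr_fun h (MvPolynomial.X 2)
      fin_cases i
      · simpa [blowupCoord] using h0
      · simpa [blowupCoord'] using h1
      · simpa [blowupCoord] using h2

theorem chart_mem_basicOpen_v (y : Spec (.of C3)) : s.chart y ∈ Proj.basicOpen
    (grading (semiInv quiverAct θ)) (homog _ 1 ⟨co s.v, s.isSide.co_v_mem⟩) ↔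
      MvPolynomial.X 2 ∉ y.asIdeal := by
  refine s.isSide.isChart.chart_mem_basicOpen_iff _ _ ?_ y
  have h1 : (IsSide.ev s.u s.v s.p s.q).toRingHom (co s.u) = 1 := s.isSide.ev_co.1
  rw [h1, one_pow, one_mul]
  exact s.isSide.ev_co.2.1

theorem blowupChart_mem_basicOpen (k : Fin 4) (y : Spec (.of C3)) :
    s.blowupChart y ∈ Proj.basicOpen (grading originPow)
      (homog _ 1 ⟨ConifoldRing.coord (s.e k), coord_mem _⟩) ↔
    (![1, MvPolynomial.X 2, MvPolynomial.X 1, MvPolynomial.X 1 * MvPolynomial.X 2] k : C3) ∉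
      y.asIdeal := by
  refine s.isChart_blowup.chart_mem_basicOpen_iff _ _ ?_ y
  have h1 : s.blowupHom.toRingHom (ConifoldRing.coord (s.e 0)) = MvPolynomial.X 0 :=
    s.blowupHom_coord 0
  rw [h1, pow_one]
  refine (s.blowupHom_coord k).trans ?_
  fin_cases k <;> simp [mul_assoc]

end Side

/-! ### The blow-up as fibre product, and the absence of a morphism between the resolutions -/

namespace Side

variable {θ : Fin 2 → ℤ} (s : Side θ)

include s in
-- A pair of charts of the two moduli spaces is a choice of one of `u`, `v` and one of `p`, `q`;
-- their product is one of the four invariants and so names a chart of the blow-up. On each such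
-- triple the square is `isPullback_blowupCoord`.
theorem isPullback_blowup {φ : Blowup ⟶ ModuliSpace quiverAct θ}
    {φ' : Blowup ⟶ ModuliSpace quiverAct (-θ)} (h : φ ≫ toConifold θ = Blowup.toConifold)
    (h' : φ' ≫ toConifold (-θ) = Blowup.toConifold)
    (hφ : ∀ s : Side θ, s.blowupChart ≫ φ =
      Spec.map (CommRingCat.ofHom blowupCoord.toRingHom) ≫ s.chart)
    (hφ' : ∀ s : Side θ, s.blowupChart ≫ φ' =
      Spec.map (CommRingCat.ofHom blowupCoord'.toRingHom) ≫ s.neg.chart) :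
    IsPullback φ φ' (toConifold θ) (toConifold (-θ)) := by
  refine isPullback_of_cover (h.trans h'.symm) (I := Side θ) blowupChart chart
    (fun s => s.neg.chart) _ _ (fun s => (hφ s).symm) (fun s => (hφ' s).symm)
    isPullback_blowupCoord (fun x y _ => ?_) fun s z hz hz' => ?_
  -- The image of a chart depends only on the arrow called `u`, not on the names of the others.
  · have hy : ∀ s : Side θ, s.neg.symm.chart.opensRange = s.swap.neg.chart.opensRange :=
      fun s => by rw [opensRange_chart, opensRange_chart]; rfl
    have hy' : s.symm.neg.chart.opensRange = s.neg.chart.opensRange := by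
      rw [opensRange_chart, opensRange_chart]; rfl
    have hy'' : s.symm.swap.neg.chart.opensRange = s.swap.neg.chart.opensRange := by
      rw [opensRange_chart, opensRange_chart]; rfl
    have hx : ∀ s : Side θ, s.swap.chart.opensRange = s.chart.opensRange :=
      fun s => by rw [opensRange_chart, opensRange_chart]; rfl
    rcases s.mem_range_or x with h1 | h1 <;> rcases s.neg.mem_range_or y with h2 | h2
    · exact ⟨s, h1, h2⟩
    · exact ⟨s.swap, (hx s).symm ▸ h1, hy s ▸ h2⟩
    · exact ⟨s.symm, h1, hy'.symm ▸ h2⟩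
    · exact ⟨s.symm.swap, (hx s.symm).symm ▸ h1, hy''.symm ▸ hy s ▸ h2⟩
  · obtain ⟨i, hi⟩ := Blowup.exists_mem_basicOpen z
    rw [opensRange_chart] at hz hz'
    rw [opensRange_blowupChart]
    have hv : ∀ (k : Side θ) (y : Spec (.of C3)), φ (k.blowupChart y) ∈ Proj.basicOpen
        (grading (semiInv quiverAct θ)) (homog _ 1 ⟨co k.v, k.isSide.co_v_mem⟩) →
          MvPolynomial.X 2 ∉ y.asIdeal := fun k y hk => by
      rw [← Scheme.Hom.comp_apply, hφ, Scheme.Hom.comp_apply, chart_mem_basicOpen_v] at hk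
      intro hy
      refine hk ?_
      change blowupCoord (MvPolynomial.X 2) ∈ y.asIdeal
      rwa [blowupCoord, MvPolynomial.aeval_X]
    have hq : ∀ (k : Side θ) (y : Spec (.of C3)), φ' (k.blowupChart y) ∈ Proj.basicOpen
        (grading (semiInv quiverAct (-θ))) (homog _ 1 ⟨co k.q, k.neg.isSide.co_v_mem⟩) →
          MvPolynomial.X 1 ∉ y.asIdeal := fun k y hk => by
      have hk' := hk
      rw [← Scheme.Hom.comp_apply, hφ', Scheme.Hom.comp_apply] at hk'
      have hk'' := (k.neg.chart_mem_basicOpen_v _).mp hk'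
      intro hy
      refine hk'' ?_
      change blowupCoord' (MvPolynomial.X 2) ∈ y.asIdeal
      rwa [blowupCoord', MvPolynomial.aeval_X]
    -- The point `z` is in some chart of the blow-up. On the charts of `p v`, `q u`, `q v` the
    -- quotient of `p u` by that coordinate is `u / v`, `p / q` or their product, and `hz`, `hz'`
    -- make these nonzero.
    obtain ⟨k, rfl⟩ := s.e.surjective i
    fin_cases k
    · exact hi
    · have hi' : z ∈ s.symm.blowupChart.opensRange := by
        rw [opensRange_blowupChart]; exact hi
      obtain ⟨y, rfl⟩ := hi'
      exact (s.symm.blowupChart_mem_basicOpen 1 y).mpr (hv s.symm y hz)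
    · have hi' : z ∈ s.swap.blowupChart.opensRange := by
        rw [opensRange_blowupChart]; exact hi
      obtain ⟨y, rfl⟩ := hi'
      exact (s.swap.blowupChart_mem_basicOpen 2 y).mpr (hq s.swap y hz')
    · have hi' : z ∈ s.symm.swap.blowupChart.opensRange := by
        rw [opensRange_blowupChart]; exact hi
      obtain ⟨y, rfl⟩ := hi'
      refine (s.symm.swap.blowupChart_mem_basicOpen 3 y).mpr fun hy => ?_
      exact (y.isPrime.mem_or_mem hy).elim (hq s.symm.swap y hz') (hv s.symm.swap y hz)

/-- Two independent coordinates at the origin do not divide each other. -/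
theorem not_X_dvd {i j : Fin 3} (hij : i ≠ j) {g : C3} (hg : MvPolynomial.constantCoeff g ≠ 0)
    {w : Localization.Away g} (hw : algebraMap C3 (Localization.Away g) (MvPolynomial.X j) =
      algebraMap C3 (Localization.Away g) (MvPolynomial.X i) * w) : False := by
  obtain ⟨n, a, ha⟩ := IsLocalization.Away.surj g w
  have hg0 : g ≠ 0 := fun h => hg (by rw [h, map_zero])
  have h1 : (MvPolynomial.X j : C3) * g ^ n = MvPolynomial.X i * a := by
    refine IsLocalization.injective (Localization.Away g)
      (powers_le_nonZeroDivisors_of_noZeroDivisors hg0) ?_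
    rw [map_mul, map_mul, map_pow, hw, mul_assoc, ha]
  rcases (MvPolynomial.X_prime (i := i)).dvd_or_dvd ⟨a, h1⟩ with h2 | h2
  · exact hij (MvPolynomial.X_dvd_X.mp h2)
  · obtain ⟨b, hb⟩ := (MvPolynomial.X_prime (i := i)).dvd_of_dvd_pow h2
    exact hg (by rw [hb, map_mul, MvPolynomial.constantCoeff_X, zero_mul])

/-- The origin of a chart. -/
def chartOrigin : Spec (.of C3) :=
  ⟨RingHom.ker (MvPolynomial.constantCoeff : C3 →+* ℂ), RingHom.ker_isPrime _⟩

include s in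
/-- The identity of the punctured conifold does not extend to a morphism of moduli spaces. -/
theorem not_exists_hom :
    ¬ ∃ r : ModuliSpace quiverAct θ ⟶ ModuliSpace quiverAct (-θ),
      r ≫ toConifold (-θ) = toConifold θ := by
  rintro ⟨r, hr⟩
  -- Near the origin of the chart the morphism `r` maps a basic open set `D(g)` to one chart of the
  -- target, so it is given there by a homomorphism `ψ` compatible with the maps from the conifold.
  have key : ∀ (t : Side (-θ)), (s.chart ≫ r) chartOrigin ∈ t.chart.opensRange →
      ∃ g : C3, MvPolynomial.constantCoeff g ≠ 0 ∧ ∃ ψ : C3 →+* Localization.Away g,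
        ∀ c, ψ (t.chartHom c) = algebraMap C3 (Localization.Away g) (s.chartHom c) := by
    intro t ht
    obtain ⟨_, ⟨_, ⟨g, rfl⟩, rfl⟩, hg, hgt⟩ := PrimeSpectrum.isBasis_basic_opens.exists_subset_of_mem_open
      ht ((s.chart ≫ r) ⁻¹ᵁ t.chart.opensRange).isOpen
    let l : Spec (.of (Localization.Away g)) ⟶ Spec (.of C3) :=
      Spec.map (CommRingCat.ofHom (algebraMap C3 (Localization.Away g)))
    have hl : Set.range (l ≫ s.chart ≫ r) ⊆ Set.range t.chart := by
      rintro _ ⟨y, rfl⟩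
      refine hgt ?_
      have : l y ∈ Set.range (PrimeSpectrum.comap (algebraMap C3 (Localization.Away g))) := ⟨y, rfl⟩
      rwa [PrimeSpectrum.localization_away_comap_range _ g] at this
    let m := IsOpenImmersion.lift t.chart (l ≫ s.chart ≫ r) hl
    have hm : m ≫ t.chart = l ≫ s.chart ≫ r := IsOpenImmersion.lift_fac _ _ _
    have hm' := congrArg (· ≫ toConifold (-θ)) hm
    dsimp only at hm'
    rw [Category.assoc, Category.assoc, Category.assoc, hr, chart_toConifold, chart_toConifold,
      ← Spec.map_preimage m, ← Spec.map_comp, ← Spec.map_comp] at hm'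
    refine ⟨g, fun h0 => hg ?_, (Spec.preimage m).hom, fun c => ?_⟩
    · exact h0
    · exact RingHom.congr_fun (congrArg CommRingCat.Hom.hom (Spec.map_injective hm')) c
  have hc := s.chartHom_coord
  -- If the origin is mapped to the chart `p ≠ 0`, then `q / p` is regular near it, so `X 0 = p u`
  -- divides `X 1 = q u` there. For the chart `q ≠ 0` the roles are exchanged. Both are excluded by
  -- `not_X_dvd`.
  rcases s.neg.mem_range_or ((s.chart ≫ r) chartOrigin) with h | h
  · obtain ⟨g, hg, ψ, hψ⟩ := key _ h
    have h0 := hψ (ConifoldRing.coord (s.e 0))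
    have h1 := hψ (ConifoldRing.coord (s.e 2))
    rw [hc] at h0 h1
    have h0' := s.neg.chartHom_coord 0
    have h1' := s.neg.chartHom_coord 1
    refine not_X_dvd (i := 0) (j := 1) (by decide) hg (w := ψ (MvPolynomial.X 2)) ?_
    refine h1.symm.trans ((congrArg ψ h1').trans ((map_mul ψ _ _).trans ?_))
    exact congrArg (· * _) ((congrArg ψ h0').symm.trans h0)
  · obtain ⟨g, hg, ψ, hψ⟩ := key _ h
    have h0 := hψ (ConifoldRing.coord (s.e 2))
    have h1 := hψ (ConifoldRing.coord (s.e 0))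
    rw [hc] at h0 h1
    have h0' := s.neg.symm.chartHom_coord 0
    have h1' := s.neg.symm.chartHom_coord 1
    refine not_X_dvd (i := 1) (j := 0) (by decide) hg (w := ψ (MvPolynomial.X 2)) ?_
    refine h1.symm.trans ((congrArg ψ h1').trans ((map_mul ψ _ _).trans ?_))
    exact congrArg (· * _) ((congrArg ψ h0').symm.trans h0)

include s in
/-- The moduli spaces for `θ` and `-θ` are related by the Atiyah flop. -/
theorem isAtiyahFlop : IsAtiyahFlop (toConifold θ) (toConifold (-θ)) where
  diagram := by
    have := s.atlas.isIso_punctured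
    have := s.neg.atlas.isIso_punctured
    obtain ⟨φ, h, hφ⟩ := s.exists_blowup_lift _ _ blowupCoord_chart_toConifold
    obtain ⟨φ', h', hφ'⟩ := s.exists_blowup_lift _ _ blowupCoord'_chart_toConifold
    -- Since the blow-up is the fibre product of the two moduli spaces, its fibre over the origin is
    -- the product of their fibres.
    have h1 := isPullback_fiberMap h h' (s.isPullback_blowup h h' hφ hφ')
    let η := s.isSide.fiberIso
    let η' := s.neg.isSide.fiberIso
    have hη : η.hom ≫ ProjSpace.str 1 ℂ = pullback.snd _ _ := s.isSide.fiberIso_hom_str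
    have hη' : η'.hom ≫ ProjSpace.str 1 ℂ = pullback.snd _ _ := s.neg.isSide.fiberIso_hom_str
    have h2 : IsPullback (fiberMap _ _ φ h ≫ η.hom) (fiberMap _ _ φ' h' ≫ η'.hom)
        (ProjSpace.str 1 ℂ) (ProjSpace.str 1 ℂ) :=
      h1.of_iso (Iso.refl _) η η' (Iso.refl _) (by simp) (by simp) (by simpa using hη.symm)
        (by simpa using hη'.symm)
    exact ⟨φ, φ', h, h', h2.isoPullback, η, η', hη, hη', h2.isoPullback_hom_fst.symm,
      h2.isoPullback_hom_snd.symm⟩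
  not_extend := s.not_exists_hom
  not_extend' := by
    have h := s.neg.not_exists_hom
    rwa [neg_neg] at h

end Side

/-! ### The universal representation -/

section Universal

variable {Λ : Type} [Ring Λ] [Algebra ℂ Λ] (e : Fin 2 → Λ)

theorem RepRing.entry_algebraMap (c : ℂ) (i j : Fin 2) :
    RepRing.entry e (algebraMap ℂ Λ c) i j = if i = j then algebraMap ℂ _ c else 0 := by
  have h := RepRing.mk_eq_zero e (RepRel.scalar c i j)
  rw [map_sub, sub_eq_zero] at h
  refine h.trans ?_
  split_ifs
  · rfl
  · exact map_zero _

theorem RepRing.entry_add (a b : Λ) (i j : Fin 2) :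
    RepRing.entry e (a + b) i j = RepRing.entry e a i j + RepRing.entry e b i j := by
  have h := RepRing.mk_eq_zero e (RepRel.add a b i j)
  rw [map_sub, sub_eq_zero, map_add] at h
  exact h

theorem RepRing.entry_mul (a b : Λ) (i j : Fin 2) :
    RepRing.entry e (a * b) i j = ∑ m, RepRing.entry e a i m * RepRing.entry e b m j := by
  have h := RepRing.mk_eq_zero e (RepRel.mul a b i j)
  rw [map_sub, sub_eq_zero, map_sum] at h
  refine h.trans (Finset.sum_congr rfl fun m _ => map_mul _ _ _)

theorem RepRing.entry_idem (m i j : Fin 2) :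
    RepRing.entry e (e m) i j = if i = m ∧ j = m then 1 else 0 := by
  have h := RepRing.mk_eq_zero e (RepRel.idem m i j)
  rw [map_sub, sub_eq_zero] at h
  refine h.trans ?_
  split_ifs
  · exact map_one _
  · exact map_zero _

/-- The universal representation. -/
def RepRing.univ : Λ →ₐ[ℂ] Matrix (Fin 2) (Fin 2) (RepRing e) :=
  AlgHom.ofLinearMap
    { toFun a := Matrix.of (RepRing.entry e a)
      map_add' a b := by
        ext i j
        exact RepRing.entry_add e a b i j
      map_smul' c a := by
        ext i j
        rw [Algebra.smul_def]
        refine (RepRing.entry_mul e _ _ i j).trans ?_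
        simp [RepRing.entry_algebraMap, Algebra.smul_def] }
    (by
      ext i j
      refine (congrArg (fun a => RepRing.entry e a i j) (map_one (algebraMap ℂ Λ)).symm).trans ?_
      rw [RepRing.entry_algebraMap, map_one, Matrix.one_apply])
    (fun a b => by
      ext i j
      exact (RepRing.entry_mul e a b i j).trans (Matrix.mul_apply).symm)

theorem RepRing.univ_apply (a : Λ) (i j : Fin 2) :
    RepRing.univ e a i j = RepRing.entry e a i j := rfl

variable {e}

theorem RepRing.algHom_ext {B : Type} [CommRing B] [Algebra ℂ B] {f g : RepRing e →ₐ[ℂ] B}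
    (h : ∀ a i j, f (RepRing.entry e a i j) = g (RepRing.entry e a i j)) : f = g :=
  Ideal.Quotient.algHom_ext _ (MvPolynomial.algHom_ext fun t => h t.1 t.2.1 t.2.2)

theorem RepRing.lift_entry {B : Type} [CommRing B] [Algebra ℂ B]
    (x : Λ → Matrix (Fin 2) (Fin 2) B) (hc ha hm he) (a : Λ) (i j : Fin 2) :
    RepRing.lift e x hc ha hm he (RepRing.entry e a i j) = x a i j :=
  MvPolynomial.aeval_X _ _

theorem repAct_entry (g : GLα) (a : Λ) (i j : Fin 2) : repAct e g (RepRing.entry e a i j) =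
    ((g i * (g j)⁻¹ : ℂˣ) : ℂ) • RepRing.entry e a i j :=
  RepRing.lift_entry _ _ _ _ _ a i j

theorem Rep.eval_entry (V : Rep e) (a : Λ) (i j : Fin 2) :
    V.eval (RepRing.entry e a i j) = V.hom a i j :=
  RepRing.lift_entry _ _ _ _ _ a i j

end Universal

/-! ### Representations of the conifold algebra -/

namespace ConifoldAlgebra

theorem mem_of_gen_mem {S : Subalgebra ℂ ConifoldAlgebra} (h : ∀ i, gen i ∈ S)
    (a : ConifoldAlgebra) : a ∈ S := by
  obtain ⟨a, rfl⟩ := RingQuot.mkAlgHom_surjective ℂ ConifoldRel a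
  induction a using FreeAlgebra.induction with
  | grade0 c => rw [AlgHom.commutes]; exact S.algebraMap_mem c
  | grade1 i => exact h i
  | mul a b ha hb => rw [map_mul]; exact S.mul_mem ha hb
  | add a b ha hb => rw [map_add]; exact S.add_mem ha hb

theorem algHom_ext {B : Type} [Ring B] [Algebra ℂ B] {f g : ConifoldAlgebra →ₐ[ℂ] B}
    (h : ∀ i, f (gen i) = g (gen i)) : f = g :=
  AlgHom.ext fun a => mem_of_gen_mem (S := AlgHom.equalizer f g) h a

theorem gen_zero_mul : gen 0 * gen 2 = -(gen 2 * gen 0) := by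
  have h := RingQuot.mkAlgHom_rel ℂ ConifoldRel.xz
  rw [map_neg, map_mul, map_mul] at h
  exact h

theorem gen_one_mul : gen 1 * gen 2 = -(gen 2 * gen 1) := by
  have h := RingQuot.mkAlgHom_rel ℂ ConifoldRel.yz
  rw [map_neg, map_mul, map_mul] at h
  exact h

theorem gen_two_eq : gen 2 = idem 0 - idem 1 := by
  have h : ((1 / 2 : ℂ) + 1 / 2) = 1 := by norm_num
  change _ = (1 / 2 : ℂ) • (1 + gen 2) - (1 / 2 : ℂ) • (1 - gen 2)
  rw [smul_add, smul_sub, add_sub_sub_cancel, ← add_smul, h, one_smul]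

/-- The matrices `X`, `Y`, `Z` of the universal representation. -/
def mat : Fin 3 → Matrix (Fin 2) (Fin 2) QRing :=
  ![!![0, co .x₂; co .x₃, 0], !![0, co .y₂; co .y₃, 0], !![1, 0; 0, -1]]

/-- The squares of the off-diagonal matrices `X` and `Y` are scalar, hence central, and off-diagonal
matrices anticommute with `diag(1, -1)`. -/
theorem lift_mat_rel {x y : FreeAlgebra ℂ (Fin 3)} (h : ConifoldRel x y) :
    FreeAlgebra.lift ℂ mat x = FreeAlgebra.lift ℂ mat y := by
  cases h <;> simp [mat, pow_two, Matrix.one_fin_two] <;> refine ⟨?_, ?_⟩ <;> ring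

/-- The universal representation over `ℂ[x₂, x₃, y₂, y₃]`. -/
def toMatrix : ConifoldAlgebra →ₐ[ℂ] Matrix (Fin 2) (Fin 2) QRing :=
  RingQuot.liftAlgHom ℂ ⟨FreeAlgebra.lift ℂ mat, fun _ _ => lift_mat_rel⟩

theorem toMatrix_gen (i : Fin 3) : toMatrix (gen i) = mat i :=
  (RingQuot.liftAlgHom_mkAlgHom_apply ℂ _ _ _).trans (FreeAlgebra.lift_ι_apply _ _)

theorem toMatrix_idem (i : Fin 2) : toMatrix (idem i) = Matrix.single i i 1 := by
  fin_cases i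
  · change toMatrix ((1 / 2 : ℂ) • (1 + gen 2)) = _
    rw [map_smul, map_add, map_one, toMatrix_gen]
    ext i j
    fin_cases i <;> fin_cases j <;> simp [mat, ← two_smul ℂ, smul_smul, Matrix.single]
  · change toMatrix ((1 / 2 : ℂ) • (1 - gen 2)) = _
    rw [map_smul, map_sub, map_one, toMatrix_gen]
    ext i j
    fin_cases i <;> fin_cases j <;> simp [mat, ← two_smul ℂ, smul_smul, Matrix.single]

end ConifoldAlgebra

namespace ConifoldAlgebra

theorem entry_gen_two (i j : Fin 2) :
    RepRing.entry idem (gen 2) i j = (!![1, 0; 0, -1] : Matrix _ _ (RepRing idem)) i j := by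
  have h := map_sub (RepRing.univ idem) (idem 0) (idem 1)
  rw [← gen_two_eq] at h
  have h' : RepRing.entry idem (gen 2) i j =
      RepRing.entry idem (idem 0) i j - RepRing.entry idem (idem 1) i j := congrFun (congrFun h i) j
  rw [h', RepRing.entry_idem, RepRing.entry_idem]
  fin_cases i <;> fin_cases j <;> simp

/-- As `gen 2` acts by `diag(1, -1)`, anticommuting with it forces a diagonal entry to be its own
negative, and `2` is invertible. -/
theorem entry_diag {a : ConifoldAlgebra} (h : a * gen 2 = -(gen 2 * a)) (i : Fin 2) :
    RepRing.entry idem a i i = 0 := by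
  have h1 := congrArg (RepRing.univ idem) h
  rw [map_neg] at h1
  have h2 : RepRing.entry idem (a * gen 2) i i = -RepRing.entry idem (gen 2 * a) i i :=
    congrFun (congrFun h1 i) i
  rw [RepRing.entry_mul, RepRing.entry_mul, Fin.sum_univ_two, Fin.sum_univ_two] at h2
  simp only [entry_gen_two] at h2
  have h3 : ∀ x : RepRing idem, x = -x → x = 0 := fun x hx => by
    have h4 : (2 : ℂ) • x = 0 := by rw [two_smul]; nth_rewrite 1 [hx]; exact neg_add_cancel x
    exact (smul_eq_zero_iff_right two_ne_zero).mp h4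
  fin_cases i
  · exact h3 _ (by simpa using h2)
  · refine h3 (RepRing.entry idem a 1 1) ?_
    simp at h2
    linear_combination -h2

/-- The homomorphism from the coordinate ring of `rep_α Λ_c` to that of `rep_α Q`. -/
def toQRing : RepRing idem →ₐ[ℂ] QRing :=
  RepRing.lift idem toMatrix (fun c => toMatrix.commutes c) (map_add toMatrix) (map_mul toMatrix)
    toMatrix_idem

theorem toQRing_entry (a : ConifoldAlgebra) (i j : Fin 2) :
    toQRing (RepRing.entry idem a i j) = toMatrix a i j := RepRing.lift_entry _ _ _ _ _ a i j

/-- The entry of the universal representation at an arrow. -/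
def arrowEntry : Arrow → RepRing idem
  | .x₂ => RepRing.entry idem (gen 0) 0 1
  | .x₃ => RepRing.entry idem (gen 0) 1 0
  | .y₂ => RepRing.entry idem (gen 1) 0 1
  | .y₃ => RepRing.entry idem (gen 1) 1 0

/-- The homomorphism from the coordinate ring of `rep_α Q` to that of `rep_α Λ_c`. -/
def ofQRing : QRing →ₐ[ℂ] RepRing idem := MvPolynomial.aeval arrowEntry

theorem ofQRing_co (a : Arrow) : ofQRing (co a) = arrowEntry a := MvPolynomial.aeval_X _ _

theorem toQRing_arrowEntry (a : Arrow) : toQRing (arrowEntry a) = co a := by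
  cases a <;> refine (toQRing_entry _ _ _).trans ?_ <;> rw [toMatrix_gen] <;> rfl

/-- It is enough to compare the matrices of the generators: the diagonals of `X` and `Y` vanish by
`entry_diag`, their other entries are the images of the arrows, and `Z` is the difference of the
idempotents. -/
theorem mapMatrix_comp_toMatrix : ofQRing.mapMatrix.comp toMatrix = RepRing.univ idem := by
  refine algHom_ext fun k => ?_
  rw [AlgHom.comp_apply, toMatrix_gen]
  ext i j
  rw [AlgHom.mapMatrix_apply, Matrix.map_apply, RepRing.univ_apply]
  fin_cases k
  · fin_cases i <;> fin_cases j
    · exact (map_zero _).trans (entry_diag gen_zero_mul 0).symm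
    · exact ofQRing_co _
    · exact ofQRing_co _
    · exact (map_zero _).trans (entry_diag gen_zero_mul 1).symm
  · fin_cases i <;> fin_cases j
    · exact (map_zero _).trans (entry_diag gen_one_mul 0).symm
    · exact ofQRing_co _
    · exact ofQRing_co _
    · exact (map_zero _).trans (entry_diag gen_one_mul 1).symm
  · refine Eq.trans ?_ (entry_gen_two i j).symm
    fin_cases i <;> fin_cases j <;> simp [mat]

/-- The isomorphism from `rep_α Λ_c` to `rep_α Q`. -/
def canonicalForm : RepRing idem ≃ₐ[ℂ] QRing :=
  AlgEquiv.ofAlgHom toQRing ofQRing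
    (MvPolynomial.algHom_ext fun a => (congrArg toQRing (ofQRing_co a)).trans
      (toQRing_arrowEntry a))
    (RepRing.algHom_ext fun a i j => by
      rw [AlgHom.comp_apply, toQRing_entry]
      exact congrFun (congrFun (DFunLike.congr_fun mapMatrix_comp_toMatrix a) i) j)

theorem symm_quiverAct (g : GLα) (f : QRing) :
    canonicalForm.symm (quiverAct g f) = repAct idem g (canonicalForm.symm f) := by
  have key : ofQRing.comp (quiverAct g) = (repAct idem g).comp ofQRing := by
    refine MvPolynomial.algHom_ext fun a => ?_
    rw [AlgHom.comp_apply, AlgHom.comp_apply, quiverAct, MvPolynomial.aeval_X, map_smul,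
      ofQRing_co]
    cases a <;> exact (repAct_entry g _ _ _).symm
  exact DFunLike.congr_fun key f

theorem isCanonicalForm : IsCanonicalForm canonicalForm where
  matX := by
    ext1 i j
    exact (toQRing_entry _ _ _).trans (congrFun (congrFun (toMatrix_gen 0) i) j)
  matY := by
    ext1 i j
    exact (toQRing_entry _ _ _).trans (congrFun (congrFun (toMatrix_gen 1) i) j)
  matZ := by
    ext1 i j
    exact (toQRing_entry _ _ _).trans (congrFun (congrFun (toMatrix_gen 2) i) j)
  equivariant g f := by
    apply canonicalForm.symm.injective
    rw [symm_quiverAct, AlgEquiv.symm_apply_apply, AlgEquiv.symm_apply_apply]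

theorem symm_mem_semiInv {θ : Fin 2 → ℤ} {l : ℕ} {f : QRing} (hf : f ∈ semiInv quiverAct θ l) :
    canonicalForm.symm f ∈ semiInv (repAct idem) θ l := fun g => by
  rw [← symm_quiverAct, hf g, map_smul]

theorem mem_semiInv {θ : Fin 2 → ℤ} {l : ℕ} {f : RepRing idem}
    (hf : f ∈ semiInv (repAct idem) θ l) : canonicalForm f ∈ semiInv quiverAct θ l := fun g => by
  rw [← isCanonicalForm.equivariant, hf g, map_smul]

end ConifoldAlgebra

/-! ### Isomorphisms of graded rings -/

section GradedMap

variable {k A B : Type} [CommRing k] [CommRing A] [Algebra k A] [CommRing B] [Algebra k B]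
  {F : ℕ → Submodule k A} [SetLike.GradedMonoid F] {G : ℕ → Submodule k B}
  [SetLike.GradedMonoid G]

/-- The homomorphism of graded rings which applies `ψ` in every degree. -/
def gradedMap (ψ : A →ₐ[k] B) (h : ∀ l, ∀ f ∈ F l, ψ f ∈ G l) :
    GradedRingHom (grading F) (grading G) where
  toRingHom := (((Polynomial.mapAlgHom ψ).comp (gradedRing F).val).codRestrict (gradedRing G)
    fun s l => by
      rw [AlgHom.comp_apply]
      refine Set.mem_of_eq_of_mem ?_ (h l _ (s.2 l))
      exact Polynomial.coeff_map _ _).toRingHom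
  map_mem {n s} hs := fun m hm => by
    refine (Polynomial.coeff_map _ _).trans ?_
    refine (congrArg ψ (hs m hm)).trans (map_zero ψ)

theorem gradedMap_coeff (ψ : A →ₐ[k] B) (h : ∀ l, ∀ f ∈ F l, ψ f ∈ G l) (s : gradedRing F)
    (l : ℕ) : (gradedMap ψ h s).1.coeff l = ψ (s.1.coeff l) := Polynomial.coeff_map _ _

theorem gradedMap_homog (ψ : A →ₐ[k] B) (h : ∀ l, ∀ f ∈ F l, ψ f ∈ G l) (l : ℕ) (f : F l) :
    gradedMap ψ h (homog F l f) = homog G l ⟨ψ f, h l f f.2⟩ :=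
  Subtype.ext (Polynomial.map_monomial _)

variable (ψ : A ≃ₐ[k] B) (h : ∀ l, ∀ f ∈ F l, ψ f ∈ G l) (h' : ∀ l, ∀ f ∈ G l, ψ.symm f ∈ F l)

theorem gradedMap_symm_apply (s : gradedRing G) :
    gradedMap (ψ : A →ₐ[k] B) h (gradedMap (ψ.symm : B →ₐ[k] A) h' s) = s :=
  Subtype.ext (Polynomial.ext fun l => (gradedMap_coeff _ h _ l).trans
    ((congrArg ψ (gradedMap_coeff _ h' s l)).trans (ψ.apply_symm_apply _)))

include h' in
theorem irrelevant_le_map_gradedMap : HomogeneousIdeal.irrelevant (grading G) ≤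
    (HomogeneousIdeal.irrelevant (grading F)).map (gradedMap (ψ : A →ₐ[k] B) h) := by
  rw [← toIdeal_le_toIdeal_iff]
  refine (HomogeneousIdeal.toIdeal_irrelevant_le _).mpr fun i hi s hs => ?_
  refine Set.mem_of_eq_of_mem (gradedMap_symm_apply ψ h h' s).symm
    (Ideal.mem_map_of_mem (gradedMap (ψ : A →ₐ[k] B) h) ?_)
  exact HomogeneousIdeal.mem_irrelevant_of_mem _ hi
    ((gradedMap (ψ.symm : B →ₐ[k] A) h').map_mem hs)

theorem isIso_map_gradedMap : IsIso (Proj.map (gradedMap (ψ : A →ₐ[k] B) h)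
    (irrelevant_le_map_gradedMap ψ h h')) := by
  have h1 : (gradedMap (ψ : A →ₐ[k] B) h).comp (gradedMap (ψ.symm : B →ₐ[k] A) h') =
      GradedRingHom.id _ := GradedRingHom.ext fun s => gradedMap_symm_apply ψ h h' s
  have h2 : (gradedMap (ψ.symm : B →ₐ[k] A) h').comp (gradedMap (ψ : A →ₐ[k] B) h) =
      GradedRingHom.id _ := GradedRingHom.ext fun s => gradedMap_symm_apply ψ.symm h' h s
  refine ⟨Proj.map (gradedMap (ψ.symm : B →ₐ[k] A) h')
    (irrelevant_le_map_gradedMap ψ.symm h' h), ?_, ?_⟩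
  · rw [← Proj.map_comp]
    simp only [h1, Proj.map_id]
  · rw [← Proj.map_comp]
    simp only [h2, Proj.map_id]

end GradedMap

theorem inducesIsoOfModuli (θ : Fin 2 → ℤ) : InducesIsoOfModuli ConifoldAlgebra.canonicalForm θ :=
  ⟨_, _, fun s l => gradedMap_coeff _ _ s l,
    isIso_map_gradedMap ConifoldAlgebra.canonicalForm.symm
      (fun _ _ => ConifoldAlgebra.symm_mem_semiInv) fun _ _ => ConifoldAlgebra.mem_semiInv⟩

/-! ### Closed points of the moduli space of the quiver -/

/-- The closed point of affine space with the coordinates `c`. -/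
def affinePoint (c : Fin 3 → ℂ) : Spec (.of C3) :=
  ⟨RingHom.ker (MvPolynomial.aeval c : C3 →ₐ[ℂ] ℂ), RingHom.ker_isPrime _⟩

theorem mem_affinePoint {c : Fin 3 → ℂ} {g : C3} :
    g ∈ (affinePoint c).asIdeal ↔ MvPolynomial.aeval c g = 0 := Iff.rfl

theorem isClosed_affinePoint (c : Fin 3 → ℂ) : IsClosed ({affinePoint c} : Set (Spec (.of C3))) := by
  refine (PrimeSpectrum.isClosed_singleton_iff_isMaximal _).mpr ?_
  exact RingHom.ker_isMaximal_of_surjective _ fun z =>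
    ⟨MvPolynomial.C z, MvPolynomial.aeval_C _ _⟩

/-- This is the Nullstellensatz over `ℂ`. -/
theorem exists_affinePoint_eq {y : Spec (.of C3)} (hy : IsClosed ({y} : Set (Spec (.of C3)))) :
    ∃ c, y = affinePoint c := by
  have h1 := (PrimeSpectrum.isClosed_singleton_iff_isMaximal y).mp hy
  obtain ⟨c, hc⟩ := (MvPolynomial.isMaximal_iff_eq_vanishingIdeal_singleton).mp h1
  refine ⟨c, PrimeSpectrum.ext (hc.trans (Ideal.ext fun g => ?_))⟩
  rw [MvPolynomial.mem_vanishingIdeal_singleton_iff]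
  rfl

theorem affinePoint_injective : Function.Injective affinePoint := by
  intro c c' h
  ext i
  have h1 : (MvPolynomial.X i - MvPolynomial.C (c i) : C3) ∈ (affinePoint c).asIdeal := by
    rw [mem_affinePoint]
    simp
  rw [h, mem_affinePoint] at h1
  simp only [map_sub, MvPolynomial.aeval_X, MvPolynomial.aeval_C] at h1
  exact (sub_eq_zero.mp h1).symm

/-- The point of `Proj` of the ring of `θ`-semi-invariants is the image of the point of `rep_α Q`
with the coordinates `x`. -/
def Represents (θ : Fin 2 → ℤ) (x : Arrow → ℂ) (z : ModuliSpace quiverAct θ) : Prop :=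
  ∀ (l : ℕ) (f : semiInv quiverAct θ l),
    z ∈ Proj.basicOpen (grading (semiInv quiverAct θ)) (homog _ l f) ↔ MvPolynomial.aeval x f.1 ≠ 0

theorem eq_of_mem_basicOpen_iff {θ : Fin 2 → ℤ} {z z' : ModuliSpace quiverAct θ}
    (h : ∀ (l : ℕ) (f : semiInv quiverAct θ l),
      z ∈ Proj.basicOpen (grading (semiInv quiverAct θ)) (homog _ l f) ↔
      z' ∈ Proj.basicOpen (grading (semiInv quiverAct θ)) (homog _ l f)) : z = z' := by
  refine ProjectiveSpectrum.ext (HomogeneousIdeal.ext' fun l s hs => ?_)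
  rw [eq_homog_of_mem _ hs]
  have h1 := h l ⟨s.1.coeff l, s.2 l⟩
  rw [Proj.mem_basicOpen, Proj.mem_basicOpen] at h1
  exact not_iff_not.mp h1

theorem Represents.eq {θ : Fin 2 → ℤ} {x : Arrow → ℂ} {z z' : ModuliSpace quiverAct θ}
    (h : Represents θ x z) (h' : Represents θ x z') : z = z' :=
  eq_of_mem_basicOpen_iff fun l f => (h l f).trans (h' l f).symm

namespace Side

variable {θ : Fin 2 → ℤ} (s : Side θ)

/-- The coordinates on the chart `u ≠ 0` of a point of `rep_α Q`. -/
def point (x : Arrow → ℂ) : Spec (.of C3) :=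
  affinePoint ![x s.p * x s.u, x s.q * x s.u, x s.v / x s.u]

/-- By `aeval_point` the value of a semi-invariant at `x` is its value at `s.point x` times a power
of the nonzero number `x s.u`. -/
theorem represents_chart {x : Arrow → ℂ} (hx : x s.u ≠ 0) :
    Represents θ x (s.chart (s.point x)) := by
  intro l f
  have h1 : (IsSide.ev s.u s.v s.p s.q).toRingHom (co s.u) = 1 := s.isSide.ev_co.1
  refine (s.isSide.isChart.chart_mem_basicOpen_iff f (IsSide.ev s.u s.v s.p s.q f.1) ?_ _).trans ?_
  · rw [h1, one_pow, one_mul]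
    rfl
  · rw [point, mem_affinePoint, ← s.isSide.aeval_point hx f.2, ne_eq, mul_eq_zero, not_or]
    exact ⟨fun h => ⟨h, pow_ne_zero _ hx⟩, And.left⟩

theorem exists_represents {x : Arrow → ℂ} (hx : x s.u ≠ 0 ∨ x s.v ≠ 0) :
    ∃ z, Represents θ x z :=
  hx.elim (fun h => ⟨_, s.represents_chart h⟩) fun h => ⟨_, s.symm.represents_chart h⟩

theorem u_ne_zero_iff {x : Arrow → ℂ} {z : ModuliSpace quiverAct θ} (h : Represents θ x z) :
    z ∈ s.chart.opensRange ↔ x s.u ≠ 0 := by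
  rw [opensRange_chart]
  refine (h 1 _).trans ?_
  rw [MvPolynomial.aeval_X]

/-- A specialization of `z` lies in some chart. This chart is open, so it contains `z` as well, and
there `z` is a closed point of affine space. -/
theorem _root_.ConifoldModuli.Represents.isClosed (s : Side θ) {x : Arrow → ℂ}
    {z : ModuliSpace quiverAct θ} (h : Represents θ x z) :
    IsClosed ({z} : Set (ModuliSpace quiverAct θ)) := by
  have key : ∀ (s : Side θ) (z'), z ⤳ z' → z' ∈ s.chart.opensRange → z' = z := by
    rintro s _ hz ⟨y, rfl⟩
    have hx := (s.u_ne_zero_iff h).mp (hz.mem_open s.chart.opensRange.isOpen ⟨y, rfl⟩)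
    obtain rfl := h.eq (s.represents_chart hx)
    have h1 : s.point x ⤳ y := s.chart.isOpenEmbedding.isInducing.specializes_iff.mp hz
    have h2 : y ∈ ({s.point x} : Set _) := h1.mem_closed (isClosed_affinePoint _) rfl
    rw [Set.mem_singleton_iff.mp h2]
  refine isClosed_of_closure_subset fun z' hz => ?_
  have hz' := specializes_iff_mem_closure.mpr hz
  exact (s.mem_range_or z').elim (key _ _ hz') (key _ _ hz')

include s in
-- A closed point is closed in a chart that contains it, so it has coordinates `c`. The
-- representation normalized by `u = 1`, with `p = c 0`, `q = c 1` and `v = c 2`, lies over it.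
theorem exists_represents_of_isClosed {z : ModuliSpace quiverAct θ}
    (hz : IsClosed ({z} : Set (ModuliSpace quiverAct θ))) :
    ∃ x : Arrow → ℂ, (x s.u ≠ 0 ∨ x s.v ≠ 0) ∧ Represents θ x z := by
  have key : ∀ s : Side θ, z ∈ s.chart.opensRange →
      ∃ x : Arrow → ℂ, x s.u ≠ 0 ∧ Represents θ x z := by
    rintro s ⟨y, rfl⟩
    have hy : IsClosed ({y} : Set (Spec (.of C3))) := by
      have h1 : ({y} : Set (Spec (.of C3))) = s.chart ⁻¹' {s.chart y} := by
        ext y'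
        exact s.chart.isOpenEmbedding.injective.eq_iff.symm
      rw [h1]
      exact hz.preimage s.chart.continuous
    obtain ⟨c, rfl⟩ := exists_affinePoint_eq hy
    have hn := s.isSide.nodup
    simp only [List.nodup_cons, List.mem_cons, not_or, List.not_mem_nil, List.nodup_nil] at hn
    obtain ⟨⟨h1, h2, h3, -⟩, ⟨h4, h5, -⟩, ⟨h6, -⟩, -⟩ := hn
    let x : Arrow → ℂ := fun a => if a = s.u then 1 else if a = s.v then c 2 else
      if a = s.p then c 0 else c 1
    have hu : x s.u = 1 := if_pos rfl
    have hv : x s.v = c 2 := by simp [x, Ne.symm h1]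
    have hp : x s.p = c 0 := by simp [x, Ne.symm h2, Ne.symm h4]
    have hq : x s.q = c 1 := by simp [x, Ne.symm h3, Ne.symm h5, Ne.symm h6]
    have hx : x s.u ≠ 0 := hu.trans_ne one_ne_zero
    refine ⟨x, hx, ?_⟩
    have h7 := s.represents_chart hx
    have h8 : s.point x = affinePoint c := by
      rw [point, hu, hv, hp, hq]
      congr 1
      ext i
      fin_cases i <;> simp
    rwa [h8] at h7
  rcases s.mem_range_or z with h | h
  · obtain ⟨x, hx, hxz⟩ := key s h
    exact ⟨x, Or.inl hx, hxz⟩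
  · obtain ⟨x, hx, hxz⟩ := key s.symm h
    exact ⟨x, Or.inr hx, hxz⟩

/-- Points with the same image in the moduli space are in the same orbit. -/
theorem exists_scalar_of_represents {x x' : Arrow → ℂ} {z : ModuliSpace quiverAct θ}
    (h : Represents θ x z) (h' : Represents θ x' z) (hx : x s.u ≠ 0 ∨ x s.v ≠ 0) :
    ∃ c : ℂˣ, x' s.u = c * x s.u ∧ x' s.v = c * x s.v ∧ c * x' s.p = x s.p ∧
      c * x' s.q = x s.q := by
  have key : ∀ s : Side θ, x s.u ≠ 0 → ∃ c : ℂˣ, x' s.u = c * x s.u ∧ x' s.v = c * x s.v ∧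
      c * x' s.p = x s.p ∧ c * x' s.q = x s.q := by
    intro s hx
    have hx' := (s.u_ne_zero_iff h').mp ((s.u_ne_zero_iff h).mpr hx)
    have h1 := (s.represents_chart hx).eq h
    have h2 := (s.represents_chart hx').eq h'
    have h3 := affinePoint_injective (s.chart.isOpenEmbedding.injective (h1.trans h2.symm))
    have h4 := congrFun h3 0
    have h5 := congrFun h3 1
    have h6 := congrFun h3 2
    simp only [Matrix.cons_val] at h4 h5 h6
    -- The scalar is forced by its action on `u`; the equality of the chart coordinates `p u`, `q
    -- u`, `v / u` gives the other three equations.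
    refine ⟨Units.mk0 (x' s.u / x s.u) (div_ne_zero hx' hx), ?_, ?_, ?_, ?_⟩ <;>
      rw [Units.val_mk0]
    · field_simp
    · field_simp at h6 ⊢
      linear_combination -h6
    · field_simp
      linear_combination -h4
    · field_simp
      linear_combination -h5
  rcases hx with hx | hx
  · exact key s hx
  · obtain ⟨c, h1, h2, h3, h4⟩ := key s.symm hx
    exact ⟨c, h2, h1, h3, h4⟩

end Side

/-! ### Stability of representations of dimension vector `(1, 1)` -/

namespace Rep

section Stability

variable {Λ : Type} [Ring Λ] [Algebra ℂ Λ] {e : Fin 2 → Λ} (V : Rep e)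

/-- The line spanned by a vector of the standard basis. -/
def line (i : Fin 2) : Submodule ℂ (Fin 2 → ℂ) := Submodule.span ℂ {Pi.single i 1}

theorem mem_line {i j : Fin 2} (hij : i ≠ j) {w : Fin 2 → ℂ} : w ∈ line i ↔ w j = 0 := by
  rw [line, Submodule.mem_span_singleton]
  constructor
  · rintro ⟨c, rfl⟩
    simp [hij]
  · intro hw
    refine ⟨w i, ?_⟩
    ext k
    obtain rfl | rfl : k = i ∨ k = j := by omega
    · simp
    · simp [hij, hw]

theorem line_ne_top {i j : Fin 2} (hij : i ≠ j) : line i ≠ ⊤ := fun h => by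
  have h1 : (Pi.single j 1 : Fin 2 → ℂ) ∈ line i := h ▸ Submodule.mem_top
  rw [mem_line hij] at h1
  simp at h1

theorem isSubrep_line {i j : Fin 2} (hij : i ≠ j) :
    V.IsSubrep (line i) ↔ ∀ a, V.hom a j i = 0 := by
  constructor
  · intro h a
    have h1 := h a (Pi.single i 1) (Submodule.mem_span_singleton_self _)
    rw [mem_line hij] at h1
    simpa using h1
  · intro h a w hw
    obtain ⟨c, rfl⟩ := Submodule.mem_span_singleton.mp hw
    rw [mem_line hij]
    simp [Matrix.mulVec_smul, h a]

theorem dimVec_line (i j : Fin 2) : V.dimVec (line i) j = if i = j then 1 else 0 := by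
  rw [dimVec, line, Submodule.map_span, Set.image_singleton, V.map_idem]
  split_ifs with h
  · subst h
    refine finrank_span_singleton fun h0 => ?_
    have := congrFun h0 i
    simp at this
  · have h0 : (Matrix.single j j (1 : ℂ)).mulVecLin (Pi.single i 1) = 0 := by
      ext k
      simp [Ne.symm h]
    rw [h0, Submodule.span_zero_singleton, finrank_bot]

/-- The idempotent `e k` projects `w` to its `k`-th coordinate. -/
theorem mem_of_isSubrep {V : Rep e} {W : Submodule ℂ (Fin 2 → ℂ)} (hW : V.IsSubrep W)
    {w : Fin 2 → ℂ} (hw : w ∈ W) {k : Fin 2} (hk : w k ≠ 0) : line k ≤ W := by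
  have h1 := W.smul_mem (w k)⁻¹ (hW (e k) w hw)
  rw [V.map_idem] at h1
  rw [line, Submodule.span_singleton_le_iff_mem]
  have h2 : (Pi.single k 1 : Fin 2 → ℂ) = (w k)⁻¹ • (Matrix.single k k (1 : ℂ)).mulVec w := by
    ext m
    rw [Matrix.single_mulVec, Pi.smul_apply, one_mul]
    by_cases hm : m = k
    · subst hm; simp [hk]
    · simp [hm]
  rwa [h2]

/-- A subrepresentation contains the coordinate line of every nonzero coordinate of its vectors; if
it is proper, only one coordinate can occur. -/
theorem eq_line_of_isSubrep {V : Rep e} {W : Submodule ℂ (Fin 2 → ℂ)} (hW : V.IsSubrep W)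
    (h0 : W ≠ ⊥) (h1 : W ≠ ⊤) : ∃ k, W = line k := by
  obtain ⟨w, hw, hw0⟩ := Submodule.exists_mem_ne_zero_of_ne_bot h0
  obtain ⟨k, hk⟩ := Function.ne_iff.mp hw0
  refine ⟨k, le_antisymm (fun w' hw' => ?_) (mem_of_isSubrep hW hw hk)⟩
  rw [mem_line (j := k.rev) (by fin_cases k <;> decide)]
  by_contra hk'
  refine h1 (eq_top_iff.mpr fun t _ => ?_)
  have ht : t = t k • Pi.single k 1 + t k.rev • Pi.single k.rev 1 := by
    ext m
    fin_cases k <;> fin_cases m <;> simp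
  rw [ht]
  exact W.add_mem
    (W.smul_mem _ (mem_of_isSubrep hW hw hk (Submodule.mem_span_singleton_self _)))
    (W.smul_mem _ (mem_of_isSubrep hW hw' hk' (Submodule.mem_span_singleton_self _)))

theorem sum_dimVec_line (θ : Fin 2 → ℤ) (i : Fin 2) :
    ∑ k, θ k * (V.dimVec (line i) k : ℤ) = θ i := by
  simp [dimVec_line]

variable {θ : Fin 2 → ℤ} {i j : Fin 2}

theorem IsStable.isSemistable {V : Rep e} (h : V.IsStable θ) : V.IsSemistable θ := by
  intro W hW h1
  by_cases h0 : W = ⊥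
  · subst h0
    refine (Finset.sum_eq_zero fun k _ => ?_).ge
    rw [dimVec, Submodule.map_bot, finrank_bot, Nat.cast_zero, mul_zero]
  · exact (h W hW h0 h1).le

/-- Otherwise the line of the vertex `i` is a subrepresentation on which `θ` has the value `-1`. -/
theorem IsSemistable.exists_ne_zero {V : Rep e} (h : V.IsSemistable θ) (hij : i ≠ j)
    (hi : θ i = -1) : ∃ a, V.hom a j i ≠ 0 := by
  by_contra! h0
  have h1 := h _ ((V.isSubrep_line hij).mpr h0) (line_ne_top hij)
  rw [sum_dimVec_line, hi] at h1
  omega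

/-- Only the two coordinate lines can be proper nonzero subrepresentations. The nonzero entry
excludes that of `i`, and on that of `j` the value of `θ` is `1`. -/
theorem isStable_of_ne_zero {V : Rep e} (hij : i ≠ j) (hj : θ j = 1) {a : Λ}
    (ha : V.hom a j i ≠ 0) : V.IsStable θ := by
  intro W hW h0 h1
  obtain ⟨k, rfl⟩ := eq_line_of_isSubrep hW h0 h1
  rw [sum_dimVec_line]
  obtain rfl | rfl : k = i ∨ k = j := by omega
  · exact absurd ((V.isSubrep_line hij).mp hW a) ha
  · omega

/-- A change of basis does not change the points in the moduli spaces. -/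
theorem Iso.exists_eval_eq {V V' : Rep e} (h : V.Iso V') :
    ∃ g, ∀ f, V'.eval f = V.eval (repAct e g f) := by
  obtain ⟨P, hP⟩ := h
  -- Compatibility with the idempotents forces `P` to be diagonal, that is, an element of `GL(α)`.
  have hoff : ∀ m k, m ≠ k → P.1 m k = 0 := fun m k hmk => by
    have h1 := congrFun (congrFun (hP (e k)) m) k
    rw [V.map_idem, V'.map_idem, Matrix.mul_single_apply_same, mul_one] at h1
    rw [h1]
    exact Matrix.single_mul_apply_of_ne _ _ _ _ _ hmk _
  have hdiag : P.1 = Matrix.diagonal fun k => P.1 k k := by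
    ext m k
    by_cases hmk : m = k
    · subst hmk; simp
    · rw [Matrix.diagonal_apply_ne _ hmk, hoff m k hmk]
  have hne : ∀ k, P.1 k k ≠ 0 := fun k => by
    have h1 := P.det_ne_zero
    change P.1.det ≠ 0 at h1
    rw [hdiag, Matrix.det_diagonal] at h1
    exact (Finset.prod_ne_zero_iff.mp h1) k (Finset.mem_univ k)
  refine ⟨fun k => Units.mk0 (P.1 k k) (hne k), fun f => ?_⟩
  have key : V'.eval = V.eval.comp (repAct e fun k => Units.mk0 (P.1 k k) (hne k)) := by
    refine RepRing.algHom_ext fun a m k => ?_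
    rw [AlgHom.comp_apply, repAct_entry, map_smul, eval_entry, eval_entry]
    have h1 := congrFun (congrFun (hP a) m) k
    rw [hdiag, Matrix.diagonal_mul, Matrix.mul_diagonal] at h1
    rw [Units.val_mul, Units.val_inv_eq_inv_val, Units.val_mk0, Units.val_mk0, smul_eq_mul]
    have := hne k
    field_simp
    exact h1.symm
  exact DFunLike.congr_fun key f

theorem Iso.represents {V V' : Rep e} (h : V.Iso V') {z : ModuliSpace (repAct e) θ}
    (hz : V.Represents θ z) : V'.Represents θ z := by
  obtain ⟨g, hg⟩ := h.exists_eval_eq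
  intro l f
  rw [hz l f, hg, f.2 g, map_smul, smul_ne_zero_iff]
  exact ⟨fun h => ⟨Units.ne_zero _, h⟩, And.right⟩

end Stability

end Rep

/-! ### Representations of the conifold algebra and of the quiver -/

namespace ConifoldAlgebra

/-- The coordinates of a representation. -/
def coords (V : Rep idem) (a : Arrow) : ℂ := V.eval (arrowEntry a)

theorem eval_symm (V : Rep idem) (f : QRing) :
    V.eval (canonicalForm.symm f) = MvPolynomial.aeval (coords V) f := by
  have key : V.eval.comp ofQRing = MvPolynomial.aeval (coords V) := by
    refine MvPolynomial.algHom_ext fun a => ?_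
    rw [AlgHom.comp_apply, MvPolynomial.aeval_X]
    exact congrArg V.eval (ofQRing_co a)
  exact DFunLike.congr_fun key f

theorem eval_eq (V : Rep idem) (f : RepRing idem) :
    V.eval f = MvPolynomial.aeval (coords V) (canonicalForm f) := by
  rw [← eval_symm, AlgEquiv.symm_apply_apply]

theorem hom_apply (V : Rep idem) (a : ConifoldAlgebra) (i j : Fin 2) :
    V.hom a i j = MvPolynomial.aeval (coords V) (toMatrix a i j) := by
  rw [← Rep.eval_entry, eval_eq]
  exact congrArg _ (toQRing_entry a i j)

/-- The representation with the coordinates `x`. -/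
def ofCoords (x : Arrow → ℂ) : Rep idem where
  hom := (MvPolynomial.aeval x).mapMatrix.comp toMatrix
  map_idem i := by
    rw [AlgHom.comp_apply, toMatrix_idem]
    ext m k
    simp [Matrix.single_apply]

theorem coords_ofCoords (x : Arrow → ℂ) : coords (ofCoords x) = x := by
  ext a
  have h : ∀ b m k, (ofCoords x).eval (RepRing.entry idem b m k) =
      MvPolynomial.aeval x (toMatrix b m k) := fun b m k => Rep.eval_entry _ _ _ _
  cases a <;> refine (h _ _ _).trans ?_ <;> rw [toMatrix_gen] <;> exact MvPolynomial.aeval_X _ _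

/-- Representations in the same orbit are isomorphic. -/
theorem iso_of_coords {V V' : Rep idem} (g : GLα)
    (h : ∀ a : Arrow, coords V' a * g a.src = g a.tgt * coords V a) : V.Iso V' := by
  let d : Fin 2 → ℂ := fun k => g k
  have hd : IsUnit (Matrix.diagonal d) := by
    rw [Matrix.isUnit_diagonal, Pi.isUnit_iff]
    exact fun k => (g k).isUnit
  refine ⟨hd.unit, fun a => ?_⟩
  rw [IsUnit.unit_spec]
  -- The elements which the diagonal matrix intertwines form a subalgebra, so only the generators
  -- have to be checked.
  let S : Subalgebra ℂ ConifoldAlgebra :=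
    { carrier := {a | Matrix.diagonal d * V.hom a = V'.hom a * Matrix.diagonal d}
      mul_mem' := fun {a b} ha hb => by
        have ha' : Matrix.diagonal d * V.hom a = V'.hom a * Matrix.diagonal d := ha
        have hb' : Matrix.diagonal d * V.hom b = V'.hom b * Matrix.diagonal d := hb
        change Matrix.diagonal d * V.hom (a * b) = V'.hom (a * b) * Matrix.diagonal d
        rw [map_mul, map_mul, ← mul_assoc, ha', mul_assoc, hb', mul_assoc]
      add_mem' := fun {a b} ha hb => by
        have ha' : Matrix.diagonal d * V.hom a = V'.hom a * Matrix.diagonal d := ha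
        have hb' : Matrix.diagonal d * V.hom b = V'.hom b * Matrix.diagonal d := hb
        change Matrix.diagonal d * V.hom (a + b) = V'.hom (a + b) * Matrix.diagonal d
        rw [map_add, map_add, mul_add, add_mul, ha', hb']
      algebraMap_mem' := fun c => by
        change Matrix.diagonal d * V.hom (algebraMap ℂ _ c) =
          V'.hom (algebraMap ℂ _ c) * Matrix.diagonal d
        rw [AlgHom.commutes, AlgHom.commutes, Algebra.commutes] }
  refine mem_of_gen_mem (S := S) (fun k => ?_) a
  change Matrix.diagonal d * V.hom (gen k) = V'.hom (gen k) * Matrix.diagonal d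
  ext m n
  rw [Matrix.diagonal_mul, Matrix.mul_diagonal, hom_apply, hom_apply, toMatrix_gen]
  have h1 := h .x₂
  have h2 := h .x₃
  have h3 := h .y₂
  have h4 := h .y₃
  simp only [Arrow.src, Arrow.tgt] at h1 h2 h3 h4
  fin_cases k <;> fin_cases m <;> fin_cases n <;> simp [mat, d, h1, h2, h3, h4]

end ConifoldAlgebra

/-! ### Comparison of the points of the two moduli spaces -/

namespace ConifoldAlgebra

/-- The isomorphism of the moduli spaces. -/
def moduliMap (θ : Fin 2 → ℤ) : ModuliSpace (repAct idem) θ ⟶ ModuliSpace quiverAct θ :=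
  Proj.map (gradedMap (canonicalForm.symm : QRing →ₐ[ℂ] RepRing idem)
    fun _ _ => symm_mem_semiInv) (irrelevant_le_map_gradedMap canonicalForm.symm _
      fun _ _ => mem_semiInv)

instance (θ : Fin 2 → ℤ) : IsIso (moduliMap θ) := 
  isIso_map_gradedMap canonicalForm.symm _ fun _ _ => mem_semiInv

theorem moduliMap_mem_basicOpen {θ : Fin 2 → ℤ} (z : ModuliSpace (repAct idem) θ) {l : ℕ}
    (f : semiInv quiverAct θ l) :
    moduliMap θ z ∈ Proj.basicOpen (grading (semiInv quiverAct θ)) (homog _ l f) ↔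
      z ∈ Proj.basicOpen (grading (semiInv (repAct idem) θ))
        (homog _ l ⟨canonicalForm.symm f, symm_mem_semiInv f.2⟩) :=
  iff_of_eq (congrArg (fun s => z ∈ Proj.basicOpen (grading (semiInv (repAct idem) θ)) s)
    (gradedMap_homog _ (fun _ _ => symm_mem_semiInv) l f))

theorem represents_iff {θ : Fin 2 → ℤ} (V : Rep idem) (z : ModuliSpace (repAct idem) θ) :
    V.Represents θ z ↔ Represents θ (coords V) (moduliMap θ z) := by
  constructor
  · intro h l f
    rw [moduliMap_mem_basicOpen, h l, eval_symm]
  · intro h l f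
    have h1 := h l ⟨canonicalForm f, mem_semiInv f.2⟩
    rw [moduliMap_mem_basicOpen, ← eval_eq] at h1
    simpa only [AlgEquiv.symm_apply_apply] using h1

theorem moduliMap_bijective (θ : Fin 2 → ℤ) : Function.Bijective (moduliMap θ) :=
  (Scheme.homeoOfIso (asIso (moduliMap θ))).bijective

theorem isClosed_moduliMap_iff {θ : Fin 2 → ℤ} (z : ModuliSpace (repAct idem) θ) :
    IsClosed ({moduliMap θ z} : Set (ModuliSpace quiverAct θ)) ↔
      IsClosed ({z} : Set (ModuliSpace (repAct idem) θ)) := by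
  rw [← (Scheme.homeoOfIso (asIso (moduliMap θ))).isClosed_image, Set.image_singleton]
  rfl

theorem exists_hom_eq (V : Rep idem) (b : Arrow) : ∃ a, V.hom a b.tgt b.src = coords V b := by
  cases b <;> exact ⟨_, (Rep.eval_entry V _ _ _).symm⟩

/-- The elements with vanishing entry `(j, i)` act by triangular matrices and form a subalgebra, so
the generators suffice. -/
theorem hom_eq_zero {V : Rep idem} {i j : Fin 2} (hij : i ≠ j)
    (h : ∀ b : Arrow, b.src = i → coords V b = 0) (a : ConifoldAlgebra) : V.hom a j i = 0 := by
  let S : Subalgebra ℂ ConifoldAlgebra :=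
    { carrier := {a | V.hom a j i = 0}
      mul_mem' := fun {a b} ha hb => by
        have ha' : V.hom a j i = 0 := ha
        have hb' : V.hom b j i = 0 := hb
        change V.hom (a * b) j i = 0
        rw [map_mul, Matrix.mul_apply]
        refine Finset.sum_eq_zero fun m _ => ?_
        obtain rfl | rfl : m = i ∨ m = j := by omega
        · rw [ha', zero_mul]
        · rw [hb', mul_zero]
      add_mem' := fun {a b} ha hb => by
        have ha' : V.hom a j i = 0 := ha
        have hb' : V.hom b j i = 0 := hb
        change V.hom (a + b) j i = 0
        rw [map_add, Matrix.add_apply, ha', hb', add_zero]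
      algebraMap_mem' := fun c => by
        change V.hom (algebraMap ℂ _ c) j i = 0
        rw [AlgHom.commutes, Matrix.algebraMap_matrix_apply, if_neg hij.symm] }
  refine mem_of_gen_mem (S := S) (fun k => ?_) a
  change V.hom (gen k) j i = 0
  rw [hom_apply, toMatrix_gen]
  have h1 := h .x₂
  have h2 := h .x₃
  have h3 := h .y₂
  have h4 := h .y₃
  simp only [Arrow.src] at h1 h2 h3 h4
  fin_cases k <;> fin_cases j <;> fin_cases i <;>
    first | exact absurd rfl hij | simp_all [mat]

end ConifoldAlgebra

/-! ### Stable representations and closed points -/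

namespace Side

variable {θ : Fin 2 → ℤ} (s : Side θ) {i j : Fin 2}

include s in
/-- The moduli space of the conifold algebra classifies the stable representations. -/
theorem classifiesStable (hij : i ≠ j) (hi : θ i = -1) (hj : θ j = 1)
    (hu : s.u.src = i ∧ s.u.tgt = j) (hv : s.v.src = i ∧ s.v.tgt = j)
    (hp : s.p.src = j ∧ s.p.tgt = i) (hq : s.q.src = j ∧ s.q.tgt = i) :
    ClassifiesStable ConifoldAlgebra.idem θ := by
  have hcases : ∀ b : Arrow, b = s.u ∨ b = s.v ∨ b = s.p ∨ b = s.q := fun b => by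
    have := Finset.mem_univ b
    rw [s.isSide.univ_eq] at this
    simpa using this
  -- As `u` and `v` are the arrows from `i` to `j`, stability and semistability are both equivalent
  -- to `u ≠ 0` or `v ≠ 0`: the next two claims close the circle.
  have hof : ∀ V : Rep ConifoldAlgebra.idem,
      ConifoldAlgebra.coords V s.u ≠ 0 ∨ ConifoldAlgebra.coords V s.v ≠ 0 → V.IsStable θ := by
    rintro V (h | h)
    · obtain ⟨a, ha⟩ := ConifoldAlgebra.exists_hom_eq V s.u
      rw [hu.1, hu.2] at ha
      exact Rep.isStable_of_ne_zero hij hj (ha.trans_ne h)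
    · obtain ⟨a, ha⟩ := ConifoldAlgebra.exists_hom_eq V s.v
      rw [hv.1, hv.2] at ha
      exact Rep.isStable_of_ne_zero hij hj (ha.trans_ne h)
  have hto : ∀ V : Rep ConifoldAlgebra.idem, V.IsSemistable θ →
      ConifoldAlgebra.coords V s.u ≠ 0 ∨ ConifoldAlgebra.coords V s.v ≠ 0 := by
    intro V h
    obtain ⟨a, ha⟩ := h.exists_ne_zero hij hi
    by_contra! h0
    refine ha (ConifoldAlgebra.hom_eq_zero hij (fun b hb => ?_) a)
    rcases hcases b with rfl | rfl | rfl | rfl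
    · exact h0.1
    · exact h0.2
    · exact absurd (hb.symm.trans hp.1) hij
    · exact absurd (hb.symm.trans hq.1) hij
  refine ⟨fun V => ⟨Rep.IsStable.isSemistable, fun h => hof V (hto V h)⟩, fun V hV => ?_,
    fun V z _ hz => ?_, fun z hz => ?_, fun V V' z hV _ hz => ⟨fun hz' => ?_, fun h => ?_⟩⟩
  · obtain ⟨z, hz⟩ := s.exists_represents (hto V hV.isSemistable)
    obtain ⟨z, rfl⟩ := (ConifoldAlgebra.moduliMap_bijective θ).2 z
    refine ⟨z, (ConifoldAlgebra.represents_iff V z).mpr hz, fun z' hz' => ?_⟩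
    exact (ConifoldAlgebra.moduliMap_bijective θ).1
      (((ConifoldAlgebra.represents_iff V z').mp hz').eq hz)
  · exact (ConifoldAlgebra.isClosed_moduliMap_iff z).mp
      (((ConifoldAlgebra.represents_iff V z).mp hz).isClosed s)
  · obtain ⟨x, hx, hxz⟩ := s.exists_represents_of_isClosed
      ((ConifoldAlgebra.isClosed_moduliMap_iff z).mpr hz)
    rw [← ConifoldAlgebra.coords_ofCoords x] at hx hxz
    exact ⟨_, hof _ hx, (ConifoldAlgebra.represents_iff _ z).mpr hxz⟩
  · obtain ⟨c, h1, h2, h3, h4⟩ := s.exists_scalar_of_represents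
      ((ConifoldAlgebra.represents_iff V z).mp hz) ((ConifoldAlgebra.represents_iff V' z).mp hz')
      (hto V hV.isSemistable)
    -- The scalar `c` at the vertex `j` and `1` at `i` multiply `u`, `v` by `c` and `p`, `q` by its
    -- inverse.
    refine ConifoldAlgebra.iso_of_coords (fun k => if k = j then c else 1) fun b => ?_
    rcases hcases b with rfl | rfl | rfl | rfl
    · simp [hu, hij, h1]
    · simp [hv, hij, h2]
    · simp [hp, hij, ← h3, mul_comm]
    · simp [hq, hij, ← h4, mul_comm]
  · exact h.represents hz

end Side

end ConifoldModuli

end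

theorem mainTheorem8 :
    -- the representation scheme of the conifold algebra is that of the quiver
    (∃ Ψ : ConifoldModuli.RepRing ConifoldModuli.ConifoldAlgebra.idem ≃ₐ[ℂ] ConifoldModuli.QRing,
      ConifoldModuli.IsCanonicalForm Ψ ∧
      ConifoldModuli.InducesIsoOfModuli Ψ ![-1, 1] ∧
      ConifoldModuli.InducesIsoOfModuli Ψ ![1, -1]) ∧
    -- the stability structure (-1, 1)
    ConifoldModuli.ClassifiesStable ConifoldModuli.ConifoldAlgebra.idem ![-1, 1] ∧
    ConifoldModuli.SemiInvRingDescription ![-1, 1] .x₃ .y₃ ∧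
    ConifoldModuli.IsSubvarietyDescription ![-1, 1] .x₃ .y₃ ConifoldModuli.equations ∧
    ConifoldModuli.IsSmallResolution (ConifoldModuli.toConifold ![-1, 1]) ∧
    -- the stability structure (1, -1)
    ConifoldModuli.ClassifiesStable ConifoldModuli.ConifoldAlgebra.idem ![1, -1] ∧
    ConifoldModuli.SemiInvRingDescription ![1, -1] .x₂ .y₂ ∧
    ConifoldModuli.IsSubvarietyDescription ![1, -1] .x₂ .y₂ ConifoldModuli.equations' ∧
    ConifoldModuli.IsSmallResolution (ConifoldModuli.toConifold ![1, -1]) ∧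
    -- the two resolutions are related by the Atiyah flop
    ConifoldModuli.IsAtiyahFlop (ConifoldModuli.toConifold ![-1, 1])
      (ConifoldModuli.toConifold ![1, -1]) := by
  have hn : (-![-1, 1] : Fin 2 → ℤ) = ![1, -1] := by decide
  have h := ConifoldModuli.isSide
  have h' := ConifoldModuli.isSide'
  let s : ConifoldModuli.Side ![-1, 1] := ⟨_, _, _, _, _, h⟩
  let s' : ConifoldModuli.Side ![1, -1] := ⟨_, _, _, _, _, h'⟩
  have hf := s.isAtiyahFlop
  rw [hn] at hf
  exact ⟨⟨ConifoldModuli.ConifoldAlgebra.canonicalForm,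
      ConifoldModuli.ConifoldAlgebra.isCanonicalForm, ConifoldModuli.inducesIsoOfModuli _,
      ConifoldModuli.inducesIsoOfModuli _⟩,
    s.classifiesStable zero_ne_one rfl rfl ⟨rfl, rfl⟩ ⟨rfl, rfl⟩ ⟨rfl, rfl⟩ ⟨rfl, rfl⟩,
    h.semiInvRingDescription, ConifoldModuli.equationsPerm_one ▸ h.isSubvarietyDescription,
    s.isSmallResolution,
    s'.classifiesStable one_ne_zero rfl rfl ⟨rfl, rfl⟩ ⟨rfl, rfl⟩ ⟨rfl, rfl⟩ ⟨rfl, rfl⟩,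
    h'.semiInvRingDescription, ConifoldModuli.equationsPerm_swap ▸ h'.isSubvarietyDescription,
    s'.isSmallResolution, hf⟩
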